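/- Let $M$ be a closed smooth manifold with a foliation, i.e. an integrable subbundle $H\subseteq TM$ of rank $p$; let $N=TM/H$ (of rank $q$) and let $\pi\colon H^*\oplus N^*\to M$ be the projection. Let $E,F$ be smooth complex vector bundles over $M$ with Hermitian metrics, and let $P\colon C^\infty(E)\to C^\infty(F)$ be a differential operator of weighted order $d\ge 1$: in foliation coordinates $x_1,\dots,x_{p+q}$ (such that $H$ is spanned by $\partial_1,\dots,\partial_p$) and local trivializations, $P=\sum_{\|\alpha\|\le d}a_\alpha(x)\partial^\alpha$, where $\|\alpha\|=\alpha_1+\dots+\alpha_p+2(\alpha_{p+1}+\dots+\alpha_{p+q})$. Let $\sigma=\sigma_H(P)\colon\pi^*E\to\pi^*F$ be its weighted principal symbol, $\sigma(x,\xi)=\sum_{\|\alpha\|=d}a_\alpha(x)(i\xi)^\alpha$ for $\xi\in H_x^*\oplus N_x^*$, and suppose that $\sigma(x,\xi)$ is invertible whenever $\xi\ne0$. Let $X=H^*\oplus N^*$. Let $K_0(C_0(X))$ be the kernel of $K_0(C_0(X)^+)\to K_0(\mathbb C)$, where $C_0(X)^+$ is the unitization and $K_0$ of a unital algebra is the Grothendieck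 group of Murray–von Neumann classes of projections in matrices over it. Let $K^0(X)$ be topological $K$-theory with compact supports: the abelian group generated by the triples $[E_0,E_1,\tau]$ of two complex vector bundles over $X$ and an isomorphism $\tau\colon E_0\to E_1$ defined outside a compact set, where direct sum is addition, isomorphic triples and triples with homotopic $\tau$ are equal, and a triple is zero if its $\tau$ is an isomorphism over all of $X$. Let $\Phi\colon K_0(C_0(X))\to K^0(X)$ be the canonical map (the well-known isomorphism), which is induced by $[e]\mapsto[\operatorname{range}e,\operatorname{range}e(\infty),e(\infty)]$ for projections $e$ over $C_0(X)^+$. For $y\in X$ let $e_\sigma(y)$ be the orthogonal projection of $(\pi^*E\oplus\pi^*F)_y$ onto the graph of $\sigma(y)$. Then $(\pi^*E,\pi^*F,\sigma)$ is such a triple, and $e_\sigma-\begin{pmatrix}0&0\\0&1\end{pmatrix}$ vanishes at infinity. Consequently there is a class $$[\sigma_H(P)]=[e_\sigma]\ominus\Big[\begin{pmatrix}0&0\\0&1\end{pmatrix}\Big]\in K_0(C_0(X)),$$ computed as follows: choose isometric embeddings $E\subseteq M\times\mathbb C^a$, $F\subseteq M\times\mathbb C^b$ (these exist), regard $e_\sigma-\begin{pmatrix}0&0\\0&1\end{pmatrix}$,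 extended by zero on the orthogonal complement of $\pi^*E\oplus\pi^*F$, as an $(a+b)\times(a+b)$ matrix over $C_0(X)$, add to it the constant projection $1_b$ onto $\mathbb C^b$ to obtain a projection $e$ over $C_0(X)^+$, and take $[e]-[1_b]$. For every choice of the embeddings, $$\Phi\big([\sigma_H(P)]\big)=[\pi^*E,\pi^*F,\sigma_H(P)]\in K^0(H^*\oplus N^*).$$ -/

import Mathlib

open scoped Manifold ContDiff Topology ZeroAtInfty Matrix
open Bundle Set Filter

universe u v

/-! ### Complex vector bundles (of locally constant rank) -/

/-- A complex vector bundle over `X`: a family of complex vector spaces together with a topology on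
the total space which is locally isomorphic to a product `U × ℂⁿ` (`n` may vary with `U`). -/
structure CBundle (X : Type u) [TopologicalSpace X] where
  Fiber : X → Type v
  [addCommGroup : ∀ x, AddCommGroup (Fiber x)]
  [module : ∀ x, Module ℂ (Fiber x)]
  [top : TopologicalSpace (TotalSpace Unit Fiber)]
  continuous_proj : Continuous (TotalSpace.proj : TotalSpace Unit Fiber → X)
  locally_trivial : ∀ x, ∃ U : Set X, IsOpen U ∧ x ∈ U ∧ ∃ (n : ℕ)
    (T : ∀ y, Fiber y →ₗ[ℂ] (Fin n → ℂ)) (S : ∀ y, (Fin n → ℂ) →ₗ[ℂ] Fiber y),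
    (∀ y ∈ U, (∀ v, S y (T y v) = v) ∧ ∀ w, T y (S y w) = w) ∧
    ContinuousOn (fun e : TotalSpace Unit Fiber => T e.proj e.snd) (TotalSpace.proj ⁻¹' U) ∧
    ContinuousOn (fun z : X × (Fin n → ℂ) => (⟨z.1, S z.1 z.2⟩ : TotalSpace Unit Fiber))
      (U ×ˢ univ)

namespace CBundle

attribute [instance] CBundle.addCommGroup CBundle.module CBundle.top

variable {X : Type u} [TopologicalSpace X]

/-- The total space. -/
abbrev Total (B : CBundle.{u, v} X) : Type (max u v) := TotalSpace Unit B.Fiber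

/-- A fibrewise linear map is continuous over the set `S`. -/
def ContOn (B B' : CBundle.{u, v} X) (f : ∀ x, B.Fiber x →ₗ[ℂ] B'.Fiber x) (S : Set X) : Prop :=
  ContinuousOn (fun e : B.Total => (⟨e.proj, f e.proj e.snd⟩ : B'.Total)) (TotalSpace.proj ⁻¹' S)

/-- Isomorphisms of vector bundles over `X`. -/
structure Iso (B B' : CBundle.{u, v} X) where
  toFun : ∀ x, B.Fiber x →ₗ[ℂ] B'.Fiber x
  invFun : ∀ x, B'.Fiber x →ₗ[ℂ] B.Fiber x
  left_inv : ∀ x w, invFun x (toFun x w) = w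
  right_inv : ∀ x w, toFun x (invFun x w) = w
  cont_toFun : ContOn B B' toFun univ
  cont_invFun : ContOn B' B invFun univ

/-- The direct sum of two bundles. -/
def sum (B B' : CBundle.{u, v} X) : CBundle.{u, v} X :=
  letI t : TopologicalSpace (TotalSpace Unit fun x => B.Fiber x × B'.Fiber x) :=
    TopologicalSpace.induced
      (fun e => ((⟨e.proj, e.snd.1⟩ : B.Total), (⟨e.proj, e.snd.2⟩ : B'.Total))) inferInstance
  { Fiber := fun x => B.Fiber x × B'.Fiber x
    top := t
    continuous_proj := by
      have c0 : Continuous (fun e : TotalSpace Unit (fun x => B.Fiber x × B'.Fiber x) =>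
          ((⟨e.proj, e.snd.1⟩ : B.Total), (⟨e.proj, e.snd.2⟩ : B'.Total))) :=
        continuous_induced_dom
      exact B.continuous_proj.comp (continuous_fst.comp c0)
    locally_trivial := by
      intro x
      obtain ⟨U, hU, hxU, n, T, S, hTS, hT, hS⟩ := B.locally_trivial x
      obtain ⟨U', hU', hxU', n', T', S', hTS', hT', hS'⟩ := B'.locally_trivial x
      have c0 : Continuous (fun e : TotalSpace Unit (fun x => B.Fiber x × B'.Fiber x) =>
          ((⟨e.proj, e.snd.1⟩ : B.Total), (⟨e.proj, e.snd.2⟩ : B'.Total))) :=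
        continuous_induced_dom
      let r : ((Fin n → ℂ) × (Fin n' → ℂ)) ≃L[ℂ] (Fin (n + n') → ℂ) :=
        ((LinearEquiv.sumArrowLequivProdArrow (Fin n) (Fin n') ℂ ℂ).symm.trans
          (LinearEquiv.funCongrLeft ℂ ℂ finSumFinEquiv.symm)).toContinuousLinearEquiv
      refine ⟨U ∩ U', hU.inter hU', ⟨hxU, hxU'⟩, n + n',
        fun y => r.toLinearMap ∘ₗ ((T y).prodMap (T' y)),
        fun y => ((S y).prodMap (S' y)) ∘ₗ r.symm.toLinearMap, ?_, ?_, ?_⟩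
      · intro y hy
        refine ⟨fun w => ?_, fun w => ?_⟩
        · simp [(hTS y hy.1).1, (hTS' y hy.2).1]
        · have : (T y (S y (r.symm w).1), T' y (S' y (r.symm w).2)) = r.symm w := by
            rw [(hTS y hy.1).2, (hTS' y hy.2).2]
          simp [this]
      · refine r.continuous.comp_continuousOn (ContinuousOn.prodMk ?_ ?_)
        · exact hT.comp (continuous_fst.comp c0).continuousOn fun e he => he.1
        · exact hT'.comp (continuous_snd.comp c0).continuousOn fun e he => he.2
      · have hr := r.symm.continuous
        rw [(Topology.IsInducing.induced _ : @Topology.IsInducing _ _ t _ _).continuousOn_iff]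
        refine ContinuousOn.prodMk ?_ ?_
        · refine hS.comp (f := fun z : X × (Fin (n + n') → ℂ) => (z.1, (r.symm z.2).1))
            (Continuous.continuousOn (by fun_prop)) fun z hz => ⟨hz.1.1, mem_univ _⟩
        · refine hS'.comp (f := fun z : X × (Fin (n + n') → ℂ) => (z.1, (r.symm z.2).2))
            (Continuous.continuousOn (by fun_prop)) fun z hz => ⟨hz.1.2, mem_univ _⟩ }

/-- The pull-back of a bundle along a continuous map. -/
def pullback {Y : Type*} [TopologicalSpace Y] (f : C(X, Y)) (B : CBundle Y) : CBundle X :=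
  letI t : TopologicalSpace (TotalSpace Unit fun x => B.Fiber (f x)) :=
    TopologicalSpace.induced
      (fun e => (e.proj, (⟨f e.proj, e.snd⟩ : B.Total))) inferInstance
  { Fiber := fun x => B.Fiber (f x)
    top := t
    continuous_proj := by
      have c0 : Continuous (fun e : TotalSpace Unit (fun x => B.Fiber (f x)) =>
          (e.proj, (⟨f e.proj, e.snd⟩ : B.Total))) := continuous_induced_dom
      exact continuous_fst.comp c0
    locally_trivial := by
      intro x
      obtain ⟨U, hU, hxU, n, T, S, hTS, hT, hS⟩ := B.locally_trivial (f x)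
      have c0 : Continuous (fun e : TotalSpace Unit (fun x => B.Fiber (f x)) =>
          (e.proj, (⟨f e.proj, e.snd⟩ : B.Total))) := continuous_induced_dom
      refine ⟨f ⁻¹' U, hU.preimage f.continuous, hxU, n, fun y => T (f y), fun y => S (f y),
        fun y hy => hTS _ hy, ?_, ?_⟩
      · exact hT.comp (continuous_snd.comp c0).continuousOn fun e he => he
      · rw [(Topology.IsInducing.induced _ : @Topology.IsInducing _ _ t _ _).continuousOn_iff]
        refine ContinuousOn.prodMk continuousOn_fst ?_
        exact hS.comp (f := fun z : X × (Fin n → ℂ) => (f z.1, z.2))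
            (Continuous.continuousOn (by fun_prop)) fun z hz => ⟨hz.1, mem_univ _⟩ }

/-- A vector bundle in the sense of Mathlib, as an object of `CBundle`. -/
def ofBundle (V : Type*) [NormedAddCommGroup V] [NormedSpace ℂ V] [FiniteDimensional ℂ V]
    (E : X → Type v) [∀ x, AddCommGroup (E x)] [∀ x, Module ℂ (E x)]
    [∀ x, TopologicalSpace (E x)] [TopologicalSpace (TotalSpace V E)] [FiberBundle V E]
    [VectorBundle ℂ V E] : CBundle.{u, v} X :=
  letI t : TopologicalSpace (TotalSpace Unit E) :=
    TopologicalSpace.induced (fun e => (⟨e.proj, e.snd⟩ : TotalSpace V E)) inferInstance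
  { Fiber := E
    top := t
    continuous_proj := by
      have c0 : Continuous (fun e : TotalSpace Unit E => (⟨e.proj, e.snd⟩ : TotalSpace V E)) :=
        continuous_induced_dom
      exact (FiberBundle.continuous_proj V E).comp c0
    locally_trivial := by
      intro x
      let e := trivializationAt V E x
      have c0 : Continuous (fun e : TotalSpace Unit E => (⟨e.proj, e.snd⟩ : TotalSpace V E)) :=
        continuous_induced_dom
      let r : V ≃L[ℂ] (Fin (Module.finrank ℂ V) → ℂ) :=
        (Module.finBasis ℂ V).equivFun.toContinuousLinearEquiv
      refine ⟨e.baseSet, e.open_baseSet, FiberBundle.mem_baseSet_trivializationAt V E x, _,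
        fun y => r.toLinearMap ∘ₗ (e.linearMapAt ℂ y),
        fun y => (e.symmₗ ℂ y) ∘ₗ r.symm.toLinearMap, ?_, ?_, ?_⟩
      · intro y hy
        refine ⟨fun w => ?_, fun w => ?_⟩
        · simp [e.symmₗ_linearMapAt hy]
        · simp [e.linearMapAt_symmₗ hy]
      · refine r.continuous.comp_continuousOn ?_
        have h1 : ContinuousOn (fun z : TotalSpace V E => (e z).2) e.source :=
          continuous_snd.comp_continuousOn e.continuousOn
        refine (h1.comp c0.continuousOn fun z hz => ?_).congr fun z hz => ?_
        · exact e.mem_source.2 hz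
        · exact congrFun (e.coe_linearMapAt_of_mem (R := ℂ) hz) _
      · rw [(Topology.IsInducing.induced _ : @Topology.IsInducing _ _ t _ _).continuousOn_iff]
        have h2 : ContinuousOn (fun z : X × (Fin (Module.finrank ℂ V) → ℂ) => (z.1, r.symm z.2))
            (e.baseSet ×ˢ univ) :=
          (continuous_fst.prodMk (r.symm.continuous.comp continuous_snd)).continuousOn
        exact (e.continuousOn_symm.comp h2 fun z hz => ⟨hz.1, mem_univ _⟩).congr
          fun z hz => by simp [e.symmₗ_apply hz.1] }

end CBundle

namespace CBundle

variable {X : Type u} [TopologicalSpace X]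

/-- The range of a continuous family of idempotent matrices, as a subbundle of the trivial
bundle. -/
noncomputable def image {ι : Type} [Fintype ι] [DecidableEq ι] (P : X → Matrix ι ι ℂ) (hP : Continuous P)
    (hi : ∀ x, IsIdempotentElem (P x)) : CBundle.{u, v} X :=
  letI t : TopologicalSpace
      (TotalSpace Unit fun x => ULift.{v} (LinearMap.range (P x).mulVecLin)) :=
    TopologicalSpace.induced (fun e => (e.proj, (e.snd.down : ι → ℂ))) inferInstance
  have c0 : Continuous
      (fun e : TotalSpace Unit (fun x => ULift.{v} (LinearMap.range (P x).mulVecLin)) =>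
        (e.proj, (e.snd.down : ι → ℂ))) := continuous_induced_dom
  { Fiber := fun x => ULift.{v} (LinearMap.range (P x).mulVecLin)
    top := t
    continuous_proj := continuous_fst.comp c0
    locally_trivial := by
      intro x
      have hfix : ∀ y (w : LinearMap.range (P y).mulVecLin), P y *ᵥ (w : ι → ℂ) = w := by
        rintro y ⟨_, w, rfl⟩
        simp only [Matrix.mulVecLin_apply, Matrix.mulVec_mulVec]
        rw [(hi y).eq]
      let g : X → Matrix ι ι ℂ := fun y => P x * P y + (1 - P x) * (1 - P y)
      have hg : Continuous g := by fun_prop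
      have hgx : g x = 1 := by
        have h1 : P x * P x = P x := (hi x).eq
        simp only [g, mul_sub, sub_mul, mul_one, one_mul, h1]
        abel
      have hgP : ∀ y, g y * P y = P x * g y := by
        intro y
        have h1 : P x * P x = P x := (hi x).eq
        have h2 : P y * P y = P y := (hi y).eq
        simp only [g, mul_add, add_mul, mul_sub, sub_mul, mul_one, one_mul, mul_assoc, h2]
        simp only [← mul_assoc, h1]
        abel
      let r : LinearMap.range (P x).mulVecLin ≃L[ℂ]
          (Fin (Module.finrank ℂ (LinearMap.range (P x).mulVecLin)) → ℂ) :=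
        (Module.finBasis ℂ (LinearMap.range (P x).mulVecLin)).equivFun.toContinuousLinearEquiv
      let U : Set X := {y | (g y).det ≠ 0}
      have hU : IsOpen U := isOpen_ne_fun hg.matrix_det continuous_const
      have hginv : ContinuousOn (fun y => (g y)⁻¹) U := by
        have : (fun y => (g y)⁻¹) = fun y => (g y).det⁻¹ • (g y).adjugate := by
          funext y; rw [Matrix.inv_def, Ring.inverse_eq_inv']
        rw [this]
        exact (hg.matrix_det.continuousOn.inv₀ fun y hy => hy).smul hg.matrix_adjugate.continuousOn
      refine ⟨U, hU, by simp [U, hgx], _,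
        fun y => r.toLinearMap ∘ₗ ((P x).mulVecLin.rangeRestrict ∘ₗ
          ((LinearMap.range (P y).mulVecLin).subtype ∘ₗ ULift.moduleEquiv.toLinearMap)),
        fun y => ULift.moduleEquiv.symm.toLinearMap ∘ₗ ((P y).mulVecLin.rangeRestrict ∘ₗ
          ((g y)⁻¹.mulVecLin ∘ₗ
            ((LinearMap.range (P x).mulVecLin).subtype ∘ₗ r.symm.toLinearMap))), ?_, ?_, ?_⟩
      · intro y hy
        have hu : IsUnit (g y).det := isUnit_iff_ne_zero.2 hy
        refine ⟨fun w => ?_, fun w => ?_⟩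
        · apply ULift.down_injective
          apply Subtype.ext
          have hw := hfix y w.down
          have h1 : g y *ᵥ (w.down : ι → ℂ) = P x *ᵥ (w.down : ι → ℂ) := by
            rw [← hw, Matrix.mulVec_mulVec, hgP, ← Matrix.mulVec_mulVec]
            nth_rewrite 1 [← hw]
            simp only [g, Matrix.mulVec_mulVec]
            have h1 : P x * P x = P x := (hi x).eq
            have h2 : P y * P y = P y := (hi y).eq
            congr 1
            simp only [mul_add, add_mul, mul_sub, sub_mul, mul_one, one_mul, mul_assoc, h2]
            simp only [← mul_assoc, h1]
            abel
          have h2 : (g y)⁻¹ *ᵥ (P x *ᵥ (w.down : ι → ℂ)) = w.down := by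
            rw [← h1, Matrix.mulVec_mulVec, Matrix.nonsing_inv_mul _ hu, Matrix.one_mulVec]
          simp [h2, hw]
        · apply r.symm.injective
          apply Subtype.ext
          have hw := hfix x (r.symm w)
          have h1 : P x *ᵥ (P y *ᵥ ((g y)⁻¹ *ᵥ (r.symm w : ι → ℂ))) = r.symm w := by
            have h3 : P x * (P y * (g y)⁻¹) = P x := by
              have h4 : P x * P y = P x * g y := by
                have h1 : P x * P x = P x := (hi x).eq
                simp only [g, mul_add, mul_sub, sub_mul, mul_one, one_mul]
                simp only [← mul_assoc, h1]
                abel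
              rw [← mul_assoc, h4, mul_assoc, Matrix.mul_nonsing_inv _ hu, mul_one]
            rw [Matrix.mulVec_mulVec, Matrix.mulVec_mulVec, mul_assoc, h3, hw]
          simpa using h1
      · refine r.continuous.comp_continuousOn (Continuous.continuousOn ?_)
        refine Continuous.subtype_mk ?_ _
        exact Continuous.matrix_mulVec continuous_const (continuous_snd.comp c0)
      · rw [(Topology.IsInducing.induced _ : @Topology.IsInducing _ _ t _ _).continuousOn_iff]
        refine ContinuousOn.prodMk continuousOn_fst ?_
        have h1 : ContinuousOn (fun z : X × (Fin (Module.finrank ℂ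
            (LinearMap.range (P x).mulVecLin)) → ℂ) => (g z.1)⁻¹) (U ×ˢ univ) :=
          hginv.comp continuousOn_fst fun z hz => hz.1
        have h2 : Continuous (fun z : X × (Fin (Module.finrank ℂ
            (LinearMap.range (P x).mulVecLin)) → ℂ) => (r.symm z.2 : ι → ℂ)) :=
          continuous_subtype_val.comp (r.symm.continuous.comp continuous_snd)
        have h3 : ContinuousOn (fun z : X × (Fin (Module.finrank ℂ
            (LinearMap.range (P x).mulVecLin)) → ℂ) =>
              P z.1 *ᵥ ((g z.1)⁻¹ *ᵥ (r.symm z.2 : ι → ℂ))) (U ×ˢ univ) := by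
          have hm : Continuous (fun t : (Matrix ι ι ℂ × Matrix ι ι ℂ) × (ι → ℂ) =>
              t.1.1 *ᵥ (t.1.2 *ᵥ t.2)) := by fun_prop
          exact hm.comp_continuousOn
            (((hP.comp continuous_fst).continuousOn.prodMk h1).prodMk h2.continuousOn)
        exact h3 }

end CBundle

/-! ### Topological `K`-theory with compact supports -/

/-- A triple `[E₀, E₁, σ]`: two complex vector bundles over `X` and an isomorphism between them
which is defined outside a compact set (the values of `σ` on the compact set play no role). -/
structure KTriple (X : Type u) [TopologicalSpace X] where
  E₀ : CBundle.{u, v} X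
  E₁ : CBundle.{u, v} X
  σ : ∀ x, E₀.Fiber x →ₗ[ℂ] E₁.Fiber x
  iso_off_compact : ∃ K : Set X, IsCompact K ∧ CBundle.ContOn E₀ E₁ σ Kᶜ ∧
    ∀ x ∉ K, Function.Bijective (σ x)

namespace KTriple

variable {X : Type u} [TopologicalSpace X]

/-- Direct sum of triples. -/
def sum (T T' : KTriple.{u, v} X) : KTriple.{u, v} X where
  E₀ := T.E₀.sum T'.E₀
  E₁ := T.E₁.sum T'.E₁
  σ := fun x => (T.σ x).prodMap (T'.σ x)
  iso_off_compact := by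
    obtain ⟨K, hK, hc, hb⟩ := T.iso_off_compact
    obtain ⟨K', hK', hc', hb'⟩ := T'.iso_off_compact
    refine ⟨K ∪ K', hK.union hK', ?_, ?_⟩
    · have c0 : Continuous (fun e : (T.E₀.sum T'.E₀).Total =>
          ((⟨e.proj, e.snd.1⟩ : T.E₀.Total), (⟨e.proj, e.snd.2⟩ : T'.E₀.Total))) :=
        continuous_induced_dom
      have hi : Topology.IsInducing (fun e : (T.E₁.sum T'.E₁).Total =>
          ((⟨e.proj, e.snd.1⟩ : T.E₁.Total), (⟨e.proj, e.snd.2⟩ : T'.E₁.Total))) := ⟨rfl⟩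
      unfold CBundle.ContOn
      rw [hi.continuousOn_iff]
      refine ContinuousOn.prodMk ?_ ?_
      · exact hc.comp (continuous_fst.comp c0).continuousOn fun e he h => he (Or.inl h)
      · exact hc'.comp (continuous_snd.comp c0).continuousOn fun e he h => he (Or.inr h)
    · intro x hx
      exact (hb x fun h => hx (Or.inl h)).prodMap (hb' x fun h => hx (Or.inr h))

/-- Isomorphism of triples: bundle isomorphisms over `X` which intertwine `σ` and `σ'` outside a
compact set. -/
def IsIso (T T' : KTriple.{u, v} X) : Prop :=
  ∃ (f₀ : T.E₀.Iso T'.E₀) (f₁ : T.E₁.Iso T'.E₁) (K : Set X), IsCompact K ∧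
    ∀ x ∉ K, ∀ w, f₁.toFun x (T.σ x w) = T'.σ x (f₀.toFun x w)

/-- `σ₀` and `σ₁` are homotopic through isomorphisms `E₀ → E₁` defined outside a fixed compact
set. -/
def Homotopic {E₀ E₁ : CBundle.{u, v} X} (σ₀ σ₁ : ∀ x, E₀.Fiber x →ₗ[ℂ] E₁.Fiber x) : Prop :=
  ∃ (s : ℝ → ∀ x, E₀.Fiber x →ₗ[ℂ] E₁.Fiber x) (K : Set X), IsCompact K ∧
    ContinuousOn (fun z : ℝ × E₀.Total => (⟨z.2.proj, s z.1 z.2.proj z.2.snd⟩ : E₁.Total))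
      (Icc 0 1 ×ˢ (TotalSpace.proj ⁻¹' Kᶜ)) ∧
    (∀ t ∈ Icc (0 : ℝ) 1, ∀ x ∉ K, Function.Bijective (s t x)) ∧
    ∀ x ∉ K, s 0 x = σ₀ x ∧ s 1 x = σ₁ x

/-- The relations between triples that hold in `K⁰(X)`. -/
inductive Rel : FreeAbelianGroup (KTriple.{u, v} X) → Prop
  | sum (T T' : KTriple X) : Rel (.of (T.sum T') - (.of T + .of T'))
  | iso (T T' : KTriple X) (h : T.IsIso T') : Rel (.of T - .of T')
  | homotopy (E₀ E₁ : CBundle X) (σ σ' : ∀ x, E₀.Fiber x →ₗ[ℂ] E₁.Fiber x) (h h')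
      (H : Homotopic σ σ') : Rel (.of ⟨E₀, E₁, σ, h⟩ - .of ⟨E₀, E₁, σ', h'⟩)
  | degenerate (T : KTriple X) (hc : CBundle.ContOn T.E₀ T.E₁ T.σ univ)
      (hb : ∀ x, Function.Bijective (T.σ x)) : Rel (.of T)

end KTriple

/-- `K⁰(X)`, the topological `K`-theory of `X` with compact supports: the abelian group generated
by the triples, in which direct sum is addition, isomorphic and homotopic triples are equal, and
triples whose `σ` is an isomorphism over all of `X` are zero. -/
def KTop (X : Type u) [TopologicalSpace X] : Type (max u (v + 1)) :=
  FreeAbelianGroup (KTriple.{u, v} X) ⧸ AddSubgroup.closure {z | KTriple.Rel.{u, v} (X := X) z}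

instance (X : Type u) [TopologicalSpace X] : AddCommGroup (KTop.{u, v} X) :=
  inferInstanceAs (AddCommGroup (_ ⧸ AddSubgroup.closure {z | KTriple.Rel.{u, v} (X := X) z}))

/-- The class of a triple. -/
def KTop.mk {X : Type u} [TopologicalSpace X] (T : KTriple.{u, v} X) : KTop.{u, v} X :=
  QuotientAddGroup.mk (FreeAbelianGroup.of T)

theorem KTop.eq_zero_of_rel {X : Type u} [TopologicalSpace X]
    {z : FreeAbelianGroup (KTriple.{u, v} X)} (h : KTriple.Rel z) :
    (QuotientAddGroup.mk z : KTop.{u, v} X) = 0 :=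
  (QuotientAddGroup.eq_zero_iff _).2 (AddSubgroup.subset_closure h)

theorem KTop.mk_sum {X : Type u} [TopologicalSpace X] (T T' : KTriple.{u, v} X) :
    KTop.mk (T.sum T') = KTop.mk T + KTop.mk T' :=
  sub_eq_zero.1 (KTop.eq_zero_of_rel (.sum T T'))

theorem KTop.mk_iso {X : Type u} [TopologicalSpace X] {T T' : KTriple.{u, v} X}
    (h : T.IsIso T') : KTop.mk T = KTop.mk T' :=
  sub_eq_zero.1 (KTop.eq_zero_of_rel (.iso T T' h))

theorem KTop.mk_homotopy {X : Type u} [TopologicalSpace X] {E₀ E₁ : CBundle.{u, v} X}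
    {σ σ' : ∀ x, E₀.Fiber x →ₗ[ℂ] E₁.Fiber x} (h h') (H : KTriple.Homotopic σ σ') :
    KTop.mk ⟨E₀, E₁, σ, h⟩ = KTop.mk ⟨E₀, E₁, σ', h'⟩ :=
  sub_eq_zero.1 (KTop.eq_zero_of_rel (.homotopy E₀ E₁ σ σ' h h' H))

/-! ### `K`-theory of algebras, by projections -/

/-- A projection in a matrix algebra over `B`. -/
structure MatProj (B : Type*) [Ring B] [StarRing B] where
  n : ℕ
  mat : Matrix (Fin n) (Fin n) B
  isProj : IsStarProjection mat

namespace MatProj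

variable {B : Type*} [Ring B] [StarRing B]

/-- A projection in matrices indexed by `ι`, after an enumeration of `ι`. -/
def ofMatrix {ι : Type*} [Fintype ι] [DecidableEq ι] {n : ℕ} (e : ι ≃ Fin n) (P : Matrix ι ι B)
    (hP : IsStarProjection P) : MatProj B where
  n := n
  mat := P.submatrix e.symm e.symm
  isProj := by
    constructor
    · have h : P * P = P := hP.isIdempotentElem
      change P.submatrix e.symm e.symm * P.submatrix e.symm e.symm = _
      rw [Matrix.submatrix_mul_equiv, h]
    · have h : Pᴴ = P := hP.isSelfAdjoint
      change (P.submatrix e.symm e.symm)ᴴ = _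
      rw [Matrix.conjTranspose_submatrix, h]

/-- The block sum `diag(p, q)`. -/
def sum (p q : MatProj B) : MatProj B :=
  ofMatrix finSumFinEquiv (Matrix.fromBlocks p.mat 0 0 q.mat) (by
    constructor
    · have hp : p.mat * p.mat = p.mat := p.isProj.isIdempotentElem
      have hq : q.mat * q.mat = q.mat := q.isProj.isIdempotentElem
      change Matrix.fromBlocks p.mat 0 0 q.mat * Matrix.fromBlocks p.mat 0 0 q.mat = _
      simp [Matrix.fromBlocks_multiply, hp, hq]
    · have hp : p.matᴴ = p.mat := p.isProj.isSelfAdjoint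
      have hq : q.matᴴ = q.mat := q.isProj.isSelfAdjoint
      change (Matrix.fromBlocks p.mat 0 0 q.mat)ᴴ = _
      simp [Matrix.fromBlocks_conjTranspose, hp, hq])

/-- Murray–von Neumann equivalence. -/
def Equivalent (p q : MatProj B) : Prop :=
  ∃ w : Matrix (Fin q.n) (Fin p.n) B, wᴴ * w = p.mat ∧ w * wᴴ = q.mat

/-- The image of a projection under a `*`-homomorphism. -/
def map {C : Type*} [Ring C] [StarRing C] [Algebra ℂ B] [Algebra ℂ C] (f : B →⋆ₐ[ℂ] C)
    (p : MatProj B) : MatProj C where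
  n := p.n
  mat := p.mat.map f
  isProj := by
    constructor
    · have h : p.mat * p.mat = p.mat := p.isProj.isIdempotentElem
      change p.mat.map f * p.mat.map f = _
      rw [← Matrix.map_mul, h]
    · have h : p.matᴴ = p.mat := p.isProj.isSelfAdjoint
      change (p.mat.map f)ᴴ = _
      rw [← Matrix.conjTranspose_map f (fun b => map_star f b), h]

/-- The relations in the Grothendieck group of projections. -/
inductive Rel : FreeAbelianGroup (MatProj B) → Prop
  | sum (p q : MatProj B) : Rel (.of (p.sum q) - (.of p + .of q))
  | equiv (p q : MatProj B) (h : p.Equivalent q) : Rel (.of p - .of q)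

end MatProj

/-- The Grothendieck group of Murray–von Neumann classes of projections in matrices over `B`, i.e.
`K₀(B)` for a unital `C*`-algebra `B`. -/
def K00 (B : Type*) [Ring B] [StarRing B] : Type _ :=
  FreeAbelianGroup (MatProj B) ⧸ AddSubgroup.closure {z | MatProj.Rel (B := B) z}

instance (B : Type*) [Ring B] [StarRing B] : AddCommGroup (K00 B) :=
  inferInstanceAs (AddCommGroup (_ ⧸ AddSubgroup.closure {z | MatProj.Rel (B := B) z}))

namespace K00

variable {B : Type*} [Ring B] [StarRing B]

/-- The class of a projection. -/
def mk (p : MatProj B) : K00 B := QuotientAddGroup.mk (FreeAbelianGroup.of p)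

/-- The universal property of `K00 B`. -/
def lift {G : Type*} [AddCommGroup G] (f : MatProj B → G)
    (hs : ∀ p q, f (p.sum q) = f p + f q) (he : ∀ p q, p.Equivalent q → f p = f q) : K00 B →+ G :=
  QuotientAddGroup.lift _ (FreeAbelianGroup.lift f) ((AddSubgroup.closure_le _).2 (by
    rintro _ (⟨p, q⟩ | ⟨p, q, h⟩)
    · simp [hs]
    · simp [he p q h]))

theorem mk_sum (p q : MatProj B) : mk (p.sum q) = mk p + mk q :=
  sub_eq_zero.1 ((QuotientAddGroup.eq_zero_iff _).2 (AddSubgroup.subset_closure (.sum p q)))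

theorem mk_equiv {p q : MatProj B} (h : p.Equivalent q) : mk p = mk q :=
  sub_eq_zero.1 ((QuotientAddGroup.eq_zero_iff _).2 (AddSubgroup.subset_closure (.equiv p q h)))

/-- Functoriality for `*`-homomorphisms. -/
def map {C : Type*} [Ring C] [StarRing C] [Algebra ℂ B] [Algebra ℂ C] (f : B →⋆ₐ[ℂ] C) :
    K00 B →+ K00 C :=
  lift (fun p => mk (p.map f))
    (fun p q => by
      rw [← mk_sum]
      congr 1
      simp only [MatProj.map, MatProj.sum, MatProj.ofMatrix]
      congr 1
      rw [← Matrix.submatrix_map, Matrix.fromBlocks_map]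
      simp
      rfl)
    (fun p q ⟨w, h₁, h₂⟩ => by
      have h₁' : (w.map f)ᴴ * w.map f = p.mat.map f := by
        rw [← Matrix.conjTranspose_map f (fun b => map_star f b), ← Matrix.map_mul, h₁]
      have h₂' : w.map f * (w.map f)ᴴ = q.mat.map f := by
        rw [← Matrix.conjTranspose_map f (fun b => map_star f b), ← Matrix.map_mul, h₂]
      exact mk_equiv ⟨w.map f, h₁', h₂'⟩)

theorem map_mk {C : Type*} [Ring C] [StarRing C] [Algebra ℂ B] [Algebra ℂ C] (f : B →⋆ₐ[ℂ] C)
    (p : MatProj B) : map f (mk p) = mk (p.map f) :=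
  FreeAbelianGroup.lift_apply_of _ _

end K00

section K0

variable (A : Type*) [NonUnitalRing A] [StarRing A] [Module ℂ A] [IsScalarTower ℂ A A]
  [SMulCommClass ℂ A A] [StarModule ℂ A]

/-- The canonical character `A⁺ → ℂ` of the unitization, with kernel `A`. -/
def scalarPart : Unitization ℂ A →⋆ₐ[ℂ] ℂ :=
  { Unitization.fstHom ℂ A with map_star' := fun _ => rfl }

/-- `K₀(A) = ker (K₀(A⁺) → K₀(ℂ))`. -/
def K0 : AddSubgroup (K00 (Unitization ℂ A)) := (K00.map (scalarPart A)).ker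

variable {A}

/-- The formal difference `[P] ⊖ [Q] ∈ K₀(A)` of two projections over `A⁺` with `P - Q` a matrix
over `A`. -/
def K0.diff {ι : Type*} [Fintype ι] [DecidableEq ι] {n : ℕ} (e : ι ≃ Fin n)
    (P Q : Matrix ι ι (Unitization ℂ A)) (hP : IsStarProjection P) (hQ : IsStarProjection Q)
    (h : P.map (scalarPart A) = Q.map (scalarPart A)) : K0 A :=
  ⟨K00.mk (.ofMatrix e P hP) - K00.mk (.ofMatrix e Q hQ), by
    have : (MatProj.ofMatrix e P hP).map (scalarPart A) =
        (MatProj.ofMatrix e Q hQ).map (scalarPart A) := by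
      simp only [MatProj.map, MatProj.ofMatrix]
      congr 1
      rw [← Matrix.submatrix_map, h, Matrix.submatrix_map]
    simp only [K0, AddMonoidHom.mem_ker, map_sub, K00.map_mk, this, sub_self]⟩

end K0

/-! ### The canonical map `K₀(C₀(X)) → K⁰(X)` -/

section Canonical

set_option linter.unusedSectionVars false

variable {X : Type u} [TopologicalSpace X]

/-- Evaluation at a point as a character of the unitization of `C₀(X)`. -/
noncomputable def evalAt (x : X) : Unitization ℂ C₀(X, ℂ) →⋆ₐ[ℂ] ℂ :=
  Unitization.starLift
    { toFun := fun f => f x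
      map_smul' := fun _ _ => rfl
      map_zero' := rfl
      map_add' := fun _ _ => rfl
      map_mul' := fun _ _ => rfl
      map_star' := fun _ => rfl }

theorem evalAt_apply (x : X) (f : Unitization ℂ C₀(X, ℂ)) : evalAt x f = f.fst + f.snd x := rfl

theorem continuous_evalAt {ι κ : Type*} (P : Matrix ι κ (Unitization ℂ C₀(X, ℂ))) :
    Continuous fun x => P.map (evalAt x) :=
  continuous_matrix fun i j => by
    simp only [Matrix.map_apply, evalAt_apply]
    exact continuous_const.add (map_continuous _)

theorem tendsto_evalAt {ι κ : Type*} (P : Matrix ι κ (Unitization ℂ C₀(X, ℂ))) :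
    Tendsto (fun x => P.map (evalAt x)) (cocompact X) (𝓝 (P.map (scalarPart C₀(X, ℂ)))) := by
  refine tendsto_pi_nhds.2 fun i => tendsto_pi_nhds.2 fun j => ?_
  have h := (zero_at_infty (P i j).snd).const_add (P i j).fst
  rw [add_zero] at h
  exact h

theorem isIdempotentElem_map {ι : Type*} [Fintype ι] [DecidableEq ι] {B C : Type*} [Ring B]
    [Ring C] [StarRing B] [StarRing C] [Algebra ℂ B] [Algebra ℂ C] (f : B →⋆ₐ[ℂ] C)
    {P : Matrix ι ι B} (hP : IsIdempotentElem P) : IsIdempotentElem (P.map f) := by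
  change P.map f * P.map f = P.map f
  rw [← Matrix.map_mul, hP.eq]

namespace CBundle

variable {ι κ : Type} [Fintype ι] [DecidableEq ι] [Fintype κ] [DecidableEq κ]

/-- The map `w ↦ Q N w` from the range of the matrix `P` to the range of `Q`. -/
noncomputable def rangeMap (P : Matrix ι ι ℂ) (Q : Matrix κ κ ℂ) (N : Matrix κ ι ℂ) :
    ULift.{v} (LinearMap.range P.mulVecLin) →ₗ[ℂ] ULift.{v} (LinearMap.range Q.mulVecLin) :=
  ULift.moduleEquiv.symm.toLinearMap ∘ₗ Q.mulVecLin.rangeRestrict ∘ₗ N.mulVecLin ∘ₗ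
    (LinearMap.range P.mulVecLin).subtype ∘ₗ ULift.moduleEquiv.toLinearMap

theorem rangeMap_apply (P : Matrix ι ι ℂ) (Q : Matrix κ κ ℂ) (N : Matrix κ ι ℂ)
    (w : ULift.{v} (LinearMap.range P.mulVecLin)) :
    ((rangeMap P Q N w).down : κ → ℂ) = Q *ᵥ (N *ᵥ (w.down : ι → ℂ)) := rfl

theorem mulVec_range {P : Matrix ι ι ℂ} (hP : IsIdempotentElem P)
    (w : LinearMap.range P.mulVecLin) : P *ᵥ (w : ι → ℂ) = w := by
  obtain ⟨_, w, rfl⟩ := w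
  simp only [Matrix.mulVecLin_apply, Matrix.mulVec_mulVec]
  rw [hP.eq]

theorem range_ext {P : Matrix ι ι ℂ} {w w' : ULift.{v} (LinearMap.range P.mulVecLin)}
    (h : (w.down : ι → ℂ) = w'.down) : w = w' :=
  ULift.down_injective (Subtype.ext h)

theorem rangeMap_bijective {P Q N : Matrix ι ι ℂ} (hP : IsIdempotentElem P)
    (hQ : IsIdempotentElem Q) (h : (Q * N * P + (1 - Q) * (1 - P)).det ≠ 0) :
    Function.Bijective (rangeMap.{v} P Q N) := by
  set g := Q * N * P + (1 - Q) * (1 - P) with hg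
  have hu : IsUnit g.det := isUnit_iff_ne_zero.2 h
  have hgP : g * P = Q * N * P := by
    have h1 : P * P = P := hP.eq
    rw [hg]
    simp only [add_mul, mul_assoc, sub_mul, one_mul, h1, sub_self, mul_zero, add_zero]
  have hQg : Q * g = Q * N * P := by
    have h1 : Q * Q = Q := hQ.eq
    rw [hg]
    simp only [mul_add, ← mul_assoc, mul_sub, mul_one, h1, sub_self, zero_mul, add_zero]
  constructor
  · refine (injective_iff_map_eq_zero _).2 fun w hw => range_ext ?_
    have h1 : Q *ᵥ (N *ᵥ (w.down : ι → ℂ)) = 0 := by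
      rw [← rangeMap_apply, hw]; rfl
    have h2 : g *ᵥ (w.down : ι → ℂ) = 0 := by
      rw [← mulVec_range hP w.down, Matrix.mulVec_mulVec, hgP, ← Matrix.mulVec_mulVec,
        mulVec_range hP, ← Matrix.mulVec_mulVec, h1]
    rw [← Matrix.one_mulVec (w.down : ι → ℂ), ← Matrix.nonsing_inv_mul _ hu,
      ← Matrix.mulVec_mulVec, h2, Matrix.mulVec_zero]
    rfl
  · intro z
    refine ⟨⟨P *ᵥ (g⁻¹ *ᵥ (z.down : ι → ℂ)), ⟨_, rfl⟩⟩, range_ext ?_⟩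
    rw [rangeMap_apply]
    change Q *ᵥ (N *ᵥ (P *ᵥ (g⁻¹ *ᵥ (z.down : ι → ℂ)))) = _
    rw [Matrix.mulVec_mulVec, Matrix.mulVec_mulVec, ← hQg, Matrix.mulVec_mulVec,
      mul_assoc, Matrix.mul_nonsing_inv _ hu, mul_one, mulVec_range hQ]

theorem contOn_rangeMap {P : X → Matrix ι ι ℂ} {Q : X → Matrix κ κ ℂ} (hP : Continuous P)
    (hQ : Continuous Q) (hPi : ∀ x, IsIdempotentElem (P x)) (hQi : ∀ x, IsIdempotentElem (Q x))
    {N : ℝ → X → Matrix κ ι ℂ} (hN : Continuous fun z : ℝ × X => N z.1 z.2) :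
    Continuous (fun z : ℝ × (image.{u, v} P hP hPi).Total =>
      (⟨z.2.proj, rangeMap (P z.2.proj) (Q z.2.proj) (N z.1 z.2.proj) z.2.snd⟩ :
        (image.{u, v} Q hQ hQi).Total)) := by
  have c0 : Continuous (fun e : (image.{u, v} P hP hPi).Total =>
      (e.proj, (e.snd.down : ι → ℂ))) := continuous_induced_dom
  have hi : Topology.IsInducing (fun e : (image.{u, v} Q hQ hQi).Total =>
      (e.proj, (e.snd.down : κ → ℂ))) := ⟨rfl⟩
  have c1 : Continuous (fun z : ℝ × (image.{u, v} P hP hPi).Total => z.2.proj) :=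
    (image.{u, v} P hP hPi).continuous_proj.comp continuous_snd
  rw [hi.continuous_iff]
  refine c1.prodMk ?_
  exact (hQ.comp c1).matrix_mulVec ((hN.comp (continuous_fst.prodMk c1)).matrix_mulVec
    (continuous_snd.comp (c0.comp continuous_snd)))

theorem contOn_rangeMap' {P : X → Matrix ι ι ℂ} {Q : X → Matrix κ κ ℂ} (hP : Continuous P)
    (hQ : Continuous Q) (hPi : ∀ x, IsIdempotentElem (P x)) (hQi : ∀ x, IsIdempotentElem (Q x))
    {N : X → Matrix κ ι ℂ} (hN : Continuous N) (S : Set X) :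
    ContOn (image.{u, v} P hP hPi) (image.{u, v} Q hQ hQi)
      (fun x => rangeMap (P x) (Q x) (N x)) S :=
  ((contOn_rangeMap hP hQ hPi hQi (N := fun _ => N) (hN.comp continuous_snd)).comp
    (continuous_const (y := (0 : ℝ)).prodMk continuous_id)).continuousOn

theorem rangeMap_rangeMap {P : Matrix ι ι ℂ} {Q : Matrix κ κ ℂ} {V : Matrix κ ι ℂ}
    {W : Matrix ι κ ℂ} (hP : IsIdempotentElem P) (hWV : W * V = P) (hVW : V * W = Q)
    (w : ULift.{v} (LinearMap.range P.mulVecLin)) : rangeMap Q P W (rangeMap P Q V w) = w :=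
  range_ext (by
    have h := mulVec_range hP w.down
    have hP' : P * P = P := hP
    have h2 : P * (W * (Q * V)) = P := by
      rw [← hVW, Matrix.mul_assoc V, hWV, ← Matrix.mul_assoc W, hWV, hP', hP']
    rw [rangeMap_apply, rangeMap_apply]
    simp only [Matrix.mulVec_mulVec, h2, h])

/-- Matrices `V` and `W` with `W V = P` and `V W = Q` give an isomorphism between the ranges. -/
noncomputable def rangeIso {P : X → Matrix ι ι ℂ} {Q : X → Matrix κ κ ℂ} (hP : Continuous P)
    (hQ : Continuous Q) (hPi : ∀ x, IsIdempotentElem (P x)) (hQi : ∀ x, IsIdempotentElem (Q x))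
    {V : X → Matrix κ ι ℂ} {W : X → Matrix ι κ ℂ} (hV : Continuous V) (hW : Continuous W)
    (hWV : ∀ x, W x * V x = P x) (hVW : ∀ x, V x * W x = Q x) :
    (image.{u, v} P hP hPi).Iso (image.{u, v} Q hQ hQi) where
  toFun := fun x => rangeMap (P x) (Q x) (V x)
  invFun := fun x => rangeMap (Q x) (P x) (W x)
  left_inv := fun x => rangeMap_rangeMap (hPi x) (hWV x) (hVW x)
  right_inv := fun x => rangeMap_rangeMap (hQi x) (hVW x) (hWV x)
  cont_toFun := contOn_rangeMap' hP hQ hPi hQi hV _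
  cont_invFun := contOn_rangeMap' hQ hP hQi hPi hW _

end CBundle

namespace MatProj

variable (p : MatProj (Unitization ℂ C₀(X, ℂ)))

/-- The value `p(x)` of a projection over `C₀(X)⁺` at a point. -/
noncomputable def valAt (x : X) : Matrix (Fin p.n) (Fin p.n) ℂ := p.mat.map (evalAt x)

/-- The value `p(∞)` of a projection over `C₀(X)⁺` at infinity. -/
noncomputable def atInfty : Matrix (Fin p.n) (Fin p.n) ℂ := p.mat.map (scalarPart C₀(X, ℂ))

theorem isIdempotentElem_valAt (x : X) : IsIdempotentElem (p.valAt x) :=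
  isIdempotentElem_map _ p.isProj.isIdempotentElem

theorem isIdempotentElem_atInfty : IsIdempotentElem p.atInfty :=
  isIdempotentElem_map _ p.isProj.isIdempotentElem

/-- The vector bundle over `X` whose fibre at `x` is the range of `p(x)`. -/
noncomputable def bundle : CBundle.{u, v} X :=
  .image p.valAt (continuous_evalAt p.mat) p.isIdempotentElem_valAt

/-- The trivial vector bundle over `X` whose fibre is the range of `p(∞)`. -/
noncomputable def bundleInfty : CBundle.{u, v} X :=
  .image (fun _ => p.atInfty) continuous_const fun _ => p.isIdempotentElem_atInfty

theorem eventually_det {N : X → Matrix (Fin p.n) (Fin p.n) ℂ}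
    (hN : Tendsto N (cocompact X) (𝓝 p.atInfty)) :
    ∀ᶠ x in cocompact X, ∀ t ∈ Icc (0 : ℝ) 1,
      (p.atInfty * ((1 - (t : ℂ)) • 1 + (t : ℂ) • N x) * p.valAt x +
        (1 - p.atInfty) * (1 - p.valAt x)).det ≠ 0 := by
  let F : (Matrix (Fin p.n) (Fin p.n) ℂ × Matrix (Fin p.n) (Fin p.n) ℂ) × ℝ → ℂ := fun z =>
    (p.atInfty * ((1 - (z.2 : ℂ)) • 1 + (z.2 : ℂ) • z.1.1) * z.1.2 +
      (1 - p.atInfty) * (1 - z.1.2)).det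
  have hF : Continuous F := by
    refine Continuous.matrix_det ?_
    have h2 : Continuous fun z : (Matrix (Fin p.n) (Fin p.n) ℂ × Matrix (Fin p.n) (Fin p.n) ℂ) × ℝ
        => (z.2 : ℂ) := Complex.continuous_ofReal.comp continuous_snd
    fun_prop
  have key := (isCompact_Icc (a := (0 : ℝ)) (b := 1)).eventually_forall_of_forall_eventually
    (x₀ := (p.atInfty, p.atInfty)) (P := fun a t => F (a, t) ≠ 0) (fun t _ => by
      refine hF.continuousAt.eventually_ne ?_
      have h1 : p.atInfty * p.atInfty = p.atInfty := p.isIdempotentElem_atInfty.eq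
      have h2 : p.atInfty * ((1 - (t : ℂ)) • 1 + (t : ℂ) • p.atInfty) * p.atInfty +
          (1 - p.atInfty) * (1 - p.atInfty) = 1 := by
        simp only [mul_add, mul_smul_comm, smul_mul_assoc, mul_one, h1, ← add_smul,
          mul_sub, sub_mul, one_mul]
        simp
      simp only [F, h2, Matrix.det_one, ne_eq, one_ne_zero, not_false_eq_true])
  exact ((hN.prodMk_nhds (tendsto_evalAt p.mat)).eventually key :)

/-- The triple `[range p, range p(∞), p(∞)]` over `X` defined by a projection `p` over `C₀(X)⁺`:
near infinity, `p(∞)` is an isomorphism from the range of `p(x)` to that of `p(∞)`. -/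
noncomputable def triple : KTriple.{u, v} X where
  E₀ := p.bundle
  E₁ := p.bundleInfty
  σ := fun x => CBundle.rangeMap (p.valAt x) p.atInfty 1
  iso_off_compact := by
    have hev := p.eventually_det (tendsto_const_nhds (x := p.atInfty))
    obtain ⟨K, hK, hKs⟩ := mem_cocompact.1 hev
    refine ⟨K, hK, CBundle.contOn_rangeMap' (N := fun _ => 1) _ _ _ _ continuous_const _,
      fun x hx => ?_⟩
    refine CBundle.rangeMap_bijective (p.isIdempotentElem_valAt x) p.isIdempotentElem_atInfty ?_
    simpa using hKs hx 0 ⟨le_rfl, zero_le_one⟩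

open scoped ComplexOrder in
theorem mk_triple_eq {p q : MatProj (Unitization ℂ C₀(X, ℂ))} (h : p.Equivalent q) :
    KTop.mk p.triple = (KTop.mk q.triple : KTop.{u, v} X) := by
  obtain ⟨w, hp, hq⟩ := h
  have hmap : ∀ f : Unitization ℂ C₀(X, ℂ) →⋆ₐ[ℂ] ℂ,
      (w.map f)ᴴ * w.map f = p.mat.map f ∧ w.map f * (w.map f)ᴴ = q.mat.map f := by
    intro f
    rw [← Matrix.conjTranspose_map f (fun b => map_star f b), ← Matrix.map_mul, hp,
      ← Matrix.map_mul, hq]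
    exact ⟨rfl, rfl⟩
  have hmap' : ∀ f : Unitization ℂ C₀(X, ℂ) →⋆ₐ[ℂ] ℂ,
      w.map f * p.mat.map f = w.map f ∧ q.mat.map f * w.map f = w.map f := by
    intro f
    obtain ⟨h1, h2⟩ := hmap f
    have hpi : p.mat.map f * p.mat.map f = p.mat.map f :=
      isIdempotentElem_map f p.isProj.isIdempotentElem
    have h3 : w.map f * p.mat.map f = w.map f := by
      rw [← sub_eq_zero, ← Matrix.conjTranspose_mul_self_eq_zero]
      have h4 : (p.mat.map f)ᴴ = p.mat.map f := by
        rw [← h1, Matrix.conjTranspose_mul, Matrix.conjTranspose_conjTranspose]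
      rw [Matrix.conjTranspose_sub, Matrix.conjTranspose_mul, h4]
      rw [Matrix.sub_mul, Matrix.mul_sub, Matrix.mul_sub]
      have h5 : p.mat.map f * (w.map f)ᴴ * w.map f = p.mat.map f := by
        rw [Matrix.mul_assoc, h1, hpi]
      have h6 : p.mat.map f * (w.map f)ᴴ * (w.map f * p.mat.map f) = p.mat.map f := by
        rw [← Matrix.mul_assoc, h5, hpi]
      have h7 : (w.map f)ᴴ * (w.map f * p.mat.map f) = p.mat.map f := by
        rw [← Matrix.mul_assoc, h1, hpi]
      rw [h5, h6, h7, h1]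
      abel
    refine ⟨h3, ?_⟩
    rw [← h2, Matrix.mul_assoc, h1, h3]
  have hv := fun x => hmap (evalAt x)
  have hv' := fun x => hmap' (evalAt x)
  have hs := hmap (scalarPart C₀(X, ℂ))
  have hs' := hmap' (scalarPart C₀(X, ℂ))
  let N : X → Matrix (Fin p.n) (Fin p.n) ℂ := fun x =>
    (w.map (scalarPart C₀(X, ℂ)))ᴴ * w.map (evalAt x)
  have hNc : Continuous N := continuous_const.matrix_mul (continuous_evalAt w)
  have hNt : Tendsto N (cocompact X) (𝓝 p.atInfty) := by
    have h1 : Continuous fun A : Matrix (Fin q.n) (Fin p.n) ℂ =>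
        (w.map (scalarPart C₀(X, ℂ)))ᴴ * A := continuous_const.matrix_mul continuous_id
    have h2 := (h1.tendsto _).comp (tendsto_evalAt w)
    rwa [hs.1] at h2
  obtain ⟨K, hK, hKs⟩ := mem_cocompact.1 (p.eventually_det hNt)
  let s : ℝ → X → Matrix (Fin p.n) (Fin p.n) ℂ := fun t x =>
    (1 - (t : ℂ)) • 1 + (t : ℂ) • N x
  have hsc : Continuous fun z : ℝ × X => s z.1 z.2 := by
    have h2 : Continuous fun z : ℝ × X => (z.1 : ℂ) :=
      Complex.continuous_ofReal.comp continuous_fst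
    have h3 : Continuous fun z : ℝ × X => N z.2 := hNc.comp continuous_snd
    fun_prop
  have hbij : ∀ t ∈ Icc (0 : ℝ) 1, ∀ x ∉ K,
      Function.Bijective (CBundle.rangeMap.{v} (p.valAt x) p.atInfty (s t x)) := fun t ht x hx =>
    CBundle.rangeMap_bijective (p.isIdempotentElem_valAt x) p.isIdempotentElem_atInfty
      (hKs hx t ht)
  have hs0 : ∀ x, s 0 x = 1 := fun x => by simp [s]
  have hs1 : ∀ x, s 1 x = N x := fun x => by simp [s]
  have hoff : ∃ K : Set X, IsCompact K ∧ CBundle.ContOn p.bundle p.bundleInfty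
      (fun x => CBundle.rangeMap.{v} (p.valAt x) p.atInfty (N x)) Kᶜ ∧
      ∀ x ∉ K, Function.Bijective (CBundle.rangeMap.{v} (p.valAt x) p.atInfty (N x)) :=
    ⟨K, hK, CBundle.contOn_rangeMap' _ _ _ _ hNc _, fun x hx => by
      have h1 := hbij 1 ⟨zero_le_one, le_rfl⟩ x hx
      rwa [hs1] at h1⟩
  let f₀ : p.bundle.Iso q.bundle :=
    CBundle.rangeIso (continuous_evalAt p.mat) (continuous_evalAt q.mat) p.isIdempotentElem_valAt
      q.isIdempotentElem_valAt (continuous_evalAt w) (continuous_evalAt w).matrix_conjTranspose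
      (fun x => (hv x).1) (fun x => (hv x).2)
  let f₁ : p.bundleInfty.Iso q.bundleInfty :=
    CBundle.rangeIso continuous_const continuous_const (fun _ => p.isIdempotentElem_atInfty)
      (fun _ => q.isIdempotentElem_atInfty) continuous_const continuous_const
      (fun _ => hs.1) (fun _ => hs.2)
  let T : KTriple.{u, v} X := ⟨p.bundle, p.bundleInfty, _, hoff⟩
  have hH : KTriple.Homotopic (E₀ := p.bundle) (E₁ := p.bundleInfty) p.triple.σ T.σ := by
    refine ⟨fun t x => CBundle.rangeMap (p.valAt x) p.atInfty (s t x), K, hK, ?_, hbij,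
      fun x _ => ?_⟩
    · exact (CBundle.contOn_rangeMap (continuous_evalAt p.mat) continuous_const
        p.isIdempotentElem_valAt (fun _ => p.isIdempotentElem_atInfty) hsc).continuousOn
    · simp only [hs0, hs1]; exact ⟨rfl, rfl⟩
  refine (KTop.mk_homotopy p.triple.iso_off_compact hoff hH).trans
    (KTop.mk_iso (T := T) (T' := q.triple) ⟨f₀, f₁, ∅, isCompact_empty, fun x _ a => ?_⟩)
  refine CBundle.range_ext (P := q.atInfty) ?_
  · change q.atInfty *ᵥ (w.map (scalarPart C₀(X, ℂ)) *ᵥ (p.atInfty *ᵥ (N x *ᵥ _))) =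
      q.atInfty *ᵥ ((1 : Matrix _ _ ℂ) *ᵥ (q.valAt x *ᵥ (w.map (evalAt x) *ᵥ _)))
    simp only [N, Matrix.mulVec_mulVec, Matrix.one_mul]
    congr 1
    have h1 : q.atInfty * q.atInfty = q.atInfty := q.isIdempotentElem_atInfty
    have h2 : q.valAt x * w.map (evalAt x) = w.map (evalAt x) := (hv' x).2
    have h3 : w.map (scalarPart C₀(X, ℂ)) * p.atInfty = w.map (scalarPart C₀(X, ℂ)) := hs'.1
    have h4 : w.map (scalarPart C₀(X, ℂ)) * (w.map (scalarPart C₀(X, ℂ)))ᴴ = q.atInfty := hs.2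
    rw [h2, ← Matrix.mul_assoc p.atInfty, ← Matrix.mul_assoc (w.map (scalarPart C₀(X, ℂ))),
      ← Matrix.mul_assoc (w.map (scalarPart C₀(X, ℂ))), h3, h4, ← Matrix.mul_assoc, h1]

end MatProj

namespace CBundle

variable {ι κ μ : Type} [Fintype ι] [DecidableEq ι] [Fintype κ] [DecidableEq κ] [Fintype μ]
  [DecidableEq μ]

/-- If `S` is block diagonal with blocks `P` and `Q`, then `range S ≅ range P ⊕ range Q`. -/
noncomputable def blockIso {S : X → Matrix μ μ ℂ} {P : X → Matrix ι ι ℂ} {Q : X → Matrix κ κ ℂ}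
    (hS : Continuous S) (hP : Continuous P) (hQ : Continuous Q)
    (hSi : ∀ x, IsIdempotentElem (S x)) (hPi : ∀ x, IsIdempotentElem (P x))
    (hQi : ∀ x, IsIdempotentElem (Q x))
    (A : Matrix ι μ ℂ) (A' : Matrix μ ι ℂ) (B : Matrix κ μ ℂ) (B' : Matrix μ κ ℂ)
    (hA : A * A' = 1) (hB : B * B' = 1) (hAB : A * B' = 0) (hBA : B * A' = 0)
    (hSPQ : ∀ x, S x = A' * P x * A + B' * Q x * B) :
    (image.{u, v} S hS hSi).Iso ((image.{u, v} P hP hPi).sum (image.{u, v} Q hQ hQi)) :=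
  have hSA : ∀ x, S x * A' = A' * P x := fun x => by
    rw [hSPQ, Matrix.add_mul, Matrix.mul_assoc _ A, hA, Matrix.mul_assoc _ B, hBA]; simp
  have hSB : ∀ x, S x * B' = B' * Q x := fun x => by
    rw [hSPQ, Matrix.add_mul, Matrix.mul_assoc _ A, hAB, Matrix.mul_assoc _ B, hB]; simp
  { toFun := fun x => (rangeMap (S x) (P x) A).prod (rangeMap (S x) (Q x) B)
    invFun := fun x => (rangeMap (P x) (S x) A').coprod (rangeMap (Q x) (S x) B')
    left_inv := fun x w => range_ext (P := S x) (by
      change S x *ᵥ (A' *ᵥ (P x *ᵥ (A *ᵥ _))) + S x *ᵥ (B' *ᵥ (Q x *ᵥ (B *ᵥ _))) = _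
      have h := mulVec_range (hSi x) w.down
      have hP' : P x * P x = P x := hPi x
      have hQ' : Q x * Q x = Q x := hQi x
      have h2 : S x * (A' * (P x * A)) + S x * (B' * (Q x * B)) = S x := by
        rw [← Matrix.mul_assoc (S x), hSA, ← Matrix.mul_assoc (S x), hSB, Matrix.mul_assoc A',
          ← Matrix.mul_assoc (P x), hP', Matrix.mul_assoc B', ← Matrix.mul_assoc (Q x), hQ', hSPQ,
          Matrix.mul_assoc, Matrix.mul_assoc]
      simp only [Matrix.mulVec_mulVec, ← Matrix.add_mulVec, h2]
      exact h)
    right_inv := fun x w => by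
      have hP' : P x * P x = P x := hPi x
      have hQ' : Q x * Q x = Q x := hQi x
      refine Prod.ext (range_ext (P := P x) ?_) (range_ext (P := Q x) ?_)
      · change P x *ᵥ (A *ᵥ (S x *ᵥ (A' *ᵥ (w.1.down : ι → ℂ)) +
          S x *ᵥ (B' *ᵥ (w.2.down : κ → ℂ)))) = _
        have h := mulVec_range (hPi x) w.1.down
        have h1 : P x * (A * (S x * A')) = P x := by
          rw [hSA, ← Matrix.mul_assoc A, hA, Matrix.one_mul, hP']
        have h2 : P x * (A * (S x * B')) = 0 := by
          rw [hSB, ← Matrix.mul_assoc A, hAB, Matrix.zero_mul, Matrix.mul_zero]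
        simp only [Matrix.mulVec_add, Matrix.mulVec_mulVec, h1, h2, h, Matrix.zero_mulVec, add_zero]
      · change Q x *ᵥ (B *ᵥ (S x *ᵥ (A' *ᵥ (w.1.down : ι → ℂ)) +
          S x *ᵥ (B' *ᵥ (w.2.down : κ → ℂ)))) = _
        have h := mulVec_range (hQi x) w.2.down
        have h1 : Q x * (B * (S x * A')) = 0 := by
          rw [hSA, ← Matrix.mul_assoc B, hBA, Matrix.zero_mul, Matrix.mul_zero]
        have h2 : Q x * (B * (S x * B')) = Q x := by
          rw [hSB, ← Matrix.mul_assoc B, hB, Matrix.one_mul, hQ']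
        simp only [Matrix.mulVec_add, Matrix.mulVec_mulVec, h1, h2, h, Matrix.zero_mulVec, zero_add]
    cont_toFun := by
      have hi : Topology.IsInducing
          (fun e : ((image.{u, v} P hP hPi).sum (image.{u, v} Q hQ hQi)).Total =>
          ((⟨e.proj, e.snd.1⟩ : (image.{u, v} P hP hPi).Total),
            (⟨e.proj, e.snd.2⟩ : (image.{u, v} Q hQ hQi).Total))) := ⟨rfl⟩
      unfold ContOn
      rw [hi.continuousOn_iff]
      exact ContinuousOn.prodMk
        (contOn_rangeMap' hS hP hSi hPi (N := fun _ => A) continuous_const univ)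
        (contOn_rangeMap' hS hQ hSi hQi (N := fun _ => B) continuous_const univ)
    cont_invFun := by
      have c0 : Continuous (fun e : ((image.{u, v} P hP hPi).sum (image.{u, v} Q hQ hQi)).Total =>
          ((⟨e.proj, e.snd.1⟩ : (image.{u, v} P hP hPi).Total),
            (⟨e.proj, e.snd.2⟩ : (image.{u, v} Q hQ hQi).Total))) := continuous_induced_dom
      have cP : Continuous (fun e : (image.{u, v} P hP hPi).Total =>
          (e.proj, (e.snd.down : ι → ℂ))) := continuous_induced_dom
      have cQ : Continuous (fun e : (image.{u, v} Q hQ hQi).Total =>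
          (e.proj, (e.snd.down : κ → ℂ))) := continuous_induced_dom
      have hi : Topology.IsInducing (fun e : (image.{u, v} S hS hSi).Total =>
          (e.proj, (e.snd.down : μ → ℂ))) := ⟨rfl⟩
      unfold ContOn
      rw [hi.continuousOn_iff]
      have cp := ((image.{u, v} P hP hPi).sum (image.{u, v} Q hQ hQi)).continuous_proj
      have c1 := continuous_snd.comp (cP.comp (continuous_fst.comp c0))
      have c2 := continuous_snd.comp (cQ.comp (continuous_snd.comp c0))
      refine (cp.prodMk ?_).continuousOn
      exact ((hS.comp cp).matrix_mulVec ((continuous_const (y := A')).matrix_mulVec c1)).add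
        ((hS.comp cp).matrix_mulVec ((continuous_const (y := B')).matrix_mulVec c2)) }

theorem mulVec_block {P P' : Matrix ι ι ℂ} {S S' : Matrix μ μ ℂ} {A : Matrix ι μ ℂ}
    (hP : IsIdempotentElem P) (h : A * S = P * A) (h' : A * S' = P' * A) {a : μ → ℂ}
    (ha : S' *ᵥ a = a) :
    P *ᵥ (A *ᵥ (S *ᵥ ((1 : Matrix μ μ ℂ) *ᵥ a))) =
      P *ᵥ ((1 : Matrix ι ι ℂ) *ᵥ (P' *ᵥ (A *ᵥ a))) := by
  have h1 : P * P = P := hP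
  rw [Matrix.mulVec_mulVec _ P' A, ← h', ← Matrix.mulVec_mulVec a, ha, Matrix.one_mulVec,
    Matrix.one_mulVec, Matrix.mulVec_mulVec _ A, h, ← Matrix.mulVec_mulVec a,
    Matrix.mulVec_mulVec _ P, h1]

end CBundle

namespace MatProj

theorem block_inclusions (n m : ℕ) :
    ∃ (A : Matrix (Fin n) (Fin (n + m)) ℂ) (A' : Matrix (Fin (n + m)) (Fin n) ℂ)
      (B : Matrix (Fin m) (Fin (n + m)) ℂ) (B' : Matrix (Fin (n + m)) (Fin m) ℂ),
      A * A' = 1 ∧ B * B' = 1 ∧ A * B' = 0 ∧ B * A' = 0 ∧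
      ∀ (P : Matrix (Fin n) (Fin n) ℂ) (Q : Matrix (Fin m) (Fin m) ℂ),
        (Matrix.fromBlocks P 0 0 Q).submatrix finSumFinEquiv.symm finSumFinEquiv.symm =
          A' * P * A + B' * Q * B := by
  refine ⟨(1 : Matrix (Fin n ⊕ Fin m) (Fin n ⊕ Fin m) ℂ).submatrix Sum.inl finSumFinEquiv.symm,
    (1 : Matrix (Fin n ⊕ Fin m) (Fin n ⊕ Fin m) ℂ).submatrix finSumFinEquiv.symm Sum.inl,
    (1 : Matrix (Fin n ⊕ Fin m) (Fin n ⊕ Fin m) ℂ).submatrix Sum.inr finSumFinEquiv.symm,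
    (1 : Matrix (Fin n ⊕ Fin m) (Fin n ⊕ Fin m) ℂ).submatrix finSumFinEquiv.symm Sum.inr,
    ?_, ?_, ?_, ?_, fun P Q => ?_⟩
  · rw [Matrix.submatrix_mul_equiv, mul_one]; ext i j; simp [Matrix.one_apply]
  · rw [Matrix.submatrix_mul_equiv, mul_one]; ext i j; simp [Matrix.one_apply]
  · rw [Matrix.submatrix_mul_equiv, mul_one]; ext i j; simp
  · rw [Matrix.submatrix_mul_equiv, mul_one]; ext i j; simp
  · ext i j
    obtain ⟨i, rfl⟩ := finSumFinEquiv.surjective i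
    obtain ⟨j, rfl⟩ := finSumFinEquiv.surjective j
    rcases i with i | i <;> rcases j with j | j <;>
      simp [Matrix.mul_apply, Matrix.one_apply]

theorem mul_block {ι κ μ : Type} [Fintype ι] [DecidableEq ι] [Fintype κ] [Fintype μ]
    {A : Matrix ι μ ℂ} {A' : Matrix μ ι ℂ} {B : Matrix κ μ ℂ} {B' : Matrix μ κ ℂ}
    (hA : A * A' = 1) (hAB : A * B' = 0) (P : Matrix ι ι ℂ) (Q : Matrix κ κ ℂ) :
    A * (A' * P * A + B' * Q * B) = P * A := by
  rw [Matrix.mul_add, ← Matrix.mul_assoc, ← Matrix.mul_assoc, ← Matrix.mul_assoc,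
    ← Matrix.mul_assoc, hA, hAB]
  simp

theorem mk_triple_sum (p q : MatProj (Unitization ℂ C₀(X, ℂ))) :
    KTop.mk (p.sum q).triple = (KTop.mk p.triple + KTop.mk q.triple : KTop.{u, v} X) := by
  rw [← KTop.mk_sum]
  obtain ⟨A, A', B, B', hA, hB, hAB, hBA, hsum⟩ := block_inclusions p.n q.n
  have hblock : ∀ f : Unitization ℂ C₀(X, ℂ) →⋆ₐ[ℂ] ℂ, (p.sum q).mat.map f =
      A' * p.mat.map f * A + B' * q.mat.map f * B := by
    intro f
    rw [← hsum]
    simp only [MatProj.sum, MatProj.ofMatrix]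
    rw [← Matrix.submatrix_map, Matrix.fromBlocks_map]
    simp
  let f₀ : (p.sum q).bundle.Iso (p.bundle.sum q.bundle) :=
    CBundle.blockIso (continuous_evalAt (p.sum q).mat) (continuous_evalAt p.mat)
      (continuous_evalAt q.mat) (p.sum q).isIdempotentElem_valAt p.isIdempotentElem_valAt
      q.isIdempotentElem_valAt A A' B B' hA hB hAB hBA (fun x => hblock (evalAt x))
  let f₁ : (p.sum q).bundleInfty.Iso (p.bundleInfty.sum q.bundleInfty) :=
    CBundle.blockIso continuous_const continuous_const continuous_const
      (fun _ => (p.sum q).isIdempotentElem_atInfty) (fun _ => p.isIdempotentElem_atInfty)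
      (fun _ => q.isIdempotentElem_atInfty) A A' B B' hA hB hAB hBA (fun x => hblock _)
  refine KTop.mk_iso (T := (p.sum q).triple) (T' := p.triple.sum q.triple)
    ⟨f₀, f₁, ∅, isCompact_empty, fun x _ a => ?_⟩
  have hfix := CBundle.mulVec_range ((p.sum q).isIdempotentElem_valAt x) a.down
  let S : (Unitization ℂ C₀(X, ℂ) →⋆ₐ[ℂ] ℂ) → Matrix (Fin (p.n + q.n)) (Fin (p.n + q.n)) ℂ :=
    fun f => (p.sum q).mat.map f
  have hAS : ∀ f : Unitization ℂ C₀(X, ℂ) →⋆ₐ[ℂ] ℂ,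
      A * S f = p.mat.map f * A := fun f => by
    rw [show S f = _ from hblock f]
    exact mul_block hA hAB _ _
  have hBS : ∀ f : Unitization ℂ C₀(X, ℂ) →⋆ₐ[ℂ] ℂ,
      B * S f = q.mat.map f * B := fun f => by
    rw [show S f = _ from hblock f, add_comm (A' * p.mat.map f * A)]
    exact mul_block hB hBA _ _
  exact Prod.ext
    (CBundle.range_ext (P := p.atInfty) (CBundle.mulVec_block p.isIdempotentElem_atInfty
      (hAS (scalarPart C₀(X, ℂ))) (hAS (evalAt x)) hfix))
    (CBundle.range_ext (P := q.atInfty) (CBundle.mulVec_block q.isIdempotentElem_atInfty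
      (hBS (scalarPart C₀(X, ℂ))) (hBS (evalAt x)) hfix))

end MatProj

variable (X) in
/-- The canonical map from analytic to topological `K`-theory: it sends the class `[p]` of a
projection over `C₀(X)⁺` to the triple `[range p, range p(∞), p(∞)]`. -/
noncomputable def K0.toKTop : K0 C₀(X, ℂ) →+ KTop.{u, v} X :=
  (K00.lift (fun p => KTop.mk p.triple) MatProj.mk_triple_sum
    fun _ _ h => MatProj.mk_triple_eq h).comp (K0 C₀(X, ℂ)).subtype

end Canonical

/-! ### Foliations and the bundle `H* ⊕ N*` -/

/-- The model space `ℝ^p × ℝ^q` of a foliated manifold: `p` coordinates along the leaves, `q`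
coordinates transversal to them. -/
abbrev FolModel (p q : ℕ) : Type := EuclideanSpace ℝ (Fin p ⊕ Fin q)

section Foliation

variable {p q : ℕ} {M : Type u} [TopologicalSpace M] [ChartedSpace (FolModel p q) M]

/-- The coordinate vector field `∂ᵢ` of a chart at `m`. -/
noncomputable def coordVec (φ : OpenPartialHomeomorph M (FolModel p q)) (i : Fin p ⊕ Fin q)
    (m : M) : TangentSpace 𝓘(ℝ, FolModel p q) m :=
  mfderiv 𝓘(ℝ, FolModel p q) 𝓘(ℝ, FolModel p q) φ.symm (φ m) (EuclideanSpace.single i (1 : ℝ))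

/-- `φ` is a smooth chart of `M` in which `H` is spanned by `∂₁, …, ∂ₚ`. -/
def IsFoliationChart (H : ∀ m : M, Submodule ℝ (TangentSpace 𝓘(ℝ, FolModel p q) m))
    (φ : OpenPartialHomeomorph M (FolModel p q)) : Prop :=
  φ ∈ IsManifold.maximalAtlas 𝓘(ℝ, FolModel p q) ∞ M ∧
    ∀ m ∈ φ.source, H m = Submodule.span ℝ (range fun i : Fin p => coordVec φ (.inl i) m)

variable (p q M) in
/-- A foliation of `M`: an integrable subbundle `H` of rank `p` of the tangent bundle. -/
structure Foliation where
  H : ∀ m : M, Submodule ℝ (TangentSpace 𝓘(ℝ, FolModel p q) m)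
  exists_chart : ∀ m : M, ∃ φ, m ∈ φ.source ∧ IsFoliationChart H φ

/-- The total space of `H* ⊕ N*`, with `N = TM / H`. -/
structure HNDual (𝓕 : Foliation p q M) where
  base : M
  ξ : Module.Dual ℝ (𝓕.H base)
  η : Module.Dual ℝ (TangentSpace 𝓘(ℝ, FolModel p q) base ⧸ 𝓕.H base)

namespace HNDual

variable {𝓕 : Foliation p q M}

open scoped Classical in
/-- The fibre coordinates `ξ(∂₁), …, ξ(∂ₚ), η(∂ₚ₊₁), …, η(∂ₙ)` of a point of `H* ⊕ N*`, in a
foliation chart around its base point. -/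
noncomputable def coord (φ : OpenPartialHomeomorph M (FolModel p q)) (x : HNDual 𝓕) :
    Fin p ⊕ Fin q → ℝ
  | .inl i => if h : coordVec φ (.inl i) x.base ∈ 𝓕.H x.base then x.ξ ⟨_, h⟩ else 0
  | .inr j => x.η (Submodule.Quotient.mk (coordVec φ (.inr j) x.base))

/-- The vector bundle topology: the coarsest one for which the projection to `M` and, over the
domain of every foliation chart, the fibre coordinates are continuous. -/
instance : TopologicalSpace (HNDual 𝓕) :=
  TopologicalSpace.induced base inferInstance ⊓ TopologicalSpace.generateFrom
    {s | ∃ (φ : OpenPartialHomeomorph M (FolModel p q)) (V : Set (Fin p ⊕ Fin q → ℝ)),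
      IsFoliationChart 𝓕.H φ ∧ IsOpen V ∧ s = {x | x.base ∈ φ.source ∧ x.coord φ ∈ V}}

variable (𝓕) in
/-- The projection `π : H* ⊕ N* → M`. -/
def proj : C(HNDual 𝓕, M) where
  toFun := base
  continuous_toFun := continuous_iff_le_induced.2 inf_le_left

end HNDual

/-! ### Differential operators and their weighted principal symbols -/

/-- The weighted order `‖α‖ = α₁ + ⋯ + αₚ + 2 (αₚ₊₁ + ⋯ + αₙ)`. -/
def weight (α : Fin p ⊕ Fin q → ℕ) : ℕ := ∑ i, α (.inl i) + 2 * ∑ j, α (.inr j)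

/-- The (finite) set of multi-indices with `‖α‖ ≤ d`. -/
def multiIndices (p q d : ℕ) : Finset (Fin p ⊕ Fin q → ℕ) :=
  (Fintype.piFinset fun _ => Finset.range (d + 1)).filter fun α => weight α ≤ d

/-- The partial derivative `∂ᵢ u`. -/
noncomputable def partialDeriv {V : Type*} [NormedAddCommGroup V] [NormedSpace ℝ V]
    (i : Fin p ⊕ Fin q) (u : FolModel p q → V) : FolModel p q → V :=
  fun z => fderiv ℝ u z (EuclideanSpace.single i (1 : ℝ))

/-- The iterated partial derivative `∂^α u = ∂₁^α₁ ⋯ ∂ₙ^αₙ u`. -/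
noncomputable def multiDeriv {V : Type*} [NormedAddCommGroup V] [NormedSpace ℝ V]
    (α : Fin p ⊕ Fin q → ℕ) (u : FolModel p q → V) : FolModel p q → V :=
  ((List.finRange p).map Sum.inl ++ (List.finRange q).map Sum.inr).foldr
    (fun i w => (partialDeriv i)^[α i] w) u

variable {V W : Type*} [NormedAddCommGroup V] [NormedSpace ℂ V] [NormedAddCommGroup W]
  [NormedSpace ℂ W] {E F : M → Type v}
  [TopologicalSpace (TotalSpace V E)] [∀ m, NormedAddCommGroup (E m)]
  [∀ m, InnerProductSpace ℂ (E m)] [FiberBundle V E]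
  [TopologicalSpace (TotalSpace W F)] [∀ m, NormedAddCommGroup (F m)]
  [∀ m, InnerProductSpace ℂ (F m)] [FiberBundle W F]

/-- In the chart `φ` and the trivializations `e` and `e'`, the operator `P` is
`∑_{‖α‖ ≤ d} a_α ∂^α`, with smooth coefficients `a_α`. -/
def HasLocalForm (P : Cₛ^∞⟮𝓘(ℝ, FolModel p q); V, E⟯ → Cₛ^∞⟮𝓘(ℝ, FolModel p q); W, F⟯) (d : ℕ)
    (φ : OpenPartialHomeomorph M (FolModel p q)) (e : Trivialization V (π V E))
    (e' : Trivialization W (π W F)) (a : (Fin p ⊕ Fin q → ℕ) → M → V →L[ℂ] W) : Prop :=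
  (∀ α, ContMDiffOn 𝓘(ℝ, FolModel p q) 𝓘(ℝ, V →L[ℂ] W) ∞ (a α)
    (φ.source ∩ e.baseSet ∩ e'.baseSet)) ∧
  ∀ (s : Cₛ^∞⟮𝓘(ℝ, FolModel p q); V, E⟯), ∀ m ∈ φ.source ∩ e.baseSet ∩ e'.baseSet,
    (e' ⟨m, P s m⟩).2 = ∑ α ∈ multiIndices p q d,
      a α m (multiDeriv α (fun z => (e ⟨φ.symm z, s (φ.symm z)⟩).2) (φ m))

/-- `P` is a differential operator of weighted order `d` with weighted principal symbol `σ`: near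
every point of `M` there are foliation coordinates and trivializations in which
`P = ∑_{‖α‖ ≤ d} a_α ∂^α` and `σ(x, ξ) = ∑_{‖α‖ = d} a_α(x) (iξ)^α`. -/
def IsWeightedPrincipalSymbol (𝓕 : Foliation p q M)
    (P : Cₛ^∞⟮𝓘(ℝ, FolModel p q); V, E⟯ → Cₛ^∞⟮𝓘(ℝ, FolModel p q); W, F⟯) (d : ℕ)
    (σ : ∀ x : HNDual 𝓕, E x.base →ₗ[ℂ] F x.base) : Prop :=
  ∀ m : M, ∃ (φ : OpenPartialHomeomorph M (FolModel p q)) (e : Trivialization V (π V E))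
    (e' : Trivialization W (π W F)) (a : (Fin p ⊕ Fin q → ℕ) → M → V →L[ℂ] W),
    IsFoliationChart 𝓕.H φ ∧ e ∈ FiberBundle.trivializationAtlas V E ∧
    e' ∈ FiberBundle.trivializationAtlas W F ∧ m ∈ φ.source ∩ e.baseSet ∩ e'.baseSet ∧
    HasLocalForm P d φ e e' a ∧
    ∀ x : HNDual 𝓕, x.base ∈ φ.source ∩ e.baseSet ∩ e'.baseSet → ∀ v : E x.base,
      (e' ⟨x.base, σ x v⟩).2 = ∑ α ∈ multiIndices p q d with weight α = d,
        (∏ k, (Complex.I * (x.coord φ k : ℂ)) ^ α k) • a α x.base (e ⟨x.base, v⟩).2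

/-! ### The graph projection of the symbol and its class in `K₀(C₀(H* ⊕ N*))` -/

/-- The graph projection `e_T`: the orthogonal projection of `V ⊕ W` onto the graph of
`T : V → W`. -/
noncomputable def graphProjection {V W : Type*} [NormedAddCommGroup V] [InnerProductSpace ℂ V]
    [NormedAddCommGroup W] [InnerProductSpace ℂ W] [FiniteDimensional ℂ V]
    [FiniteDimensional ℂ W] (T : V →ₗ[ℂ] W) : WithLp 2 (V × W) →ₗ[ℂ] WithLp 2 (V × W) :=
  (T.graph.map (WithLp.linearEquiv 2 ℂ (V × W)).symm.toLinearMap).starProjection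

/-- The projection `(v, w) ↦ (0, w)`, with matrix `(0 0; 0 1)`. -/
noncomputable def sndProjection (V W : Type*) [NormedAddCommGroup V] [InnerProductSpace ℂ V]
    [NormedAddCommGroup W] [InnerProductSpace ℂ W] :
    WithLp 2 (V × W) →ₗ[ℂ] WithLp 2 (V × W) :=
  (WithLp.linearEquiv 2 ℂ (V × W)).symm.toLinearMap ∘ₗ
    (LinearMap.inr ℂ V W ∘ₗ LinearMap.snd ℂ V W) ∘ₗ (WithLp.linearEquiv 2 ℂ (V × W)).toLinearMap

variable (V E) in
/-- An isometric embedding of a Hermitian vector bundle over `M` into a trivial bundle `M × ℂᵃ`. -/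
structure HermitianEmbedding (a : ℕ) where
  toFun : ∀ m, E m →ₗᵢ[ℂ] EuclideanSpace ℂ (Fin a)
  continuous_toFun : Continuous fun z : TotalSpace V E => toFun z.proj z.snd

/-- The isometry `i ⊕ j : E_m ⊕ F_m → ℂᵃ ⊕ ℂᵇ`. -/
noncomputable def HermitianEmbedding.sum {a b : ℕ} (i : HermitianEmbedding V E a)
    (j : HermitianEmbedding W F b) (m : M) :
    WithLp 2 (E m × F m) →ₗ[ℂ] EuclideanSpace ℂ (Fin a ⊕ Fin b) where
  toFun z := WithLp.toLp 2 (Sum.elim (i.toFun m z.fst) (j.toFun m z.snd))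
  map_add' z z' := by ext (k | k) <;> simp
  map_smul' c z := by ext (k | k) <;> simp

/-- The matrix of the endomorphism of `ℂᵃ ⊕ ℂᵇ` which is `A` on the image of `E_m ⊕ F_m` and zero
on its orthogonal complement. -/
noncomputable def HermitianEmbedding.pushMatrix {a b : ℕ} [∀ m, FiniteDimensional ℂ (E m)]
    [∀ m, FiniteDimensional ℂ (F m)] (i : HermitianEmbedding V E a)
    (j : HermitianEmbedding W F b) (m : M) (A : WithLp 2 (E m × F m) →ₗ[ℂ] WithLp 2 (E m × F m)) :
    Matrix (Fin a ⊕ Fin b) (Fin a ⊕ Fin b) ℂ :=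
  Matrix.of fun k l =>
    (i.sum j m ∘ₗ A ∘ₗ LinearMap.adjoint (i.sum j m)) (EuclideanSpace.single l 1) k

/-- The constant projection `(0 0; 0 1)` onto the second summand of `ℂᵃ ⊕ ℂᵇ`. -/
def blockOne (a b : ℕ) (B : Type*) [Ring B] : Matrix (Fin a ⊕ Fin b) (Fin a ⊕ Fin b) B :=
  Matrix.fromBlocks 0 0 0 1

theorem isStarProjection_blockOne (a b : ℕ) (B : Type*) [Ring B] [StarRing B] :
    IsStarProjection (blockOne a b B) := by
  constructor
  · change blockOne a b B * blockOne a b B = _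
    simp [blockOne, Matrix.fromBlocks_multiply]
  · change (blockOne a b B)ᴴ = _
    simp [blockOne, Matrix.fromBlocks_conjTranspose]

/-- `c` is the class `[e_σ] ⊖ [(0 0; 0 1)]` in `K₀(C₀(H* ⊕ N*))`, computed with the embeddings
`E ⊆ ℂᵃ` and `F ⊆ ℂᵇ`. These identify `e_σ - (0 0; 0 1)` with a matrix of functions on `H* ⊕ N*`;
it is required to vanish at infinity, and adding to it the constant projection onto `ℂᵇ` gives the
projection `e` over the unitization of `C₀(H* ⊕ N*)`. -/
def IsGraphProjectionClass {𝓕 : Foliation p q M} [∀ m, FiniteDimensional ℂ (E m)]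
    [∀ m, FiniteDimensional ℂ (F m)] (σ : ∀ x : HNDual 𝓕, E x.base →ₗ[ℂ] F x.base)
    {a b : ℕ} (i : HermitianEmbedding V E a) (j : HermitianEmbedding W F b)
    (c : K0 C₀(HNDual 𝓕, ℂ)) : Prop :=
  ∃ (e : Matrix (Fin a ⊕ Fin b) (Fin a ⊕ Fin b) (Unitization ℂ C₀(HNDual 𝓕, ℂ)))
    (he : IsStarProjection e)
    (hs : e.map (scalarPart C₀(HNDual 𝓕, ℂ)) =
      (blockOne a b (Unitization ℂ C₀(HNDual 𝓕, ℂ))).map (scalarPart C₀(HNDual 𝓕, ℂ))),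
    (∀ x : HNDual 𝓕, e.map (evalAt x) = blockOne a b ℂ +
      i.pushMatrix j x.base (graphProjection (σ x) - sndProjection (E x.base) (F x.base))) ∧
    c = K0.diff finSumFinEquiv e (blockOne a b _) he (isStarProjection_blockOne a b _) hs

/-- The pull-back `π*E` of a bundle on `M` to `H* ⊕ N*`. -/
noncomputable def HNDual.pullback (𝓕 : Foliation p q M) (V : Type*) [NormedAddCommGroup V]
    [NormedSpace ℂ V] [FiniteDimensional ℂ V] (E : M → Type v) [∀ m, NormedAddCommGroup (E m)]
    [∀ m, InnerProductSpace ℂ (E m)] [TopologicalSpace (TotalSpace V E)] [FiberBundle V E]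
    [VectorBundle ℂ V E] : CBundle.{u, v} (HNDual 𝓕) :=
  (CBundle.ofBundle V E).pullback (HNDual.proj 𝓕)

end Foliation

set_option linter.unusedSectionVars false

namespace CBundle

variable {X : Type u} [TopologicalSpace X]

open scoped ComplexOrder in
theorem isUnit_conjTranspose_mul_self {κ ι : Type*} [Fintype κ] [Fintype ι] [DecidableEq ι]
    {A : Matrix κ ι ℂ} (hA : Function.Injective A.mulVec) : IsUnit (Aᴴ * A).det := by
  rw [← Matrix.isUnit_iff_isUnit_det, ← Matrix.mulVec_injective_iff_isUnit]
  refine (injective_iff_map_eq_zero (Aᴴ * A).mulVecLin).2 fun w hw => ?_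
  refine (injective_iff_map_eq_zero A.mulVecLin).1 hA w ?_
  exact (Matrix.conjTranspose_mul_self_mulVec_eq_zero _ _).1 hw

theorem continuousOn_pseudoinverse {κ ι : Type*} [Fintype κ] [Fintype ι] [DecidableEq ι]
    {A : X → Matrix κ ι ℂ} {U : Set X} (hA : ContinuousOn A U)
    (hi : ∀ y ∈ U, Function.Injective (A y).mulVec) :
    ContinuousOn (fun y => ((A y)ᴴ * A y)⁻¹ * (A y)ᴴ) U := by
  rw [continuousOn_iff_continuous_domRestrict] at hA ⊢
  have hG : Continuous fun y : U => (A y)ᴴ * A y := hA.matrix_conjTranspose.matrix_mul hA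
  have h2 : Continuous fun y : U => ((A y)ᴴ * A y)⁻¹ := by
    have h1 : (fun y : U => ((A y)ᴴ * A y)⁻¹) =
        fun y : U => ((A y)ᴴ * A y).det⁻¹ • ((A y)ᴴ * A y).adjugate := by
      funext y; rw [Matrix.inv_def, Ring.inverse_eq_inv']
    rw [h1]
    exact (hG.matrix_det.inv₀ fun y =>
      (isUnit_conjTranspose_mul_self (hi y y.2)).ne_zero).smul hG.matrix_adjugate
  exact h2.matrix_mul hA.matrix_conjTranspose

/-- Let `f` be a continuous family of injective linear maps from a bundle to `ℂᵏ`. The family of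
left inverses of `f` which vanish on the orthogonal complements of the ranges is continuous. -/
theorem continuous_leftInverse (B : CBundle.{u, v} X) {κ : Type*} [Fintype κ]
    (f : ∀ x, B.Fiber x →ₗ[ℂ] (κ → ℂ)) (L : ∀ x, (κ → ℂ) →ₗ[ℂ] B.Fiber x)
    (hf : Continuous fun e : B.Total => f e.proj e.snd) (hLf : ∀ x w, L x (f x w) = w)
    (hL : ∀ x z, (∀ w, star (f x w) ⬝ᵥ z = 0) → L x z = 0) :
    Continuous fun z : X × (κ → ℂ) => (⟨z.1, L z.1 z.2⟩ : B.Total) := by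
  refine continuous_iff_continuousAt.2 fun z₀ => ?_
  obtain ⟨U, hU, hxU, n, T, S, hTS, -, hS⟩ := B.locally_trivial z₀.1
  obtain ⟨A, hA⟩ : ∃ A : X → Matrix κ (Fin n) ℂ, ∀ y w, A y *ᵥ w = f y (S y w) :=
    ⟨fun y => LinearMap.toMatrix' (f y ∘ₗ S y), fun y w => LinearMap.toMatrix'_mulVec _ _⟩
  have hAc : ContinuousOn A U := by
    refine continuousOn_pi.2 fun k => continuousOn_pi.2 fun l => ?_
    have h1 : ContinuousOn (fun y : X => f y (S y (Pi.single l 1))) U :=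
      hf.comp_continuousOn (hS.comp (f := fun y : X => (y, (Pi.single l 1 : Fin n → ℂ)))
        (by fun_prop) fun y hy => ⟨hy, mem_univ _⟩)
    refine ((continuous_apply k).comp_continuousOn h1).congr fun y _ => ?_
    simp [← hA]
  have hAi : ∀ y ∈ U, Function.Injective (A y).mulVec := fun y hy w w' hw => by
    rw [hA, hA] at hw
    rw [← (hTS y hy).2 w, ← hLf y (S y w), hw, hLf, (hTS y hy).2]
  obtain ⟨R, hR, hRA, hRR⟩ : ∃ R : X → Matrix (Fin n) κ ℂ, ContinuousOn R U ∧
      (∀ y ∈ U, R y * A y = 1) ∧ ∀ y ∈ U, (A y)ᴴ * (A y * R y) = (A y)ᴴ := by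
    refine ⟨_, continuousOn_pseudoinverse hAc hAi, fun y hy => ?_, fun y hy => ?_⟩
    · rw [Matrix.mul_assoc, Matrix.nonsing_inv_mul _ (isUnit_conjTranspose_mul_self (hAi y hy))]
    · rw [← Matrix.mul_assoc, ← Matrix.mul_assoc,
        Matrix.mul_nonsing_inv _ (isUnit_conjTranspose_mul_self (hAi y hy)), Matrix.one_mul]
  have key : ∀ y ∈ U, ∀ z, L y z = S y (R y *ᵥ z) := by
    intro y hy z
    have h1 : L y (z - A y *ᵥ (R y *ᵥ z)) = 0 := by
      refine hL y _ fun v => ?_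
      have h2 : (A y)ᴴ *ᵥ (z - A y *ᵥ (R y *ᵥ z)) = 0 := by
        rw [Matrix.mulVec_sub, Matrix.mulVec_mulVec, Matrix.mulVec_mulVec, Matrix.mul_assoc, hRR y hy,
          sub_self]
      rw [← (hTS y hy).1 v, ← hA, Matrix.star_mulVec, ← Matrix.dotProduct_mulVec, h2,
        dotProduct_zero]
    rwa [map_sub, hA, hLf, sub_eq_zero] at h1
  have hc : ContinuousOn (fun z : X × (κ → ℂ) => (⟨z.1, L z.1 z.2⟩ : B.Total)) (U ×ˢ univ) := by
    have h1 : ContinuousOn (fun z : X × (κ → ℂ) => R z.1 *ᵥ z.2) (U ×ˢ univ) := by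
      have hm : Continuous fun t : Matrix (Fin n) κ ℂ × (κ → ℂ) => t.1 *ᵥ t.2 := by fun_prop
      exact hm.comp_continuousOn
        ((hR.comp continuousOn_fst fun z hz => hz.1).prodMk continuousOn_snd)
    refine (hS.comp (f := fun z : X × (κ → ℂ) => (z.1, R z.1 *ᵥ z.2))
      (continuousOn_fst.prodMk h1) fun z hz => ⟨hz.1, mem_univ _⟩).congr fun z hz => ?_
    rw [key z.1 hz.1]; rfl
  exact hc.continuousAt ((hU.prod isOpen_univ).mem_nhds ⟨hxU, mem_univ _⟩)

/-- A continuous family of maps `B → ℂᵏ` with range that of the idempotents `P`, and with a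
continuous left inverse, is an isomorphism onto the bundle of ranges of `P`. -/
noncomputable def isoImage (B : CBundle.{u, v} X) {ι : Type} [Fintype ι] [DecidableEq ι]
    {P : X → Matrix ι ι ℂ} (hP : Continuous P) (hPi : ∀ x, IsIdempotentElem (P x))
    (r : ∀ x, B.Fiber x →ₗ[ℂ] (ι → ℂ)) (s : ∀ x, (ι → ℂ) →ₗ[ℂ] B.Fiber x)
    (hr : Continuous fun e : B.Total => r e.proj e.snd)
    (hs : Continuous fun z : X × (ι → ℂ) => (⟨z.1, s z.1 z.2⟩ : B.Total))
    (hsr : ∀ x w, s x (r x w) = w) (hPr : ∀ x w, P x *ᵥ r x w = r x w)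
    (hrs : ∀ x z, P x *ᵥ z = z → r x (s x z) = z) :
    B.Iso (image.{u, v} P hP hPi) where
  toFun x := ULift.moduleEquiv.symm.toLinearMap ∘ₗ (P x).mulVecLin.rangeRestrict ∘ₗ r x
  invFun x := s x ∘ₗ (LinearMap.range (P x).mulVecLin).subtype ∘ₗ ULift.moduleEquiv.toLinearMap
  left_inv x w := by
    change s x (P x *ᵥ r x w) = w
    rw [hPr, hsr]
  right_inv x w := range_ext (by
    have h := mulVec_range (hPi x) w.down
    change P x *ᵥ r x (s x (w.down : ι → ℂ)) = _
    rw [hrs _ _ h, h])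
  cont_toFun := by
    have hi : Topology.IsInducing (fun e : (image.{u, v} P hP hPi).Total =>
      (e.proj, (e.snd.down : ι → ℂ))) := ⟨rfl⟩
    unfold ContOn
    rw [hi.continuousOn_iff]
    exact (B.continuous_proj.prodMk (hr.congr fun e => (hPr e.proj e.snd).symm)).continuousOn
  cont_invFun := by
    have c0 : Continuous (fun e : (image.{u, v} P hP hPi).Total =>
      (e.proj, (e.snd.down : ι → ℂ))) := continuous_induced_dom
    exact (hs.comp c0).continuousOn

theorem continuous_sum_iff {Z : Type*} [TopologicalSpace Z] (B B' : CBundle.{u, v} X)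
    {h : Z → (B.sum B').Total} :
    Continuous h ↔ Continuous (fun z => (⟨(h z).proj, (h z).snd.1⟩ : B.Total)) ∧
      Continuous (fun z => (⟨(h z).proj, (h z).snd.2⟩ : B'.Total)) := by
  have hi : Topology.IsInducing (fun e : (B.sum B').Total =>
    ((⟨e.proj, e.snd.1⟩ : B.Total), (⟨e.proj, e.snd.2⟩ : B'.Total))) := ⟨rfl⟩
  rw [hi.continuous_iff, continuous_prodMk]
  rfl

end CBundle

/-- The identity of a bundle, as a triple. -/
def KTriple.id {X : Type u} [TopologicalSpace X] (B : CBundle.{u, v} X) : KTriple.{u, v} X where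
  E₀ := B
  E₁ := B
  σ := fun _ => LinearMap.id
  iso_off_compact := ⟨∅, isCompact_empty, continuous_id.continuousOn,
    fun _ _ => Function.bijective_id⟩

theorem KTop.mk_id {X : Type u} [TopologicalSpace X] (B : CBundle.{u, v} X) :
    KTop.mk (KTriple.id B) = 0 :=
  KTop.eq_zero_of_rel (.degenerate _ continuous_id.continuousOn fun _ => Function.bijective_id)

namespace MatProj

variable {X : Type u} [TopologicalSpace X]

/-- The triple of a projection whose value is constant is zero in `K`-theory. -/
theorem mk_triple_eq_zero {p : MatProj (Unitization ℂ C₀(X, ℂ))}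
    (h : ∀ x, p.valAt x = p.atInfty) : KTop.mk p.triple = (0 : KTop.{u, v} X) := by
  refine KTop.eq_zero_of_rel (.degenerate _ ?_ fun x => ?_)
  · exact CBundle.contOn_rangeMap' (N := fun _ => 1) (continuous_evalAt p.mat) continuous_const
      p.isIdempotentElem_valAt (fun _ => p.isIdempotentElem_atInfty) continuous_const _
  · refine CBundle.rangeMap_bijective (p.isIdempotentElem_valAt x) p.isIdempotentElem_atInfty ?_
    have h1 : p.atInfty * p.atInfty = p.atInfty := p.isIdempotentElem_atInfty
    rw [h, mul_one, h1, mul_sub, sub_mul, sub_mul, h1]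
    simp

theorem submatrix_mulVec_funCongrLeft {ι κ : Type*} [Fintype ι] [Fintype κ] (e : ι ≃ κ)
    (N : Matrix ι ι ℂ) (z : ι → ℂ) :
    N.submatrix e.symm e.symm *ᵥ LinearEquiv.funCongrLeft ℂ ℂ e.symm z =
      LinearEquiv.funCongrLeft ℂ ℂ e.symm (N *ᵥ z) := by
  rw [Matrix.submatrix_mulVec_equiv]
  have h : LinearEquiv.funCongrLeft ℂ ℂ e.symm z ∘ e = z :=
    funext fun i => by simp [LinearMap.funLeft]
  rw [Equiv.symm_symm, h]
  rfl

/-- The complement of the range of a continuous family `g : B → ℂᵇ` with left inverse `g'`, as the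
bundle of the ranges of the projections `1 - g g'`. -/
theorem _root_.CBundle.exists_complement (B₁ : CBundle.{u, v} X) {b : ℕ}
    (g : ∀ x, B₁.Fiber x →ₗ[ℂ] (Fin b → ℂ)) (g' : ∀ x, (Fin b → ℂ) →ₗ[ℂ] B₁.Fiber x)
    (hgc : Continuous fun e : B₁.Total => g e.proj e.snd)
    (hgc' : Continuous fun z : X × (Fin b → ℂ) => (⟨z.1, g' z.1 z.2⟩ : B₁.Total))
    (hgg : ∀ x w, g' x (g x w) = w) :
    ∃ (B : CBundle.{u, v} X) (down : ∀ x, B.Fiber x →ₗ[ℂ] (Fin b → ℂ))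
      (up : ∀ x, (Fin b → ℂ) →ₗ[ℂ] B.Fiber x), (Continuous fun e : B.Total => down e.proj e.snd) ∧
      (Continuous fun z : X × (Fin b → ℂ) => (⟨z.1, up z.1 z.2⟩ : B.Total)) ∧
      (∀ x w, up x (down x w) = w) ∧ (∀ x w, g' x (down x w) = 0) ∧
      (∀ x z, down x (up x z) = z - g x (g' x z)) := by
  obtain ⟨Q, hQ⟩ : ∃ Q : X → Matrix (Fin b) (Fin b) ℂ, ∀ x w, Q x *ᵥ w = w - g x (g' x w) :=
    ⟨fun x => 1 - LinearMap.toMatrix' (g x ∘ₗ g' x), fun x w => by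
      rw [Matrix.sub_mulVec, Matrix.one_mulVec, LinearMap.toMatrix'_mulVec]; rfl⟩
  have hQc : Continuous Q := by
    refine continuous_pi fun i => continuous_pi fun l => ?_
    have h1 : Continuous fun x => g x (g' x (Pi.single l 1)) :=
      hgc.comp (hgc'.comp (f := fun x : X => (x, (Pi.single l 1 : Fin b → ℂ))) (by fun_prop))
    have h2 : Continuous fun x => (Q x *ᵥ Pi.single l 1) i := by
      simp only [hQ, Pi.sub_apply]
      exact continuous_const.sub ((continuous_apply i).comp h1)
    simpa using h2
  have hg'Q : ∀ x w, g' x (Q x *ᵥ w) = 0 := fun x w => by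
    rw [hQ, map_sub, hgg, sub_self]
  have hQi : ∀ x, IsIdempotentElem (Q x) := fun x => by
    refine Matrix.toLin'.injective (LinearMap.ext fun w => ?_)
    rw [Matrix.toLin'_apply, Matrix.toLin'_apply, ← Matrix.mulVec_mulVec, hQ _ (Q x *ᵥ w), hg'Q,
      map_zero, sub_zero]
  refine ⟨CBundle.image.{u, v} Q hQc hQi,
    fun x => (LinearMap.range (Q x).mulVecLin).subtype ∘ₗ ULift.moduleEquiv.toLinearMap,
    fun x => ULift.moduleEquiv.symm.toLinearMap ∘ₗ (Q x).mulVecLin.rangeRestrict, ?_, ?_,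
    fun x w => CBundle.range_ext (CBundle.mulVec_range (hQi x) w.down), fun x w => ?_,
    fun x z => hQ x z⟩
  · have h : Continuous fun e : (CBundle.image.{u, v} Q hQc hQi).Total =>
      (e.proj, (e.snd.down : Fin b → ℂ)) := continuous_induced_dom
    exact continuous_snd.comp h
  · have hi : Topology.IsInducing fun e : (CBundle.image.{u, v} Q hQc hQi).Total =>
      (e.proj, (e.snd.down : Fin b → ℂ)) := ⟨rfl⟩
    rw [hi.continuous_iff]
    exact continuous_fst.prodMk ((hQc.comp continuous_fst).matrix_mulVec continuous_snd)
  · change g' x (w.down : Fin b → ℂ) = 0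
    rw [← CBundle.mulVec_range (hQi x) w.down, hg'Q]

/-- The inclusion of the second summand of `ℂᵃ ⊕ ℂᵇ`. -/
def _root_.inrLinear (a b : ℕ) : (Fin b → ℂ) →ₗ[ℂ] (Fin a ⊕ Fin b → ℂ) where
  toFun w := Sum.elim 0 w
  map_add' w w' := by ext (i | i) <;> simp
  map_smul' c w := by ext (i | i) <;> simp

theorem _root_.inrLinear_apply (a b : ℕ) (w : Fin b → ℂ) :
    inrLinear a b w = Sum.elim (0 : Fin a → ℂ) w := rfl

theorem _root_.blockOne_mulVec (a b : ℕ) (z : Fin a ⊕ Fin b → ℂ) :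
    blockOne a b ℂ *ᵥ z = inrLinear a b (LinearMap.funLeft ℂ ℂ Sum.inr z) := by
  rw [blockOne, Matrix.fromBlocks_mulVec]
  ext (i | i) <;> simp [inrLinear_apply, LinearMap.funLeft]

/-- Let `σ : B₀ → B₁` be an isomorphism outside a compact set and let `p` be a projection over the
unitization of `C₀(X)` which, in coordinates `re`, has the form
`p(x) = k(x) h(x) + (0 ⊕ (1 - g(x) g'(x)))` where `k` has second component `g σ` and `h`, `g'` are
left inverses of `k` and `g`. If `p(∞) = 0 ⊕ 1`, then the triple of `p` is equivalent to
`[B₀, B₁, σ]`. -/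
theorem mk_triple_eq_of_range {a b : ℕ} {B₀ B₁ : CBundle.{u, v} X}
    (σ : ∀ x, B₀.Fiber x →ₗ[ℂ] B₁.Fiber x)
    (hT : ∃ K : Set X, IsCompact K ∧ CBundle.ContOn B₀ B₁ σ Kᶜ ∧
      ∀ x ∉ K, Function.Bijective (σ x))
    (k : ∀ x, B₀.Fiber x →ₗ[ℂ] (Fin a ⊕ Fin b → ℂ)) (h : ∀ x, (Fin a ⊕ Fin b → ℂ) →ₗ[ℂ] B₀.Fiber x)
    (g : ∀ x, B₁.Fiber x →ₗ[ℂ] (Fin b → ℂ)) (g' : ∀ x, (Fin b → ℂ) →ₗ[ℂ] B₁.Fiber x)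
    (hkc : Continuous fun e : B₀.Total => k e.proj e.snd)
    (hhc : Continuous fun z : X × (Fin a ⊕ Fin b → ℂ) => (⟨z.1, h z.1 z.2⟩ : B₀.Total))
    (hgc : Continuous fun e : B₁.Total => g e.proj e.snd)
    (hgc' : Continuous fun z : X × (Fin b → ℂ) => (⟨z.1, g' z.1 z.2⟩ : B₁.Total))
    (hk : ∀ x w, LinearMap.funLeft ℂ ℂ Sum.inr (k x w) = g x (σ x w))
    (hhk : ∀ x w, h x (k x w) = w) (hgg : ∀ x w, g' x (g x w) = w)
    (hh0 : ∀ x w, g' x w = 0 → h x (inrLinear a b w) = 0)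
    (p : MatProj (Unitization ℂ C₀(X, ℂ))) (re : (Fin a ⊕ Fin b → ℂ) ≃ₗ[ℂ] (Fin p.n → ℂ))
    (hinf : ∀ z, p.atInfty *ᵥ re z = re (inrLinear a b (LinearMap.funLeft ℂ ℂ Sum.inr z)))
    (hval : ∀ x z, p.valAt x *ᵥ re z = re (k x (h x z) + inrLinear a b
      (LinearMap.funLeft ℂ ℂ Sum.inr z - g x (g' x (LinearMap.funLeft ℂ ℂ Sum.inr z))))) :
    KTop.mk p.triple = KTop.mk ⟨B₀, B₁, σ, hT⟩ := by
  obtain ⟨B, down, up, hdc, huc, hud, hgd, hdu⟩ := B₁.exists_complement g g' hgc hgc' hgg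
  obtain ⟨pr, hpr⟩ : ∃ pr : (Fin a ⊕ Fin b → ℂ) →ₗ[ℂ] (Fin b → ℂ),
    pr = LinearMap.funLeft ℂ ℂ Sum.inr := ⟨_, rfl⟩
  rw [← hpr] at hk hinf hval
  have hembr : ∀ w, pr (inrLinear a b w) = w := fun w => by rw [hpr]; rfl
  have hprc : Continuous pr := pr.continuous_of_finiteDimensional
  have hemc : Continuous (inrLinear a b) := (inrLinear a b).continuous_of_finiteDimensional
  have hrec : Continuous re := re.toLinearMap.continuous_of_finiteDimensional
  have hrec' : Continuous re.symm := re.symm.toLinearMap.continuous_of_finiteDimensional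
  have hug : ∀ x w, up x (g x w) = 0 := fun x w => by
    rw [← hud x (up x (g x w)), hdu, hgg, sub_self, map_zero]
  let r₀ : ∀ x, (B₀.sum B).Fiber x →ₗ[ℂ] (Fin p.n → ℂ) := fun x =>
    re.toLinearMap ∘ₗ (k x).coprod (inrLinear a b ∘ₗ down x)
  let s₀ : ∀ x, (Fin p.n → ℂ) →ₗ[ℂ] (B₀.sum B).Fiber x := fun x =>
    (h x).prod (up x ∘ₗ pr) ∘ₗ re.symm.toLinearMap
  let r₁ : ∀ x, (B₁.sum B).Fiber x →ₗ[ℂ] (Fin p.n → ℂ) := fun x =>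
    re.toLinearMap ∘ₗ inrLinear a b ∘ₗ (g x).coprod (down x)
  let s₁ : ∀ x, (Fin p.n → ℂ) →ₗ[ℂ] (B₁.sum B).Fiber x := fun x =>
    (g' x).prod (up x) ∘ₗ pr ∘ₗ re.symm.toLinearMap
  have hr₀ : ∀ x v w, r₀ x (v, w) = re (k x v + inrLinear a b (down x w)) := fun _ _ _ => rfl
  have hs₀ : ∀ x z, s₀ x (re z) = (h x z, up x (pr z)) := fun x z => by
    change (h x (re.symm (re z)), up x (pr (re.symm (re z)))) = _
    rw [re.symm_apply_apply]
  have hr₁ : ∀ x v w, r₁ x (v, w) = re (inrLinear a b (g x v + down x w)) := fun _ _ _ => rfl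
  have hs₁ : ∀ x z, s₁ x (re z) = (g' x (pr z), up x (pr z)) := fun x z => by
    change (g' x (pr (re.symm (re z))), up x (pr (re.symm (re z)))) = _
    rw [re.symm_apply_apply]
  have hPr₀ : ∀ x w, p.valAt x *ᵥ r₀ x w = r₀ x w := by
    rintro x ⟨v, w⟩
    rw [hr₀, hval, map_add (h x), map_add pr, hhk, hh0 _ _ (hgd x w), hembr, hk, map_add (g' x),
      map_add (g x), hgg, hgd, map_zero]
    simp
  have hPr₁ : ∀ x w, p.atInfty *ᵥ r₁ x w = r₁ x w := by
    rintro x ⟨v, w⟩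
    rw [hr₁, hinf, hembr]
  have hrc₀ : Continuous fun e : (B₀.sum B).Total => r₀ e.proj e.snd := by
    have h1 := (CBundle.continuous_sum_iff B₀ B).1 continuous_id
    exact hrec.comp ((hkc.comp h1.1).add (hemc.comp (hdc.comp h1.2)))
  have hrc₁ : Continuous fun e : (B₁.sum B).Total => r₁ e.proj e.snd := by
    have h1 := (CBundle.continuous_sum_iff B₁ B).1 continuous_id
    exact hrec.comp (hemc.comp ((hgc.comp h1.1).add (hdc.comp h1.2)))
  have hsc₀ : Continuous fun z : X × (Fin p.n → ℂ) => (⟨z.1, s₀ z.1 z.2⟩ : (B₀.sum B).Total) := by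
    have h1 := hrec'.comp (continuous_snd (X := X))
    exact (CBundle.continuous_sum_iff B₀ B).2 ⟨hhc.comp (continuous_fst.prodMk h1),
      huc.comp (continuous_fst.prodMk (hprc.comp h1))⟩
  have hsc₁ : Continuous fun z : X × (Fin p.n → ℂ) => (⟨z.1, s₁ z.1 z.2⟩ : (B₁.sum B).Total) := by
    have h1 := hprc.comp (hrec'.comp (continuous_snd (X := X)))
    exact (CBundle.continuous_sum_iff B₁ B).2 ⟨hgc'.comp (continuous_fst.prodMk h1),
      huc.comp (continuous_fst.prodMk h1)⟩
  have hsr₀ : ∀ x w, s₀ x (r₀ x w) = w := by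
    rintro x ⟨v, w⟩
    rw [hr₀, hs₀, map_add (h x), map_add pr, hhk, hh0 _ _ (hgd x w), hembr, hk, map_add (up x), hug,
      hud, add_zero, zero_add]
  have hsr₁ : ∀ x w, s₁ x (r₁ x w) = w := by
    rintro x ⟨v, w⟩
    rw [hr₁, hs₁, hembr, map_add, map_add, hgg, hgd, hug, hud, add_zero, zero_add]
  have hrs₀ : ∀ x z, p.valAt x *ᵥ z = z → r₀ x (s₀ x z) = z := by
    intro x z hz
    obtain ⟨z, rfl⟩ := re.surjective z
    rw [hs₀, hr₀, hdu, ← hval, hz]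
  have hrs₁ : ∀ x z, p.atInfty *ᵥ z = z → r₁ x (s₁ x z) = z := by
    intro x z hz
    obtain ⟨z, rfl⟩ := re.surjective z
    rw [hs₁, hr₁, hdu, add_sub_cancel, ← hinf, hz]
  have key : ∀ x v w, r₁ x (σ x v, w) = p.atInfty *ᵥ r₀ x (v, w) := by
    intro x v w
    rw [hr₁, hr₀, hinf, map_add pr, hk, hembr]
  have hiso : ((⟨B₀, B₁, σ, hT⟩ : KTriple X).sum (KTriple.id B)).IsIso p.triple := by
    refine ⟨CBundle.isoImage _ (continuous_evalAt p.mat) p.isIdempotentElem_valAt r₀ s₀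
      hrc₀ hsc₀ hsr₀ hPr₀ hrs₀, CBundle.isoImage _ continuous_const
      (fun _ => p.isIdempotentElem_atInfty) r₁ s₁ hrc₁ hsc₁ hsr₁ hPr₁ hrs₁, ∅, isCompact_empty,
      fun x _ w => CBundle.range_ext (P := p.atInfty) ?_⟩
    obtain ⟨v, w⟩ := w
    refine (hPr₁ x (σ x v, w)).trans ((key x v w).trans ?_)
    refine congrArg (p.atInfty *ᵥ ·) ?_
    exact ((Matrix.one_mulVec _).trans (hPr₀ x (v, w))).symm
  rw [← KTop.mk_iso hiso, KTop.mk_sum, KTop.mk_id, add_zero]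

theorem mk_triple_ofMatrix {a b : ℕ} {B₀ B₁ : CBundle.{u, v} X}
    (σ : ∀ x, B₀.Fiber x →ₗ[ℂ] B₁.Fiber x)
    (hT : ∃ K : Set X, IsCompact K ∧ CBundle.ContOn B₀ B₁ σ Kᶜ ∧
      ∀ x ∉ K, Function.Bijective (σ x))
    (k : ∀ x, B₀.Fiber x →ₗ[ℂ] (Fin a ⊕ Fin b → ℂ)) (h : ∀ x, (Fin a ⊕ Fin b → ℂ) →ₗ[ℂ] B₀.Fiber x)
    (g : ∀ x, B₁.Fiber x →ₗ[ℂ] (Fin b → ℂ)) (g' : ∀ x, (Fin b → ℂ) →ₗ[ℂ] B₁.Fiber x)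
    (hkc : Continuous fun e : B₀.Total => k e.proj e.snd)
    (hhc : Continuous fun z : X × (Fin a ⊕ Fin b → ℂ) => (⟨z.1, h z.1 z.2⟩ : B₀.Total))
    (hgc : Continuous fun e : B₁.Total => g e.proj e.snd)
    (hgc' : Continuous fun z : X × (Fin b → ℂ) => (⟨z.1, g' z.1 z.2⟩ : B₁.Total))
    (hk : ∀ x w, LinearMap.funLeft ℂ ℂ Sum.inr (k x w) = g x (σ x w))
    (hhk : ∀ x w, h x (k x w) = w) (hgg : ∀ x w, g' x (g x w) = w)
    (hh0 : ∀ x w, g' x w = 0 → h x (inrLinear a b w) = 0)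
    (e : Matrix (Fin a ⊕ Fin b) (Fin a ⊕ Fin b) (Unitization ℂ C₀(X, ℂ))) (he : IsStarProjection e)
    (hs : e.map (scalarPart C₀(X, ℂ)) = blockOne a b ℂ)
    (hex : ∀ x z, e.map (evalAt x) *ᵥ z = k x (h x z) + inrLinear a b
      (LinearMap.funLeft ℂ ℂ Sum.inr z - g x (g' x (LinearMap.funLeft ℂ ℂ Sum.inr z)))) :
    KTop.mk (MatProj.ofMatrix finSumFinEquiv e he).triple = KTop.mk ⟨B₀, B₁, σ, hT⟩ := by
  refine mk_triple_eq_of_range σ hT k h g g' hkc hhc hgc hgc' hk hhk hgg hh0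
    (MatProj.ofMatrix finSumFinEquiv e he)
    (LinearEquiv.funCongrLeft ℂ ℂ finSumFinEquiv.symm) (fun z => ?_) fun x z => ?_
  · refine (submatrix_mulVec_funCongrLeft finSumFinEquiv (e.map (scalarPart C₀(X, ℂ))) z).trans ?_
    rw [hs, blockOne_mulVec]; rfl
  · exact (submatrix_mulVec_funCongrLeft finSumFinEquiv (e.map (evalAt x)) z).trans
      (congrArg _ (hex x z))

end MatProj

section GraphProjection

variable {V W : Type*} [NormedAddCommGroup V] [InnerProductSpace ℂ V]
  [NormedAddCommGroup W] [InnerProductSpace ℂ W] [FiniteDimensional ℂ V] [FiniteDimensional ℂ W]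
  (T : V →ₗ[ℂ] W)

theorem mem_map_graph {z : WithLp 2 (V × W)} :
    z ∈ T.graph.map (WithLp.linearEquiv 2 ℂ (V × W)).symm.toLinearMap ↔ z.snd = T z.fst := by
  constructor
  · rintro ⟨w, hw, rfl⟩
    exact (T.mem_graph_iff _).1 hw
  · intro h
    exact ⟨(z.fst, z.snd), (T.mem_graph_iff _).2 h, rfl⟩

theorem graphProjection_snd (z : WithLp 2 (V × W)) :
    (graphProjection T z).snd = T (graphProjection T z).fst :=
  (mem_map_graph T).1 (Submodule.starProjection_apply_mem _ _)

theorem graphProjection_of_mem {z : WithLp 2 (V × W)} (h : z.snd = T z.fst) :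
    graphProjection T z = z :=
  Submodule.starProjection_eq_self_iff.2 ((mem_map_graph T).2 h)

theorem graphProjection_eq_zero {z : WithLp 2 (V × W)}
    (h : ∀ v, inner ℂ (WithLp.toLp 2 (v, T v)) z = 0) : graphProjection T z = 0 := by
  refine (Submodule.starProjection_apply_eq_zero_iff _).2 fun w hw => ?_
  have h1 := h w.fst
  rw [← (mem_map_graph T).1 hw] at h1
  exact h1

theorem inner_sub_graphProjection (z : WithLp 2 (V × W)) (v : V) :
    inner ℂ (WithLp.toLp 2 (v, T v)) (z - graphProjection T z) = 0 := by
  refine Submodule.inner_right_of_mem_orthogonal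
    (K := T.graph.map (WithLp.linearEquiv 2 ℂ (V × W)).symm.toLinearMap) ?_
    (Submodule.sub_starProjection_mem_orthogonal _)
  exact (mem_map_graph T).2 rfl

theorem inner_graphProjection (z w : WithLp 2 (V × W)) :
    inner ℂ (graphProjection T z) w = inner ℂ z (graphProjection T w) :=
  Submodule.inner_starProjection_left_eq_right _ _ _

theorem norm_graphProjection_le (z : WithLp 2 (V × W)) : ‖graphProjection T z‖ ≤ ‖z‖ :=
  Submodule.norm_starProjection_apply_le _ _

theorem sndProjection_apply (z : WithLp 2 (V × W)) :
    sndProjection V W z = WithLp.toLp 2 (0, z.snd) := rfl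

theorem inner_sndProjection (z w : WithLp 2 (V × W)) :
    inner ℂ (sndProjection V W z) w = inner ℂ z (sndProjection V W w) := by
  simp [sndProjection_apply, WithLp.prod_inner_apply]

theorem WithLp.norm_fst_le_two (z : WithLp 2 (V × W)) : ‖z.fst‖ ≤ ‖z‖ := by
  rw [WithLp.prod_norm_eq_of_L2]
  exact Real.le_sqrt_of_sq_le (by nlinarith [sq_nonneg ‖z.snd‖])

theorem WithLp.norm_snd_le_two (z : WithLp 2 (V × W)) : ‖z.snd‖ ≤ ‖z‖ := by
  rw [WithLp.prod_norm_eq_of_L2]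
  exact Real.le_sqrt_of_sq_le (by nlinarith [sq_nonneg ‖z.fst‖])

theorem WithLp.norm_le_add (z : WithLp 2 (V × W)) : ‖z‖ ≤ ‖z.fst‖ + ‖z.snd‖ := by
  rw [WithLp.prod_norm_eq_of_L2]
  exact Real.sqrt_le_iff.2 ⟨by positivity, by nlinarith [norm_nonneg z.fst, norm_nonneg z.snd]⟩

/-- The graph projection of an operator with small inverse is close to `(0 0; 0 1)`. -/
theorem norm_graphProjection_sub_le {ε : ℝ} (hε : 0 ≤ ε) (hT : Function.Surjective T)
    (h : ∀ v, ‖v‖ ≤ ε * ‖T v‖) (z : WithLp 2 (V × W)) :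
    ‖(graphProjection T - sndProjection V W) z‖ ≤ 3 * ε * ‖z‖ := by
  set y := graphProjection T z with hy
  have hy2 : y.snd = T y.fst := graphProjection_snd T z
  have hyz : ‖y‖ ≤ ‖z‖ := norm_graphProjection_le T z
  have h1 : ‖y.fst‖ ≤ ε * ‖z‖ := by
    refine (h _).trans (mul_le_mul_of_nonneg_left ?_ hε)
    rw [← hy2]
    exact (WithLp.norm_snd_le_two y).trans hyz
  have h2 : ‖(y - z).snd‖ ≤ 2 * ε * ‖z‖ := by
    obtain ⟨w, hw⟩ := hT (y - z).snd
    have h3 := inner_sub_graphProjection T z w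
    rw [← hy, ← neg_sub, inner_neg_right, neg_eq_zero, WithLp.prod_inner_apply] at h3
    change inner ℂ w (y - z).fst + inner ℂ (T w) (y - z).snd = 0 at h3
    rw [hw] at h3
    have h4 : ‖(y - z).snd‖ ^ 2 ≤ ‖w‖ * ‖(y - z).fst‖ := by
      have h5 : inner ℂ (y - z).snd (y - z).snd = -inner ℂ w (y - z).fst := by
        rw [← sub_eq_zero, sub_neg_eq_add, add_comm, h3]
      have h6 : ‖(inner ℂ (y - z).snd (y - z).snd : ℂ)‖ = ‖(y - z).snd‖ ^ 2 := by
        rw [inner_self_eq_norm_sq_to_K]; simp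
      rw [← h6, h5, norm_neg]
      exact norm_inner_le_norm _ _
    have h5 : ‖w‖ ≤ ε * ‖(y - z).snd‖ := by rw [← hw]; exact h w
    have h6 : ‖(y - z).fst‖ ≤ 2 * ‖z‖ :=
      (WithLp.norm_fst_le_two _).trans ((norm_sub_le _ _).trans (by linarith))
    by_contra! hlt
    have h7 : 0 < ‖(y - z).snd‖ := lt_of_le_of_lt (by positivity) hlt
    have h8 : ‖w‖ * ‖(y - z).fst‖ ≤ (ε * ‖(y - z).snd‖) * (2 * ‖z‖) :=
      mul_le_mul h5 h6 (norm_nonneg _) (by positivity)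
    nlinarith
  refine (WithLp.norm_le_add _).trans ?_
  have h3 : ((graphProjection T - sndProjection V W) z).fst = y.fst := by
    change y.fst - 0 = _
    simp
  have h4 : ((graphProjection T - sndProjection V W) z).snd = (y - z).snd := rfl
  rw [h3, h4]
  linarith

end GraphProjection

namespace HermitianEmbedding

variable {M : Type u} [TopologicalSpace M] {V W : Type*} [NormedAddCommGroup V] [NormedSpace ℂ V]
  [NormedAddCommGroup W] [NormedSpace ℂ W] {E F : M → Type v}
  [TopologicalSpace (TotalSpace V E)] [∀ m, NormedAddCommGroup (E m)]
  [∀ m, InnerProductSpace ℂ (E m)] [FiberBundle V E]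
  [TopologicalSpace (TotalSpace W F)] [∀ m, NormedAddCommGroup (F m)]
  [∀ m, InnerProductSpace ℂ (F m)] [FiberBundle W F]
  {a b : ℕ} [∀ m, FiniteDimensional ℂ (E m)] [∀ m, FiniteDimensional ℂ (F m)]
  (i : HermitianEmbedding V E a) (j : HermitianEmbedding W F b) (m : M)

/-- The adjoint of an isometric embedding, as a map on coordinates. -/
noncomputable def adj : (Fin a → ℂ) →ₗ[ℂ] E m :=
  LinearMap.adjoint (i.toFun m).toLinearMap ∘ₗ (WithLp.linearEquiv 2 ℂ (Fin a → ℂ)).symm.toLinearMap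

/-- The isometric embedding, as a map to coordinates. -/
noncomputable def toPi : E m →ₗ[ℂ] (Fin a → ℂ) :=
  (WithLp.linearEquiv 2 ℂ (Fin a → ℂ)).toLinearMap ∘ₗ (i.toFun m).toLinearMap

theorem adj_toPi (v : E m) : i.adj m (i.toPi m v) = v := by
  refine ext_inner_left ℂ fun w => ?_
  change inner ℂ w (LinearMap.adjoint (i.toFun m).toLinearMap (i.toFun m v)) = _
  rw [LinearMap.adjoint_inner_right]
  exact (i.toFun m).inner_map_map w v

theorem adj_eq_zero {z : Fin a → ℂ} (h : ∀ w, star (i.toPi m w) ⬝ᵥ z = 0) : i.adj m z = 0 := by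
  refine ext_inner_left ℂ fun w => ?_
  change inner ℂ w (LinearMap.adjoint (i.toFun m).toLinearMap (WithLp.toLp 2 z)) = _
  rw [LinearMap.adjoint_inner_right, EuclideanSpace.inner_eq_star_dotProduct, inner_zero_right,
    dotProduct_comm]
  exact h w

theorem inner_sum (x y : WithLp 2 (E m × F m)) :
    inner ℂ (i.sum j m x) (i.sum j m y) = inner ℂ x y := by
  rw [EuclideanSpace.inner_eq_star_dotProduct, WithLp.prod_inner_apply]
  change Sum.elim _ _ ⬝ᵥ star (Sum.elim (i.toFun m x.fst).ofLp (j.toFun m x.snd).ofLp) =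
    inner ℂ x.fst y.fst + inner ℂ x.snd y.snd
  have h1 := EuclideanSpace.inner_eq_star_dotProduct (i.toFun m x.fst) (i.toFun m y.fst)
  have h2 := EuclideanSpace.inner_eq_star_dotProduct (j.toFun m x.snd) (j.toFun m y.snd)
  rw [LinearIsometry.inner_map_map] at h1 h2
  rw [h1, h2, dotProduct, Fintype.sum_sum_type]
  rfl

theorem adjoint_sum_sum (x : WithLp 2 (E m × F m)) :
    LinearMap.adjoint (i.sum j m) (i.sum j m x) = x := by
  refine ext_inner_left ℂ fun w => ?_
  rw [LinearMap.adjoint_inner_right, inner_sum]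

theorem norm_sum (x : WithLp 2 (E m × F m)) : ‖i.sum j m x‖ = ‖x‖ := by
  rw [@norm_eq_sqrt_re_inner ℂ, inner_sum, ← @norm_eq_sqrt_re_inner ℂ]

theorem norm_adjoint_sum_le (z : EuclideanSpace ℂ (Fin a ⊕ Fin b)) :
    ‖LinearMap.adjoint (i.sum j m) z‖ ≤ ‖z‖ := by
  set w := LinearMap.adjoint (i.sum j m) z with hw
  have h1 : ‖w‖ ^ 2 ≤ ‖w‖ * ‖z‖ := by
    have h2 : (inner ℂ w w : ℂ) = inner ℂ (i.sum j m w) z := by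
      nth_rw 2 [hw]; rw [LinearMap.adjoint_inner_right]
    have h3 := norm_inner_le_norm (𝕜 := ℂ) (i.sum j m w) z
    rw [← h2, norm_sum, inner_self_eq_norm_sq_to_K] at h3
    simpa using h3
  by_contra! hlt
  nlinarith [norm_nonneg z]

theorem adjoint_sum_snd (z : EuclideanSpace ℂ (Fin a ⊕ Fin b)) :
    (LinearMap.adjoint (i.sum j m) z).snd = j.adj m (LinearMap.funLeft ℂ ℂ Sum.inr z.ofLp) := by
  refine ext_inner_left ℂ fun w => ?_
  have h1 : inner ℂ w (LinearMap.adjoint (i.sum j m) z).snd =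
      inner ℂ (WithLp.toLp 2 ((0 : E m), w)) (LinearMap.adjoint (i.sum j m) z) := by
    simp [WithLp.prod_inner_apply]
  rw [h1, LinearMap.adjoint_inner_right]
  change _ = inner ℂ w (LinearMap.adjoint (j.toFun m).toLinearMap
    (WithLp.toLp 2 (LinearMap.funLeft ℂ ℂ Sum.inr z.ofLp)))
  rw [LinearMap.adjoint_inner_right, EuclideanSpace.inner_eq_star_dotProduct,
    EuclideanSpace.inner_eq_star_dotProduct, dotProduct, Fintype.sum_sum_type]
  simp [HermitianEmbedding.sum, dotProduct, LinearMap.funLeft]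

variable (A A' : WithLp 2 (E m × F m) →ₗ[ℂ] WithLp 2 (E m × F m))

theorem pushMatrix_mulVec (z : Fin a ⊕ Fin b → ℂ) :
    i.pushMatrix j m A *ᵥ z =
      (i.sum j m (A (LinearMap.adjoint (i.sum j m) (WithLp.toLp 2 z)))).ofLp := by
  let f : (Fin a ⊕ Fin b → ℂ) →ₗ[ℂ] (Fin a ⊕ Fin b → ℂ) :=
    (WithLp.linearEquiv 2 ℂ _).toLinearMap ∘ₗ (i.sum j m ∘ₗ A ∘ₗ LinearMap.adjoint (i.sum j m)) ∘ₗ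
      (WithLp.linearEquiv 2 ℂ _).symm.toLinearMap
  have h : i.pushMatrix j m A = LinearMap.toMatrix' f := by
    ext k l
    rw [LinearMap.toMatrix'_apply]
    rfl
  rw [h, LinearMap.toMatrix'_mulVec]
  rfl

theorem pushMatrix_sub : i.pushMatrix j m (A - A') = i.pushMatrix j m A - i.pushMatrix j m A' := by
  ext k l; simp [pushMatrix]

theorem norm_pushMatrix_le {C : ℝ} (hC : 0 ≤ C) (h : ∀ z, ‖A z‖ ≤ C * ‖z‖) (k l : Fin a ⊕ Fin b) :
    ‖i.pushMatrix j m A k l‖ ≤ C := by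
  have h1 : ‖i.sum j m (A (LinearMap.adjoint (i.sum j m) (EuclideanSpace.single l 1)))‖ ≤ C := by
    rw [norm_sum]
    refine (h _).trans ?_
    have h2 := norm_adjoint_sum_le i j m (EuclideanSpace.single l (1 : ℂ))
    rw [PiLp.norm_single, norm_one] at h2
    nlinarith
  exact (PiLp.norm_apply_le _ k).trans h1

theorem isHermitian_pushMatrix (hA : ∀ x y, inner ℂ (A x) y = inner ℂ x (A y)) :
    (i.pushMatrix j m A).IsHermitian := by
  ext k l
  have h1 : ∀ k l, i.pushMatrix j m A k l = inner ℂ (EuclideanSpace.single k (1 : ℂ))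
      (i.sum j m (A (LinearMap.adjoint (i.sum j m) (EuclideanSpace.single l 1)))) := fun k l => by
    rw [EuclideanSpace.inner_single_left]; simp [pushMatrix]
  rw [Matrix.conjTranspose_apply, h1, h1, ← LinearMap.adjoint_inner_left (i.sum j m),
    ← LinearMap.adjoint_inner_left (i.sum j m), ← hA]
  exact inner_conj_symm _ _

/-- The embedding `v ↦ (v, T v)` of `E_m` into `ℂᵃ ⊕ ℂᵇ`. -/
noncomputable def graphMap (T : E m →ₗ[ℂ] F m) : E m →ₗ[ℂ] (Fin a ⊕ Fin b → ℂ) :=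
  (WithLp.linearEquiv 2 ℂ _).toLinearMap ∘ₗ i.sum j m ∘ₗ
    (WithLp.linearEquiv 2 ℂ (E m × F m)).symm.toLinearMap ∘ₗ LinearMap.id.prod T

/-- The left inverse of the embedding `v ↦ (v, T v)` of `E_m` into `ℂᵃ ⊕ ℂᵇ` which vanishes on the
orthogonal complement of its range. -/
noncomputable def graphInv (T : E m →ₗ[ℂ] F m) : (Fin a ⊕ Fin b → ℂ) →ₗ[ℂ] E m :=
  LinearMap.fst ℂ (E m) (F m) ∘ₗ (WithLp.linearEquiv 2 ℂ (E m × F m)).toLinearMap ∘ₗ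
    graphProjection T ∘ₗ LinearMap.adjoint (i.sum j m) ∘ₗ
      (WithLp.linearEquiv 2 ℂ (Fin a ⊕ Fin b → ℂ)).symm.toLinearMap

variable (T : E m →ₗ[ℂ] F m)

theorem graphMap_apply (v : E m) :
    i.graphMap j m T v = Sum.elim (i.toPi m v) (j.toPi m (T v)) := rfl

theorem graphInv_apply (z : Fin a ⊕ Fin b → ℂ) : i.graphInv j m T z =
    (graphProjection T (LinearMap.adjoint (i.sum j m) (WithLp.toLp 2 z))).fst := rfl

theorem funLeft_graphMap (v : E m) :
    LinearMap.funLeft ℂ ℂ Sum.inr (i.graphMap j m T v) = j.toPi m (T v) := rfl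

theorem graphInv_graphMap (v : E m) : i.graphInv j m T (i.graphMap j m T v) = v := by
  rw [graphInv_apply]
  change (graphProjection T (LinearMap.adjoint (i.sum j m)
    (i.sum j m (WithLp.toLp 2 (v, T v))))).fst = v
  rw [adjoint_sum_sum, graphProjection_of_mem T rfl]
  rfl

theorem graphInv_eq_zero {z : Fin a ⊕ Fin b → ℂ} (h : ∀ w, star (i.graphMap j m T w) ⬝ᵥ z = 0) :
    i.graphInv j m T z = 0 := by
  rw [graphInv_apply, graphProjection_eq_zero]
  · rfl
  · intro v
    rw [LinearMap.adjoint_inner_right, EuclideanSpace.inner_eq_star_dotProduct, dotProduct_comm]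
    exact h v

theorem graphInv_inrLinear {w : Fin b → ℂ} (hw : j.adj m w = 0) :
    i.graphInv j m T (inrLinear a b w) = 0 := by
  refine i.graphInv_eq_zero j m T fun v => ?_
  rw [graphMap_apply, inrLinear_apply, dotProduct, Fintype.sum_sum_type]
  have h1 : inner ℂ (T v) (j.adj m w) = star (j.toPi m (T v)) ⬝ᵥ w := by
    change inner ℂ (T v) (LinearMap.adjoint (j.toFun m).toLinearMap (WithLp.toLp 2 w)) = _
    rw [LinearMap.adjoint_inner_right, EuclideanSpace.inner_eq_star_dotProduct, dotProduct_comm]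
    rfl
  rw [hw, inner_zero_right] at h1
  simpa [dotProduct] using h1.symm

theorem pushMatrix_graphProjection_mulVec (z : Fin a ⊕ Fin b → ℂ) :
    i.pushMatrix j m (graphProjection T) *ᵥ z = i.graphMap j m T (i.graphInv j m T z) := by
  rw [pushMatrix_mulVec, graphMap_apply, graphInv_apply]
  set y := graphProjection T (LinearMap.adjoint (i.sum j m) (WithLp.toLp 2 z)) with hy
  rw [← graphProjection_snd]
  rfl

theorem pushMatrix_sndProjection_mulVec (z : Fin a ⊕ Fin b → ℂ) :
    i.pushMatrix j m (sndProjection (E m) (F m)) *ᵥ z =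
      inrLinear a b (j.toPi m (j.adj m (LinearMap.funLeft ℂ ℂ Sum.inr z))) := by
  rw [pushMatrix_mulVec, sndProjection_apply, adjoint_sum_snd]
  ext (k | k) <;> simp [HermitianEmbedding.sum, inrLinear_apply, toPi]

theorem graphMatrix_mulVec (z : Fin a ⊕ Fin b → ℂ) :
    (blockOne a b ℂ + i.pushMatrix j m (graphProjection T - sndProjection (E m) (F m))) *ᵥ z =
      i.graphMap j m T (i.graphInv j m T z) + inrLinear a b (LinearMap.funLeft ℂ ℂ Sum.inr z -
        j.toPi m (j.adj m (LinearMap.funLeft ℂ ℂ Sum.inr z))) := by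
  rw [pushMatrix_sub, Matrix.add_mulVec, Matrix.sub_mulVec, blockOne_mulVec,
    pushMatrix_graphProjection_mulVec, pushMatrix_sndProjection_mulVec, map_sub]
  abel

theorem isStarProjection_graphMatrix : IsStarProjection
    (blockOne a b ℂ + i.pushMatrix j m (graphProjection T - sndProjection (E m) (F m))) := by
  constructor
  · refine Matrix.toLin'.injective (LinearMap.ext fun z => ?_)
    rw [Matrix.toLin'_apply, Matrix.toLin'_apply, ← Matrix.mulVec_mulVec, graphMatrix_mulVec,
      graphMatrix_mulVec]
    set w := LinearMap.funLeft ℂ ℂ Sum.inr z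
    have h1 : j.adj m (w - j.toPi m (j.adj m w)) = 0 := by rw [map_sub, adj_toPi, sub_self]
    have h2 : LinearMap.funLeft ℂ ℂ Sum.inr (inrLinear a b (w - j.toPi m (j.adj m w))) =
      w - j.toPi m (j.adj m w) := rfl
    rw [map_add (i.graphInv j m T), graphInv_graphMap, graphInv_inrLinear i j m T h1, add_zero,
      map_add (LinearMap.funLeft ℂ ℂ Sum.inr), h2, funLeft_graphMap, map_add (j.adj m), adj_toPi,
      h1, add_zero, add_sub_cancel_left]
  · rw [pushMatrix_sub]
    exact (Matrix.IsHermitian.add (isStarProjection_blockOne a b ℂ).isSelfAdjoint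
      ((isHermitian_pushMatrix i j m _ (inner_graphProjection T)).sub
        (isHermitian_pushMatrix i j m _ inner_sndProjection)))

end HermitianEmbedding

section HermitianEmbedding

variable {M : Type u} [TopologicalSpace M] {V : Type*} [NormedAddCommGroup V] [NormedSpace ℂ V]
  {E : M → Type v} [TopologicalSpace (TotalSpace V E)] [∀ m, NormedAddCommGroup (E m)]
  [∀ m, InnerProductSpace ℂ (E m)] [FiberBundle V E]
  (e : Trivialization V (π V E)) [e.IsLinear ℂ]

theorem Bundle.Trivialization.continuousOn_mk_symmₗ :
    ContinuousOn (fun z : M × V => (⟨z.1, e.symmₗ ℂ z.1 z.2⟩ : TotalSpace V E))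
      (e.baseSet ×ˢ univ) :=
  e.continuousOn_symm.congr fun z hz => by rw [e.symmₗ_apply hz.1]

theorem continuousOn_norm_symmₗ (hE : Continuous fun z : TotalSpace V E => ‖z.snd‖) :
    ContinuousOn (fun z : M × V => ‖e.symmₗ ℂ z.1 z.2‖) (e.baseSet ×ˢ univ) :=
  hE.comp_continuousOn e.continuousOn_mk_symmₗ

theorem continuousOn_inner_symmₗ (hE : Continuous fun z : TotalSpace V E => ‖z.snd‖)
    {Z : Type*} [TopologicalSpace Z] {s : Set Z} {p : Z → M}
    {c d : Z → V} (hp : ContinuousOn p s) (hc : ContinuousOn c s) (hd : ContinuousOn d s)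
    (hs : MapsTo p s e.baseSet) :
    ContinuousOn (fun z => inner ℂ (e.symmₗ ℂ (p z) (c z)) (e.symmₗ ℂ (p z) (d z))) s := by
  have h : ∀ f : Z → V, ContinuousOn f s →
      ContinuousOn (fun z => ((‖e.symmₗ ℂ (p z) (f z)‖ : ℝ) : ℂ)) s := fun f hf =>
    Complex.continuous_ofReal.comp_continuousOn ((continuousOn_norm_symmₗ e hE).comp
      (hp.prodMk hf) fun z hz => ⟨hs hz, mem_univ _⟩)
  have h1 := h _ (hc.add hd)
  have h2 := h _ (hc.sub hd)
  have h3 := h _ (hc.sub (hd.const_smul Complex.I))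
  have h4 := h _ (hc.add (hd.const_smul Complex.I))
  refine ((((h1.pow 2).sub (h2.pow 2)).add (((h3.pow 2).sub (h4.pow 2)).mul
    (continuousOn_const (c := Complex.I)))).div_const 4).congr fun z _ => ?_
  rw [inner_eq_sum_norm_sq_div_four]
  simp

/-- Over the domain of a trivialization, there is a continuous family of isometries of a Hermitian
bundle to `ℂⁿ`, by the Gram–Schmidt process. -/
theorem exists_isometry_trivialization [FiniteDimensional ℂ V]
    (hE : Continuous fun z : TotalSpace V E => ‖z.snd‖) :
    ∃ ι : ∀ m, E m →ₗ[ℂ] (Fin (Module.finrank ℂ V) → ℂ),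
      (∀ m ∈ e.baseSet, ∀ v, ∑ k, ‖ι m v k‖ ^ 2 = ‖v‖ ^ 2) ∧
      ContinuousOn (fun z : TotalSpace V E => ι z.proj z.snd) (TotalSpace.proj ⁻¹' e.baseSet) := by
  let f : ∀ m, Fin (Module.finrank ℂ V) → E m := fun m l =>
    e.symmₗ ℂ m (Module.finBasis ℂ V l)
  have hf : ∀ m ∈ e.baseSet, LinearIndependent ℂ (f m) ∧ ⊤ ≤ Submodule.span ℂ (range (f m)) := by
    intro m hm
    have h : f m = (Module.finBasis ℂ V).map (e.linearEquivAt ℂ m hm).symm := by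
      ext l
      simp only [f, Module.Basis.map_apply, e.symmₗ_apply hm]
      rfl
    rw [h]
    exact ⟨Module.Basis.linearIndependent _, (Module.Basis.span_eq _).ge⟩
  let c : Fin (Module.finrank ℂ V) → M → V := fun k m =>
    e.linearMapAt ℂ m (InnerProductSpace.gramSchmidt ℂ (f m) k)
  have hc : ∀ k, ∀ m ∈ e.baseSet,
      e.symmₗ ℂ m (c k m) = InnerProductSpace.gramSchmidt ℂ (f m) k := fun k m hm =>
    e.symmₗ_linearMapAt hm _
  have hne : ∀ k, ∀ m ∈ e.baseSet, (‖e.symmₗ ℂ m (c k m)‖ : ℂ) ≠ 0 := fun k m hm => by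
    rw [hc k m hm]
    exact_mod_cast norm_ne_zero_iff.2 (InnerProductSpace.gramSchmidt_ne_zero k (hf m hm).1)
  have hcc : ∀ k, ContinuousOn (c k) e.baseSet := by
    intro k
    induction k using WellFoundedLT.induction with
    | ind k ih =>
      have h1 : ∀ m ∈ e.baseSet, c k m = Module.finBasis ℂ V k - ∑ i ∈ Finset.Iio k,
          (inner ℂ (e.symmₗ ℂ m (c i m)) (e.symmₗ ℂ m (Module.finBasis ℂ V k)) /
            (‖e.symmₗ ℂ m (c i m)‖ : ℂ) ^ 2) • c i m := by
        intro m hm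
        rw [eq_sub_iff_add_eq]
        have h2 := congrArg (e.linearMapAt ℂ m)
          (InnerProductSpace.gramSchmidt_def'' ℂ (f m) k)
        rw [map_add, map_sum] at h2
        simp only [map_smul] at h2
        refine Eq.trans ?_ (h2.symm.trans (e.linearMapAt_symmₗ hm _))
        refine congrArg _ (Finset.sum_congr rfl fun i _ => ?_)
        rw [hc i m hm]
        rfl
      refine ContinuousOn.congr (continuousOn_const.sub (continuousOn_finsetSum _ fun i hi => ?_)) h1
      have h3 := ih i (Finset.mem_Iio.1 hi)
      refine ((continuousOn_inner_symmₗ e hE continuousOn_id h3 continuousOn_const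
        fun m hm => hm).div ?_ fun m hm => pow_ne_zero 2 (hne i m hm)).smul h3
      exact (Complex.continuous_ofReal.comp_continuousOn ((continuousOn_norm_symmₗ e hE).comp
        (continuousOn_id.prodMk h3) fun m hm => ⟨hm, mem_univ _⟩)).pow 2
  refine ⟨fun m => LinearMap.pi fun k =>
    (innerₛₗ ℂ (InnerProductSpace.gramSchmidtNormed ℂ (f m) k) : E m →ₗ[ℂ] ℂ), ?_, ?_⟩
  · intro m hm v
    have h1 := InnerProductSpace.gramSchmidtNormed_orthonormal (hf m hm).1
    let b := OrthonormalBasis.mk h1 (by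
      rw [InnerProductSpace.span_gramSchmidtNormed_range, InnerProductSpace.span_gramSchmidt]
      exact (hf m hm).2)
    have h2 := b.sum_sq_norm_inner_right v
    rw [← h2]
    refine Finset.sum_congr rfl fun k _ => ?_
    simp [b]
  · refine continuousOn_pi.2 fun k => ?_
    have h1 : ContinuousOn (fun z : TotalSpace V E => (e z).2) (TotalSpace.proj ⁻¹' e.baseSet) := by
      rw [← e.source_eq]
      exact continuous_snd.comp_continuousOn e.continuousOn
    have h2 := (FiberBundle.continuous_proj V E).continuousOn (s := TotalSpace.proj ⁻¹' e.baseSet)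
    have h3 := (hcc k).comp h2 fun z hz => hz
    have h4 : ContinuousOn (fun z : TotalSpace V E => (‖e.symmₗ ℂ z.proj (c k z.proj)‖ : ℂ))
        (TotalSpace.proj ⁻¹' e.baseSet) :=
      Complex.continuous_ofReal.comp_continuousOn ((continuousOn_norm_symmₗ e hE).comp
        (h2.prodMk h3) fun m hm => ⟨hm, mem_univ _⟩)
    refine ((h4.inv₀ fun z hz => hne k _ hz).mul
      (continuousOn_inner_symmₗ e hE h2 h3 h1 fun z hz => hz)).congr fun z hz => ?_
    have h5 : e.symmₗ ℂ z.proj (e z).2 = z.snd := by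
      rw [e.symmₗ_apply hz, e.symm_proj_apply z hz]
    have h6 := hc k _ hz
    simp only [Pi.mul_apply, Pi.inv_apply, Function.comp_apply, h5, h6]
    simp [InnerProductSpace.gramSchmidtNormed]

/-- A Hermitian bundle over a compact Hausdorff space embeds isometrically in a trivial bundle. -/
theorem exists_hermitianEmbedding [CompactSpace M] [T2Space M] [FiniteDimensional ℂ V]
    [VectorBundle ℂ V E] (hE : Continuous fun z : TotalSpace V E => ‖z.snd‖) :
    ∃ a : ℕ, Nonempty (HermitianEmbedding V E a) := by
  obtain ⟨t, -, ht⟩ := isCompact_univ.elim_nhds_subcover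
    (fun m => (trivializationAt V E m).baseSet) fun m _ => (trivializationAt V E m).open_baseSet.mem_nhds
      (FiberBundle.mem_baseSet_trivializationAt V E m)
  let e : Fin t.card → Trivialization V (π V E) := fun k =>
    trivializationAt V E (t.equivFin.symm k : M)
  obtain ⟨ρ, hρs, hρ1, hρ0, -⟩ := exists_continuous_sum_one_of_isOpen_isCompact
    (s := fun k => (e k).baseSet) (fun k => (e k).open_baseSet) isCompact_univ (by
      intro m hm
      obtain ⟨m', hm', h⟩ := mem_iUnion₂.1 (ht hm)
      refine mem_iUnion.2 ⟨t.equivFin ⟨m', hm'⟩, ?_⟩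
      simpa [e] using h)
  choose ι hιn hιc using fun k => exists_isometry_trivialization (e k) hE
  let n := Module.finrank ℂ V
  let g : ∀ m, E m →ₗ[ℂ] (Fin (t.card * n) → ℂ) := fun m => LinearMap.pi fun l =>
    ((Real.sqrt (ρ (finProdFinEquiv.symm l).1 m) : ℝ) : ℂ) •
      (LinearMap.proj (finProdFinEquiv.symm l).2 ∘ₗ ι (finProdFinEquiv.symm l).1 m)
  have hg : ∀ m v k l, g m v (finProdFinEquiv (k, l)) =
      ((Real.sqrt (ρ k m) : ℝ) : ℂ) * ι k m v l := fun m v k l => by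
    change ((Real.sqrt (ρ (finProdFinEquiv.symm (finProdFinEquiv (k, l))).1 m) : ℝ) : ℂ) *
      ι (finProdFinEquiv.symm (finProdFinEquiv (k, l))).1 m v
        (finProdFinEquiv.symm (finProdFinEquiv (k, l))).2 = _
    rw [Equiv.symm_apply_apply]
  refine ⟨t.card * n, ⟨⟨fun m => ⟨(WithLp.linearEquiv 2 ℂ _).symm.toLinearMap ∘ₗ g m, fun v => ?_⟩,
    ?_⟩⟩⟩
  · change ‖WithLp.toLp 2 (g m v)‖ = ‖v‖
    have h1 : ∀ k, ∑ l, ‖g m v (finProdFinEquiv (k, l))‖ ^ 2 = ρ k m * ‖v‖ ^ 2 := fun k => by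
      simp only [hg, norm_mul, mul_pow, Complex.norm_real, Real.norm_eq_abs, sq_abs,
        Real.sq_sqrt (hρ0 k m).1, ← Finset.mul_sum]
      by_cases hm : m ∈ (e k).baseSet
      · rw [hιn k m hm]
      · rw [image_eq_zero_of_notMem_tsupport fun h => hm (hρs k h), zero_mul, zero_mul]
    have h2 : ∑ k, ρ k m = 1 := by simpa using hρ1 (mem_univ m)
    rw [EuclideanSpace.norm_eq, ← finProdFinEquiv.sum_comp, Fintype.sum_prod_type]
    simp only [h1, ← Finset.sum_mul, h2, one_mul]
    exact Real.sqrt_sq (norm_nonneg v)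
  · refine (PiLp.continuous_toLp 2 _).comp (continuous_pi fun l => ?_)
    obtain ⟨⟨k, l⟩, rfl⟩ := finProdFinEquiv.surjective l
    refine (continuous_iff_continuousAt.2 fun z => ?_ :
      Continuous fun z : TotalSpace V E => g z.proj z.snd (finProdFinEquiv (k, l)))
    simp only [hg]
    have hp := FiberBundle.continuous_proj V E
    by_cases hz : z.proj ∈ (e k).baseSet
    · refine ContinuousAt.mul (Complex.continuous_ofReal.comp (Real.continuous_sqrt.comp
        ((ρ k).continuous.comp hp))).continuousAt ?_
      exact ((continuous_apply l).comp_continuousOn (hιc k)).continuousAt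
        (((e k).open_baseSet.preimage hp).mem_nhds hz)
    · have h1 : ∀ᶠ y : TotalSpace V E in 𝓝 z, ρ k y.proj = 0 := by
        have h2 := (isClosed_tsupport (ρ k)).isOpen_compl.mem_nhds fun h => hz (hρs k h)
        filter_upwards [hp.continuousAt.preimage_mem_nhds h2] with y hy
        exact image_eq_zero_of_notMem_tsupport hy
      refine (continuousAt_const (y := (0 : ℂ))).congr ?_
      filter_upwards [h1] with y hy
      simp [hy]

end HermitianEmbedding

section FoliationCharts

variable {p q : ℕ} {M : Type u} [TopologicalSpace M] [ChartedSpace (FolModel p q) M]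
  [IsManifold 𝓘(ℝ, FolModel p q) ∞ M]

/-- The Jacobian matrix of the change of coordinates from `ψ` to `φ`, as a linear map. -/
noncomputable def chartJacobian (φ ψ : OpenPartialHomeomorph M (FolModel p q)) (m : M) :
    FolModel p q →L[ℝ] FolModel p q :=
  fderiv ℝ (φ ∘ ψ.symm) (ψ m)

variable {φ ψ : OpenPartialHomeomorph M (FolModel p q)}

theorem mdifferentiableAt_chart (hφ : φ ∈ IsManifold.maximalAtlas 𝓘(ℝ, FolModel p q) ∞ M) {m : M}
    (hm : m ∈ φ.source) :
    MDifferentiableAt 𝓘(ℝ, FolModel p q) 𝓘(ℝ, FolModel p q) φ m :=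
  ((contMDiffOn_of_mem_maximalAtlas hφ).contMDiffAt (φ.open_source.mem_nhds hm)).mdifferentiableAt
    (by simp)

theorem mdifferentiableAt_chart_symm
    (hφ : φ ∈ IsManifold.maximalAtlas 𝓘(ℝ, FolModel p q) ∞ M) {m : M} (hm : m ∈ φ.source) :
    MDifferentiableAt 𝓘(ℝ, FolModel p q) 𝓘(ℝ, FolModel p q) φ.symm (φ m) :=
  ((contMDiffOn_symm_of_mem_maximalAtlas hφ).contMDiffAt
    (φ.open_target.mem_nhds (φ.map_source hm))).mdifferentiableAt (by simp)

theorem mfderiv_coordVec (hφ : φ ∈ IsManifold.maximalAtlas 𝓘(ℝ, FolModel p q) ∞ M)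
    (hψ : ψ ∈ IsManifold.maximalAtlas 𝓘(ℝ, FolModel p q) ∞ M) {m : M} (hm : m ∈ φ.source)
    (hm' : m ∈ ψ.source) (k : Fin p ⊕ Fin q) :
    mfderiv 𝓘(ℝ, FolModel p q) 𝓘(ℝ, FolModel p q) φ m (coordVec ψ k m) =
      chartJacobian φ ψ m (EuclideanSpace.single k 1) := by
  have h := mfderiv_comp_of_eq (I := 𝓘(ℝ, FolModel p q)) (mdifferentiableAt_chart hφ hm)
    (mdifferentiableAt_chart_symm hψ hm') (ψ.left_inv hm')
  rw [chartJacobian, ← mfderiv_eq_fderiv, h, ψ.left_inv hm']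
  rfl

theorem mfderiv_coordVec_self (hφ : φ ∈ IsManifold.maximalAtlas 𝓘(ℝ, FolModel p q) ∞ M) {m : M}
    (hm : m ∈ φ.source) (k : Fin p ⊕ Fin q) :
    mfderiv 𝓘(ℝ, FolModel p q) 𝓘(ℝ, FolModel p q) φ m (coordVec φ k m) =
      EuclideanSpace.single k (1 : ℝ) := by
  rw [mfderiv_coordVec hφ hφ hm hm, chartJacobian]
  have h : φ ∘ φ.symm =ᶠ[𝓝 (φ m)] id := by
    filter_upwards [φ.open_target.mem_nhds (φ.map_source hm)] with z hz using φ.right_inv hz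
  rw [h.fderiv_eq, fderiv_id]
  rfl

theorem eq_sum_coordVec (hφ : φ ∈ IsManifold.maximalAtlas 𝓘(ℝ, FolModel p q) ∞ M) {m : M}
    (hm : m ∈ φ.source) (v : TangentSpace 𝓘(ℝ, FolModel p q) m) :
    v = ∑ k, (show FolModel p q from
      mfderiv 𝓘(ℝ, FolModel p q) 𝓘(ℝ, FolModel p q) φ m v) k • coordVec φ k m := by
  have h := mfderiv_comp (I := 𝓘(ℝ, FolModel p q)) m (mdifferentiableAt_chart_symm hφ hm)
    (mdifferentiableAt_chart hφ hm)
  have h2 : φ.symm ∘ φ =ᶠ[𝓝 m] id := by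
    filter_upwards [φ.open_source.mem_nhds hm] with z hz using φ.left_inv hz
  rw [h2.mfderiv_eq, mfderiv_id] at h
  have h3 := DFunLike.congr_fun h v
  refine h3.trans ?_
  set w : FolModel p q := mfderiv 𝓘(ℝ, FolModel p q) 𝓘(ℝ, FolModel p q) φ m v with hw
  have h4 : w = ∑ k, w k • EuclideanSpace.single k (1 : ℝ) := by
    ext (l | l) <;> simp [Pi.single_apply]
  let D : FolModel p q →L[ℝ] FolModel p q :=
    mfderiv 𝓘(ℝ, FolModel p q) 𝓘(ℝ, FolModel p q) φ.symm (φ m)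
  change D w = ∑ k, w k • D (EuclideanSpace.single k (1 : ℝ))
  conv_lhs => rw [h4]
  rw [map_sum]
  simp only [map_smul]

theorem continuousOn_chartJacobian (hφ : φ ∈ IsManifold.maximalAtlas 𝓘(ℝ, FolModel p q) ∞ M)
    (hψ : ψ ∈ IsManifold.maximalAtlas 𝓘(ℝ, FolModel p q) ∞ M) :
    ContinuousOn (chartJacobian φ ψ) (φ.source ∩ ψ.source) := by
  have h1 : ContDiffOn ℝ ∞ (φ ∘ ψ.symm) (ψ.symm.trans φ).source := by
    refine ContMDiffOn.contDiffOn ((contMDiffOn_of_mem_maximalAtlas hφ).comp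
      ((contMDiffOn_symm_of_mem_maximalAtlas hψ).mono ?_) ?_)
    · intro z hz
      exact hz.1
    · intro z hz
      exact hz.2
  have h2 := h1.continuousOn_fderiv_of_isOpen (ψ.symm.trans φ).open_source (by simp)
  refine h2.comp (ψ.continuousOn.mono inter_subset_right) fun m hm => ?_
  simp [ψ.map_source hm.2, ψ.left_inv hm.2, hm.1]

end FoliationCharts

namespace HNDual

variable {p q : ℕ} {M : Type u} [TopologicalSpace M] [ChartedSpace (FolModel p q) M]
  {𝓕 : Foliation p q M}

/-- The linear form on the tangent space at `m` with coefficients `z` in the chart `φ`. -/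
noncomputable def chartForm (φ : OpenPartialHomeomorph M (FolModel p q)) (m : M)
    (z : Fin p ⊕ Fin q → ℝ) : Module.Dual ℝ (TangentSpace 𝓘(ℝ, FolModel p q) m) :=
  ∑ k, z k • ((EuclideanSpace.proj k : FolModel p q →L[ℝ] ℝ) ∘L
    (mfderiv 𝓘(ℝ, FolModel p q) 𝓘(ℝ, FolModel p q) φ m :
      FolModel p q →L[ℝ] FolModel p q)).toLinearMap

theorem chartForm_apply (φ : OpenPartialHomeomorph M (FolModel p q)) (m : M)
    (z : Fin p ⊕ Fin q → ℝ) (v : TangentSpace 𝓘(ℝ, FolModel p q) m) :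
    chartForm φ m z v = ∑ k, z k * (show FolModel p q from
      mfderiv 𝓘(ℝ, FolModel p q) 𝓘(ℝ, FolModel p q) φ m v) k := by
  rw [chartForm, LinearMap.sum_apply]
  rfl

open scoped Classical in
variable (𝓕) in
/-- The point of `H* ⊕ N*` over `m` with fibre coordinates `z` in the chart `φ`. -/
noncomputable def ofCoord (φ : OpenPartialHomeomorph M (FolModel p q)) (m : M)
    (z : Fin p ⊕ Fin q → ℝ) : HNDual 𝓕 where
  base := m
  ξ := (chartForm φ m z).domRestrict (𝓕.H m)
  η := if h : 𝓕.H m ≤ LinearMap.ker (chartForm φ m (Sum.elim 0 (z ∘ Sum.inr))) then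
    (𝓕.H m).liftQ _ h else 0

variable {φ ψ : OpenPartialHomeomorph M (FolModel p q)}

theorem coordVec_mem (hφ : IsFoliationChart 𝓕.H φ) {m : M} (hm : m ∈ φ.source) (i : Fin p) :
    coordVec φ (.inl i) m ∈ 𝓕.H m := by
  rw [hφ.2 m hm]
  exact Submodule.subset_span ⟨i, rfl⟩

theorem coord_inl (hφ : IsFoliationChart 𝓕.H φ) {x : HNDual 𝓕} (hx : x.base ∈ φ.source)
    (i : Fin p) : x.coord φ (.inl i) = x.ξ ⟨_, coordVec_mem hφ hx i⟩ :=
  dif_pos (coordVec_mem hφ hx i)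

theorem coord_inr (x : HNDual 𝓕) (j : Fin q) :
    x.coord φ (.inr j) = x.η (Submodule.Quotient.mk (coordVec φ (.inr j) x.base)) := rfl

theorem coord_eq_zero {x : HNDual 𝓕} (hξ : x.ξ = 0) (hη : x.η = 0) : x.coord φ = 0 := by
  ext (i | j)
  · simp [coord, hξ]
  · simp [coord, hη]

theorem ext_of_coord [IsManifold 𝓘(ℝ, FolModel p q) ∞ M] (hφ : IsFoliationChart 𝓕.H φ)
    {x y : HNDual 𝓕} (hx : x.base ∈ φ.source)
    (hb : x.base = y.base) (h : x.coord φ = y.coord φ) : x = y := by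
  obtain ⟨m, ξ, η⟩ := x
  obtain ⟨m', ξ', η'⟩ := y
  obtain rfl : m = m' := hb
  congr 1
  · refine LinearMap.ext fun v => ?_
    obtain ⟨v, hv⟩ := v
    have h1 := hv
    rw [hφ.2 m hx] at h1
    induction h1 using Submodule.span_induction with
    | mem v h2 =>
      obtain ⟨i, rfl⟩ := h2
      have h3 := congrFun h (.inl i)
      rwa [coord_inl hφ hx, coord_inl (x := ⟨m, ξ', η'⟩) hφ hx] at h3
    | zero => exact (map_zero ξ).trans (map_zero ξ').symm
    | add v w h2 h3 h4 h5 =>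
      rw [← hφ.2 m hx] at h2 h3
      have h6 := congrArg₂ (· + ·) (h4 h2) (h5 h3)
      simp only [← map_add] at h6
      exact h6
    | smul c v h2 h3 =>
      rw [← hφ.2 m hx] at h2
      have h6 := congrArg (c • ·) (h3 h2)
      simp only [← map_smul] at h6
      exact h6
  · refine LinearMap.ext fun v => ?_
    obtain ⟨v, rfl⟩ := Submodule.Quotient.mk_surjective _ v
    rw [eq_sum_coordVec hφ.1 hx v]
    change (η ∘ₗ (𝓕.H m).mkQ) _ = (η' ∘ₗ (𝓕.H m).mkQ) _
    rw [map_sum, map_sum]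
    refine Finset.sum_congr rfl fun k _ => ?_
    rw [map_smul, map_smul]
    congr 1
    rcases k with i | j
    · have h1 : (𝓕.H m).mkQ (coordVec φ (.inl i) m) = 0 :=
        (Submodule.Quotient.mk_eq_zero _).2 (coordVec_mem hφ hx i)
      rw [LinearMap.comp_apply, LinearMap.comp_apply, h1, map_zero, map_zero]
    · exact congrFun h (.inr j)

theorem continuousOn_coord (hφ : IsFoliationChart 𝓕.H φ) :
    ContinuousOn (fun x : HNDual 𝓕 => x.coord φ) (base ⁻¹' φ.source) := by
  have hb : Continuous (base : HNDual 𝓕 → M) := (proj 𝓕).continuous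
  refine (continuousOn_open_iff (φ.open_source.preimage hb)).2 fun V hV => ?_
  have h : IsOpen {x : HNDual 𝓕 | x.base ∈ φ.source ∧ x.coord φ ∈ V} := by
    have h1 : IsOpen[TopologicalSpace.generateFrom
        {s | ∃ (φ : OpenPartialHomeomorph M (FolModel p q)) (V : Set (Fin p ⊕ Fin q → ℝ)),
          IsFoliationChart 𝓕.H φ ∧ IsOpen V ∧ s = {x : HNDual 𝓕 | x.base ∈ φ.source ∧
            x.coord φ ∈ V}}] {x : HNDual 𝓕 | x.base ∈ φ.source ∧ x.coord φ ∈ V} :=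
      TopologicalSpace.isOpen_generateFrom_of_mem ⟨φ, V, hφ, hV, rfl⟩
    exact (inf_le_right : (inferInstance : TopologicalSpace (HNDual 𝓕)) ≤ _) _ h1
  exact h

variable [IsManifold 𝓘(ℝ, FolModel p q) ∞ M]

theorem coord_ofCoord (hφ : IsFoliationChart 𝓕.H φ) (hψ : IsFoliationChart 𝓕.H ψ) {m : M}
    (hm : m ∈ φ.source) (hm' : m ∈ ψ.source) (z : Fin p ⊕ Fin q → ℝ) :
    (ofCoord 𝓕 φ m z).coord ψ = Sum.elim
      (fun i => ∑ k, z k * chartJacobian φ ψ m (EuclideanSpace.single (.inl i) 1) k)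
      (fun j => ∑ k, (Sum.elim 0 (z ∘ Sum.inr) : Fin p ⊕ Fin q → ℝ) k *
        chartJacobian φ ψ m (EuclideanSpace.single (.inr j) 1) k) := by
  ext (i | j)
  · rw [coord_inl hψ hm', Sum.elim_inl]
    refine (chartForm_apply φ m z _).trans ?_
    refine Finset.sum_congr rfl fun k _ => ?_
    rw [← mfderiv_coordVec hφ.1 hψ.1 hm hm']
    rfl
  · have hk : 𝓕.H m ≤ LinearMap.ker (chartForm φ m (Sum.elim 0 (z ∘ Sum.inr))) := by
      rw [hφ.2 m hm, Submodule.span_le]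
      rintro _ ⟨i, rfl⟩
      refine LinearMap.mem_ker.2 ((chartForm_apply φ m _ _).trans ?_)
      rw [Fintype.sum_sum_type, mfderiv_coordVec_self hφ.1 hm]
      simp
    rw [coord_inr, Sum.elim_inr]
    have h1 : (ofCoord 𝓕 φ m z).η = (𝓕.H m).liftQ _ hk := dif_pos hk
    rw [h1]
    refine (Submodule.liftQ_apply _ _ _).trans ((chartForm_apply φ m _ _).trans ?_)
    refine Finset.sum_congr rfl fun k _ => ?_
    rw [← mfderiv_coordVec hφ.1 hψ.1 hm hm']
    rfl

theorem coord_ofCoord_self (hφ : IsFoliationChart 𝓕.H φ) {m : M}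
    (hm : m ∈ φ.source) (z : Fin p ⊕ Fin q → ℝ) : (ofCoord 𝓕 φ m z).coord φ = z := by
  rw [coord_ofCoord hφ hφ hm hm]
  have h : ∀ k, chartJacobian φ φ m (EuclideanSpace.single k 1) = EuclideanSpace.single k 1 :=
    fun k => (mfderiv_coordVec hφ.1 hφ.1 hm hm k).symm.trans (mfderiv_coordVec_self hφ.1 hm k)
  simp only [h]
  ext (i | j) <;> simp

theorem ofCoord_coord (hφ : IsFoliationChart 𝓕.H φ) {x : HNDual 𝓕} (hx : x.base ∈ φ.source) :
    ofCoord 𝓕 φ x.base (x.coord φ) = x :=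
  ext_of_coord hφ hx rfl (coord_ofCoord_self hφ hx _)

theorem continuousOn_ofCoord (hφ : IsFoliationChart 𝓕.H φ) :
    ContinuousOn (fun w : M × (Fin p ⊕ Fin q → ℝ) => ofCoord 𝓕 φ w.1 w.2) (φ.source ×ˢ univ) := by
  rw [continuousOn_iff_continuous_domRestrict]
  refine continuous_inf_rng.2 ⟨continuous_induced_rng.2 ?_, continuous_generateFrom_iff.2 ?_⟩
  · exact (continuous_fst (X := M) (Y := Fin p ⊕ Fin q → ℝ)).comp continuous_subtype_val
  rintro _ ⟨ψ, V, hψ, hV, rfl⟩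
  have h1 : ∀ k : Fin p ⊕ Fin q, ContinuousOn
      (fun w : M × (Fin p ⊕ Fin q → ℝ) => chartJacobian φ ψ w.1 (EuclideanSpace.single k 1))
      ((φ.source ∩ ψ.source) ×ˢ univ) := fun k =>
    (((continuousOn_chartJacobian hφ.1 hψ.1).comp continuousOn_fst fun w hw => hw.1).clm_apply
      continuousOn_const)
  have h2 : ∀ k l : Fin p ⊕ Fin q, ContinuousOn
      (fun w : M × (Fin p ⊕ Fin q → ℝ) => chartJacobian φ ψ w.1 (EuclideanSpace.single k 1) l)
      ((φ.source ∩ ψ.source) ×ˢ univ) := fun k l =>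
    (EuclideanSpace.proj l : FolModel p q →L[ℝ] ℝ).continuous.comp_continuousOn (h1 k)
  have h3 : ContinuousOn (fun w : M × (Fin p ⊕ Fin q → ℝ) => (ofCoord 𝓕 φ w.1 w.2).coord ψ)
      ((φ.source ∩ ψ.source) ×ˢ univ) := by
    refine ContinuousOn.congr (f := fun w : M × (Fin p ⊕ Fin q → ℝ) => Sum.elim
      (fun i => ∑ k, w.2 k * chartJacobian φ ψ w.1 (EuclideanSpace.single (.inl i) 1) k)
      (fun j => ∑ k, (Sum.elim 0 (w.2 ∘ Sum.inr) : Fin p ⊕ Fin q → ℝ) k *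
        chartJacobian φ ψ w.1 (EuclideanSpace.single (.inr j) 1) k)) ?_
      fun w hw => coord_ofCoord hφ hψ hw.1.1 hw.1.2 w.2
    refine continuousOn_pi.2 ?_
    rintro (i | j)
    · refine continuousOn_finsetSum _ fun k _ => ContinuousOn.mul ?_ (h2 _ k)
      fun_prop
    · refine continuousOn_finsetSum _ fun k _ => ContinuousOn.mul ?_ (h2 _ k)
      rcases k with k | k
      · exact continuousOn_const
      · exact Continuous.continuousOn (by simp only [Sum.elim_inr, Function.comp]; fun_prop)
  have h4 := h3.isOpen_inter_preimage ((φ.open_source.inter ψ.open_source).prod isOpen_univ) hV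
  refine isOpen_induced_iff.2 ⟨_, h4, ?_⟩
  ext ⟨w, hw⟩
  simp only [mem_preimage, mem_inter_iff, mem_prod, mem_univ, and_true, mem_ofPred_eq]
  exact ⟨fun h => ⟨h.1.2, h.2⟩, fun h => ⟨⟨hw.1, h.1⟩, h.2⟩⟩

theorem isCompact_coord_le (hφ : IsFoliationChart 𝓕.H φ) {C : Set M} (hC : IsCompact C)
    (hCφ : C ⊆ φ.source) (R : ℝ) :
    IsCompact {x : HNDual 𝓕 | x.base ∈ C ∧ ‖x.coord φ‖ ≤ R} := by
  have h1 : IsCompact (C ×ˢ Metric.closedBall (0 : Fin p ⊕ Fin q → ℝ) R) :=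
    hC.prod (isCompact_closedBall _ _)
  have h2 := h1.image_of_continuousOn ((continuousOn_ofCoord hφ).mono
    fun w hw => ⟨hCφ hw.1, mem_univ _⟩)
  convert h2 using 1
  ext x
  constructor
  · rintro ⟨hx, hR⟩
    exact ⟨(x.base, x.coord φ), ⟨hx, by simpa using hR⟩, ofCoord_coord hφ (hCφ hx)⟩
  · rintro ⟨w, hw, rfl⟩
    refine ⟨hw.1, ?_⟩
    rw [coord_ofCoord_self hφ (hCφ hw.1)]
    simpa using hw.2

end HNDual

section WeightedDilation

variable {p q : ℕ}

/-- The weighted dilation `(ξ, η) ↦ (t ξ, t² η)`. -/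
def weightedDilation (t : ℝ) (z : Fin p ⊕ Fin q → ℝ) : Fin p ⊕ Fin q → ℝ :=
  Sum.elim (t • (z ∘ Sum.inl)) (t ^ 2 • (z ∘ Sum.inr))

/-- The norm `max (|ξ|, |η|^(1/2))` which is homogeneous for the weighted dilations. -/
noncomputable def weightedNorm (z : Fin p ⊕ Fin q → ℝ) : ℝ :=
  max ‖z ∘ Sum.inl‖ (Real.sqrt ‖z ∘ Sum.inr‖)

theorem continuous_weightedNorm : Continuous (weightedNorm : (Fin p ⊕ Fin q → ℝ) → ℝ) := by
  have h1 : Continuous fun z : Fin p ⊕ Fin q → ℝ => z ∘ Sum.inl := by fun_prop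
  have h2 : Continuous fun z : Fin p ⊕ Fin q → ℝ => z ∘ Sum.inr := by fun_prop
  exact h1.norm.max h2.norm.sqrt

theorem weightedNorm_weightedDilation {t : ℝ} (ht : 0 ≤ t) (z : Fin p ⊕ Fin q → ℝ) :
    weightedNorm (weightedDilation t z) = t * weightedNorm z := by
  have h1 : weightedDilation t z ∘ Sum.inl = t • (z ∘ Sum.inl) := rfl
  have h2 : weightedDilation t z ∘ Sum.inr = t ^ 2 • (z ∘ Sum.inr) := rfl
  rw [weightedNorm, weightedNorm, h1, h2, norm_smul, norm_smul, Real.norm_of_nonneg ht,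
    Real.norm_of_nonneg (sq_nonneg t), Real.sqrt_mul (sq_nonneg t), Real.sqrt_sq ht,
    mul_max_of_nonneg _ _ ht]

theorem norm_le_of_weightedNorm_le {R : ℝ} (hR : 1 ≤ R) {z : Fin p ⊕ Fin q → ℝ}
    (h : weightedNorm z ≤ R) : ‖z‖ ≤ R ^ 2 := by
  refine (pi_norm_le_iff_of_nonneg (by positivity)).2 ?_
  rintro (i | j)
  · have h1 := (norm_le_pi_norm (z ∘ Sum.inl) i).trans ((le_max_left _ _).trans h)
    exact h1.trans (by nlinarith)
  · refine (norm_le_pi_norm (z ∘ Sum.inr) j).trans ?_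
    exact (Real.sqrt_le_left (by linarith)).1 ((le_max_right _ _).trans h)

theorem weightedDilation_weightedDilation_inv {t : ℝ} (ht : t ≠ 0) (z : Fin p ⊕ Fin q → ℝ) :
    weightedDilation t (weightedDilation t⁻¹ z) = z := by
  ext (i | j)
  · simp [weightedDilation, ht]
  · simp [weightedDilation, ht]

variable {V W : Type*} [NormedAddCommGroup V] [NormedSpace ℂ V] [NormedAddCommGroup W]
  [NormedSpace ℂ W]

/-- The weighted homogeneous polynomial `∑_{‖α‖ = d} a_α (iz)^α`. -/
noncomputable def symbolPoly (d : ℕ) (a : (Fin p ⊕ Fin q → ℕ) → V →L[ℂ] W)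
    (z : Fin p ⊕ Fin q → ℝ) : V →L[ℂ] W :=
  ∑ α ∈ multiIndices p q d with weight α = d, (∏ k, (Complex.I * (z k : ℂ)) ^ α k) • a α

theorem symbolPoly_weightedDilation (d : ℕ) (a : (Fin p ⊕ Fin q → ℕ) → V →L[ℂ] W) (t : ℝ)
    (z : Fin p ⊕ Fin q → ℝ) :
    symbolPoly d a (weightedDilation t z) = (t : ℂ) ^ d • symbolPoly d a z := by
  rw [symbolPoly, symbolPoly, Finset.smul_sum]
  refine Finset.sum_congr rfl fun α hα => ?_
  rw [smul_smul]
  congr 1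
  have h : (t : ℂ) ^ d = (∏ i, (t : ℂ) ^ α (.inl i)) * ∏ j, ((t : ℂ) ^ 2) ^ α (.inr j) := by
    rw [Finset.prod_pow_eq_pow_sum, Finset.prod_pow_eq_pow_sum, ← pow_mul, ← pow_add,
      ← (Finset.mem_filter.1 hα).2]
    rfl
  rw [h, Fintype.prod_sum_type, Fintype.prod_sum_type, mul_mul_mul_comm, ← Finset.prod_mul_distrib,
    ← Finset.prod_mul_distrib]
  congr 1
  · refine Finset.prod_congr rfl fun i _ => ?_
    simp only [weightedDilation, Sum.elim_inl, Pi.smul_apply, Function.comp_apply, smul_eq_mul,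
      Complex.ofReal_mul]
    ring
  · refine Finset.prod_congr rfl fun i _ => ?_
    simp only [weightedDilation, Sum.elim_inr, Pi.smul_apply, Function.comp_apply, smul_eq_mul,
      Complex.ofReal_mul, Complex.ofReal_pow]
    rw [← mul_pow]
    ring

theorem continuousOn_symbolPoly {Z : Type*} [TopologicalSpace Z] {s : Set Z} (d : ℕ)
    {a : (Fin p ⊕ Fin q → ℕ) → Z → V →L[ℂ] W} {c : Z → Fin p ⊕ Fin q → ℝ}
    (ha : ∀ α, ContinuousOn (a α) s) (hc : ContinuousOn c s) :
    ContinuousOn (fun y => symbolPoly d (fun α => a α y) (c y)) s := by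
  refine continuousOn_finsetSum _ fun α _ => ContinuousOn.smul
    (f := fun y => ∏ k, (Complex.I * (c y k : ℂ)) ^ α k) (g := fun y => a α y) ?_ (ha α)
  refine continuousOn_finsetProd _ fun k _ => ContinuousOn.pow (continuousOn_const.mul ?_) _
  exact Complex.continuous_ofReal.comp_continuousOn ((continuous_apply k).comp_continuousOn hc)

end WeightedDilation

section Symbol

variable {p q : ℕ} {M : Type u} [TopologicalSpace M] [ChartedSpace (FolModel p q) M]
  {𝓕 : Foliation p q M}
  {V : Type*} [NormedAddCommGroup V] [NormedSpace ℂ V] [FiniteDimensional ℂ V]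
  {W : Type*} [NormedAddCommGroup W] [NormedSpace ℂ W] [FiniteDimensional ℂ W]
  {E : M → Type v} [TopologicalSpace (TotalSpace V E)] [∀ m, NormedAddCommGroup (E m)]
  [∀ m, InnerProductSpace ℂ (E m)] [FiberBundle V E]
  [VectorBundle ℂ V E]
  {F : M → Type v} [TopologicalSpace (TotalSpace W F)] [∀ m, NormedAddCommGroup (F m)]
  [∀ m, InnerProductSpace ℂ (F m)] [FiberBundle W F]
  [VectorBundle ℂ W F]

theorem HNDual.isInducing_pullback (𝓕 : Foliation p q M) :
    Topology.IsInducing (fun e : (HNDual.pullback 𝓕 V E).Total =>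
      (e.proj, (⟨e.proj.base, e.snd⟩ : TotalSpace V E))) := by
  have h1 : Topology.IsInducing (fun e : (HNDual.pullback 𝓕 V E).Total =>
      (e.proj, (⟨e.proj.base, e.snd⟩ : (CBundle.ofBundle V E).Total))) := ⟨rfl⟩
  have h2 : Topology.IsInducing (fun e : (CBundle.ofBundle V E).Total =>
      (⟨e.proj, e.snd⟩ : TotalSpace V E)) := ⟨rfl⟩
  exact (Topology.IsInducing.id.prodMap h2).comp h1

/-- Near every point, a weighted principal symbol is given by a weighted homogeneous polynomial with
continuous coefficients. -/
theorem IsWeightedPrincipalSymbol.exists_symbolPoly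
    {P : Cₛ^∞⟮𝓘(ℝ, FolModel p q); V, E⟯ → Cₛ^∞⟮𝓘(ℝ, FolModel p q); W, F⟯} {d : ℕ}
    {σ : ∀ x : HNDual 𝓕, E x.base →ₗ[ℂ] F x.base} (hσ : IsWeightedPrincipalSymbol 𝓕 P d σ) (m : M) :
    ∃ (φ : OpenPartialHomeomorph M (FolModel p q)) (e : Trivialization V (π V E))
      (e' : Trivialization W (π W F)) (_ : e.IsLinear ℂ) (_ : e'.IsLinear ℂ)
      (a : (Fin p ⊕ Fin q → ℕ) → M → V →L[ℂ] W),
      IsFoliationChart 𝓕.H φ ∧ m ∈ φ.source ∩ e.baseSet ∩ e'.baseSet ∧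
      (∀ α, ContinuousOn (a α) (φ.source ∩ e.baseSet ∩ e'.baseSet)) ∧
      ∀ x : HNDual 𝓕, x.base ∈ φ.source ∩ e.baseSet ∩ e'.baseSet → ∀ v : E x.base,
        σ x v = e'.symmₗ ℂ x.base
          (symbolPoly d (fun α => a α x.base) (x.coord φ) (e ⟨x.base, v⟩).2) := by
  obtain ⟨φ, e, e', a, hφ, he, he', hm, hP, hx⟩ := hσ m
  have : MemTrivializationAtlas e := ⟨he⟩
  have : MemTrivializationAtlas e' := ⟨he'⟩
  refine ⟨φ, e, e', inferInstance, inferInstance, a, hφ, hm, fun α => (hP.1 α).continuousOn,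
    fun x hxb v => ?_⟩
  have h : symbolPoly d (fun α => a α x.base) (x.coord φ) (e ⟨x.base, v⟩).2 =
      (e' ⟨x.base, σ x v⟩).2 := by
    rw [hx x hxb v, symbolPoly, sum_apply]
    rfl
  rw [h, e'.symmₗ_apply hxb.2, e'.symm_apply_apply_mk hxb.2]

theorem Bundle.Trivialization.continuousOn_snd_apply (e : Trivialization V (π V E)) :
    ContinuousOn (fun z : TotalSpace V E => (e z).2) (TotalSpace.proj ⁻¹' e.baseSet) := by
  rw [← e.source_eq]
  exact continuous_snd.comp_continuousOn e.continuousOn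

theorem IsWeightedPrincipalSymbol.continuous
    {P : Cₛ^∞⟮𝓘(ℝ, FolModel p q); V, E⟯ → Cₛ^∞⟮𝓘(ℝ, FolModel p q); W, F⟯} {d : ℕ}
    {σ : ∀ x : HNDual 𝓕, E x.base →ₗ[ℂ] F x.base} (hσ : IsWeightedPrincipalSymbol 𝓕 P d σ) :
    Continuous (fun e : (HNDual.pullback 𝓕 V E).Total =>
      (⟨e.proj, σ e.proj e.snd⟩ : (HNDual.pullback 𝓕 W F).Total)) := by
  have hE := (HNDual.isInducing_pullback (V := V) (E := E) 𝓕).continuous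
  have hp : Continuous fun e : (HNDual.pullback 𝓕 V E).Total => e.proj := continuous_fst.comp hE
  have hb : Continuous fun e : (HNDual.pullback 𝓕 V E).Total => e.proj.base :=
    (HNDual.proj 𝓕).continuous.comp hp
  rw [(HNDual.isInducing_pullback (V := W) (E := F) 𝓕).continuous_iff]
  refine hp.prodMk (continuous_iff_continuousAt.2 fun z => ?_)
  obtain ⟨φ, e, e', _, _, a, hφ, hm, ha, hs⟩ := hσ.exists_symbolPoly z.proj.base
  have hU := ((φ.open_source.inter e.open_baseSet).inter e'.open_baseSet).preimage hb
  refine ContinuousOn.continuousAt ?_ (hU.mem_nhds hm)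
  have h1 := continuousOn_symbolPoly d (s := (fun e : (HNDual.pullback 𝓕 V E).Total =>
    e.proj.base) ⁻¹' (φ.source ∩ e.baseSet ∩ e'.baseSet)) (a := fun α e => a α e.proj.base)
    (c := fun e => e.proj.coord φ) (fun α => (ha α).comp hb.continuousOn fun e he => he)
    ((HNDual.continuousOn_coord hφ).comp hp.continuousOn fun e he => he.1.1)
  have h2 := h1.clm_apply (e.continuousOn_snd_apply.comp (continuous_snd.comp hE).continuousOn
    fun e he => he.1.2)
  exact (e'.continuousOn_mk_symmₗ.comp (hb.continuousOn.prodMk h2) fun e he =>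
    ⟨he.2, mem_univ _⟩).congr fun z hz => congrArg (TotalSpace.mk' W z.proj.base) (hs z.proj hz z.snd)

/-- A continuous family of injective symbols, parametrized by compact sets, is uniformly bounded
below. -/
theorem exists_norm_le_symbolPoly (hE : Continuous fun z : TotalSpace V E => ‖z.snd‖)
    (hF : Continuous fun z : TotalSpace W F => ‖z.snd‖) (e : Trivialization V (π V E))
    (e' : Trivialization W (π W F)) [e.IsLinear ℂ] [e'.IsLinear ℂ] (d : ℕ)
    {a : (Fin p ⊕ Fin q → ℕ) → M → V →L[ℂ] W} {C : Set M} (hC : IsCompact C)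
    (hCe : C ⊆ e.baseSet) (hCe' : C ⊆ e'.baseSet) (ha : ∀ α, ContinuousOn (a α) C)
    {Q : Set (Fin p ⊕ Fin q → ℝ)} (hQ : IsCompact Q)
    (hpos : ∀ m ∈ C, ∀ z ∈ Q, ∀ v, v ≠ 0 →
      e'.symmₗ ℂ m (symbolPoly d (fun α => a α m) z v) ≠ 0) :
    ∃ A : ℝ, 0 ≤ A ∧ ∀ m ∈ C, ∀ z ∈ Q, ∀ v : V,
      ‖e.symmₗ ℂ m v‖ ≤ A * ‖e'.symmₗ ℂ m (symbolPoly d (fun α => a α m) z v)‖ := by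
  have hS : IsCompact (Metric.sphere (0 : V) 1) := by
    have : ProperSpace V := FiniteDimensional.proper ℂ V
    exact isCompact_sphere _ _
  let f : M × (Fin p ⊕ Fin q → ℝ) × V → ℝ := fun w =>
    ‖e'.symmₗ ℂ w.1 (symbolPoly d (fun α => a α w.1) w.2.1 w.2.2)‖
  have hf : ContinuousOn f (C ×ˢ Q ×ˢ Metric.sphere (0 : V) 1) := by
    have h1 : ContinuousOn (fun w : M × (Fin p ⊕ Fin q → ℝ) × V =>
        symbolPoly d (fun α => a α w.1) w.2.1) (C ×ˢ Q ×ˢ Metric.sphere (0 : V) 1) :=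
      continuousOn_symbolPoly d (a := fun α (w : M × (Fin p ⊕ Fin q → ℝ) × V) => a α w.1)
        (fun α => (ha α).comp continuousOn_fst fun w hw => hw.1)
        (continuous_fst.comp continuous_snd).continuousOn
    have h2 := h1.clm_apply (continuous_snd.comp continuous_snd).continuousOn
    exact (continuousOn_norm_symmₗ e' hF).comp (continuousOn_fst.prodMk h2)
      fun w hw => ⟨hCe' hw.1, mem_univ _⟩
  obtain ⟨c, hc0, hc⟩ := (hC.prod (hQ.prod hS)).exists_forall_le' hf (a := 0) fun w hw => by
    refine norm_pos_iff.2 (hpos _ hw.1 _ hw.2.1 _ fun h => ?_)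
    have h1 := hw.2.2
    rw [h] at h1
    simp at h1
  obtain ⟨B, hB⟩ := (hC.prod hS).exists_bound_of_continuousOn (f := fun w : M × V =>
    ‖e.symmₗ ℂ w.1 w.2‖) ((continuousOn_norm_symmₗ e hE).mono
      fun w hw => ⟨hCe hw.1, mem_univ _⟩)
  refine ⟨max B 0 / c, by positivity, fun m hm z hz v => ?_⟩
  rcases eq_or_ne v 0 with rfl | hv
  · simp
  have hv' : ‖v‖ ≠ 0 := norm_ne_zero_iff.2 hv
  have key : ∀ w ∈ Metric.sphere (0 : V) 1, ‖e.symmₗ ℂ m w‖ ≤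
      max B 0 / c * ‖e'.symmₗ ℂ m (symbolPoly d (fun α => a α m) z w)‖ := by
    intro w hw
    have h1 : c ≤ ‖e'.symmₗ ℂ m (symbolPoly d (fun α => a α m) z w)‖ :=
      hc (m, z, w) ⟨hm, hz, hw⟩
    have h2 := hB (m, w) ⟨hm, hw⟩
    rw [norm_norm] at h2
    rw [div_mul_eq_mul_div, le_div_iff₀ hc0]
    exact mul_le_mul (h2.trans (le_max_left _ _)) h1 hc0.le (le_max_right _ _)
  have h1 := key (((‖v‖⁻¹ : ℝ) : ℂ) • v) (by
    rw [mem_sphere_zero_iff_norm, norm_smul, Complex.norm_real, norm_inv, norm_norm,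
      inv_mul_cancel₀ hv'])
  rw [map_smul, map_smul, map_smul, norm_smul, norm_smul, mul_left_comm] at h1
  refine le_of_mul_le_mul_left h1 ?_
  rw [Complex.norm_real, norm_inv, norm_norm]
  positivity

variable [IsManifold 𝓘(ℝ, FolModel p q) ∞ M]

theorem IsWeightedPrincipalSymbol.exists_nhds_norm_le [CompactSpace M] [T2Space M]
    (hE : Continuous fun z : TotalSpace V E => ‖z.snd‖)
    (hF : Continuous fun z : TotalSpace W F => ‖z.snd‖)
    {P : Cₛ^∞⟮𝓘(ℝ, FolModel p q); V, E⟯ → Cₛ^∞⟮𝓘(ℝ, FolModel p q); W, F⟯} {d : ℕ} (hd : 0 < d)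
    {σ : ∀ x : HNDual 𝓕, E x.base →ₗ[ℂ] F x.base} (hσ : IsWeightedPrincipalSymbol 𝓕 P d σ)
    (hinv : ∀ x : HNDual 𝓕, ¬ (x.ξ = 0 ∧ x.η = 0) → Function.Bijective (σ x)) (m : M) {ε : ℝ}
    (hε : 0 < ε) :
    ∃ C ∈ 𝓝 m, ∃ K : Set (HNDual 𝓕), IsCompact K ∧ ∀ x ∉ K, x.base ∈ C →
      ¬ (x.ξ = 0 ∧ x.η = 0) ∧ ∀ v, ‖v‖ ≤ ε * ‖σ x v‖ := by
  obtain ⟨φ, e, e', _, _, a, hφ, hm, ha, hs⟩ := hσ.exists_symbolPoly m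
  obtain ⟨C, hC, hCU, hCc⟩ := local_compact_nhds
    (((φ.open_source.inter e.open_baseSet).inter e'.open_baseSet).mem_nhds hm)
  obtain ⟨Q, hQ, hQ0, hQm⟩ : ∃ Q : Set (Fin p ⊕ Fin q → ℝ), IsCompact Q ∧ (∀ z ∈ Q, z ≠ 0) ∧
      ∀ z, weightedNorm z = 1 → z ∈ Q := by
    refine ⟨{z | weightedNorm z = 1} ∩ Metric.closedBall 0 1, (isCompact_closedBall _ _).inter_left
      (isClosed_eq continuous_weightedNorm continuous_const), ?_, fun z hz => ⟨hz, ?_⟩⟩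
    · rintro z ⟨hz, -⟩ rfl
      have h1 : weightedNorm (0 : Fin p ⊕ Fin q → ℝ) = 0 := by
        rw [weightedNorm]
        change max ‖(0 : Fin p → ℝ)‖ (Real.sqrt ‖(0 : Fin q → ℝ)‖) = 0
        simp
      exact zero_ne_one (h1.symm.trans hz)
    · rw [mem_closedBall_zero_iff]
      simpa using norm_le_of_weightedNorm_le le_rfl hz.le
  obtain ⟨A, hA0, hA⟩ := exists_norm_le_symbolPoly hE hF e e' d hCc (fun m hm => (hCU hm).1.2)
    (fun m hm => (hCU hm).2) (fun α => (ha α).mono hCU) hQ fun m hm z hz v hv hv0 => by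
      have hU := hCU hm
      have h1 := HNDual.coord_ofCoord_self hφ hU.1.1 z
      have h2 := hs (HNDual.ofCoord 𝓕 φ m z) hU (e.symmₗ ℂ m v)
      have h3 : (e ⟨m, e.symmₗ ℂ m v⟩).2 = v := by
        rw [e.symmₗ_apply hU.1.2, e.apply_mk_symm hU.1.2]
      rw [h1] at h2
      have h4 : σ (HNDual.ofCoord 𝓕 φ m z) (e.symmₗ ℂ m v) = 0 :=
        (h2.trans (congrArg (fun t => e'.symmₗ ℂ m (symbolPoly d (fun α => a α m) z t)) h3)).trans
          hv0
      have h5 := hinv (HNDual.ofCoord 𝓕 φ m z) fun h =>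
        hQ0 _ hz (h1.symm.trans (HNDual.coord_eq_zero h.1 h.2))
      have h6 : e.symmₗ ℂ m v = 0 := (injective_iff_map_eq_zero _).1 h5.1 _ h4
      rw [← e.linearMapAt_symmₗ (R := ℂ) hU.1.2 v, h6, map_zero] at hv
      exact hv rfl
  obtain ⟨R, hR1, hR⟩ : ∃ R : ℝ, 1 ≤ R ∧ A ≤ ε * R := by
    refine ⟨max 1 (A / ε), le_max_left _ _, ?_⟩
    rw [← div_le_iff₀' hε]
    exact le_max_right _ _
  refine ⟨C, hC, _, HNDual.isCompact_coord_le hφ hCc (fun m hm => (hCU hm).1.1) (R ^ 2),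
    fun x hx hxC => ?_⟩
  have hxR : R < weightedNorm (x.coord φ) := by
    by_contra! h
    exact hx ⟨hxC, norm_le_of_weightedNorm_le hR1 h⟩
  refine ⟨fun h => ?_, fun v => ?_⟩
  · refine hx ⟨hxC, ?_⟩
    rw [HNDual.coord_eq_zero h.1 h.2, norm_zero]
    positivity
  set t := weightedNorm (x.coord φ) with ht
  have ht0 : 0 < t := by linarith
  set z := weightedDilation t⁻¹ (x.coord φ) with hz
  have hzQ : z ∈ Q := hQm z (by
    rw [hz, weightedNorm_weightedDilation (by positivity), ← ht, inv_mul_cancel₀ ht0.ne'])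
  have h1 := hA x.base hxC z hzQ (e ⟨x.base, v⟩).2
  have h2 : e.symmₗ ℂ x.base (e ⟨x.base, v⟩).2 = v := by
    rw [e.symmₗ_apply (hCU hxC).1.2, e.symm_apply_apply_mk (hCU hxC).1.2]
  have h3 : ‖σ x v‖ = t ^ d *
      ‖e'.symmₗ ℂ x.base (symbolPoly d (fun α => a α x.base) z (e ⟨x.base, v⟩).2)‖ := by
    rw [hs x (hCU hxC) v, ← weightedDilation_weightedDilation_inv ht0.ne' (x.coord φ),
      symbolPoly_weightedDilation, smul_apply, map_smul, norm_smul, norm_pow,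
      Complex.norm_real, Real.norm_of_nonneg ht0.le]
  rw [h2] at h1
  rw [h3]
  have hs0 := norm_nonneg
    (e'.symmₗ ℂ x.base (symbolPoly d (fun α => a α x.base) z (e ⟨x.base, v⟩).2))
  generalize ‖e'.symmₗ ℂ x.base (symbolPoly d (fun α => a α x.base) z (e ⟨x.base, v⟩).2)‖ = s
    at h1 hs0 ⊢
  have h4 : R ≤ t ^ d := hxR.le.trans (le_self_pow₀ (by linarith) hd.ne')
  calc ‖v‖ ≤ A * s := h1
    _ ≤ ε * R * s := mul_le_mul_of_nonneg_right hR hs0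
    _ ≤ ε * t ^ d * s := by gcongr
    _ = _ := by ring

theorem IsWeightedPrincipalSymbol.exists_compact_norm_le [CompactSpace M] [T2Space M]
    (hE : Continuous fun z : TotalSpace V E => ‖z.snd‖)
    (hF : Continuous fun z : TotalSpace W F => ‖z.snd‖)
    {P : Cₛ^∞⟮𝓘(ℝ, FolModel p q); V, E⟯ → Cₛ^∞⟮𝓘(ℝ, FolModel p q); W, F⟯} {d : ℕ} (hd : 0 < d)
    {σ : ∀ x : HNDual 𝓕, E x.base →ₗ[ℂ] F x.base} (hσ : IsWeightedPrincipalSymbol 𝓕 P d σ)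
    (hinv : ∀ x : HNDual 𝓕, ¬ (x.ξ = 0 ∧ x.η = 0) → Function.Bijective (σ x)) {ε : ℝ}
    (hε : 0 < ε) :
    ∃ K : Set (HNDual 𝓕), IsCompact K ∧ ∀ x ∉ K,
      Function.Bijective (σ x) ∧ ∀ v, ‖v‖ ≤ ε * ‖σ x v‖ := by
  choose C hC K hK h using fun m => hσ.exists_nhds_norm_le hE hF hd hinv m hε
  obtain ⟨t, -, ht⟩ := isCompact_univ.elim_nhds_subcover C fun m _ => hC m
  refine ⟨⋃ m ∈ t, K m, t.isCompact_biUnion fun m _ => hK m, fun x hx => ?_⟩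
  obtain ⟨m, hm, hxm⟩ := mem_iUnion₂.1 (ht (mem_univ x.base))
  have h1 := h m x (fun h2 => hx (mem_iUnion₂.2 ⟨m, hm, h2⟩)) hxm
  exact ⟨hinv x h1.1, h1.2⟩

end Symbol

section UnitizationMatrix

variable {X : Type u} [TopologicalSpace X]

theorem unitization_ext {f g : Unitization ℂ C₀(X, ℂ)}
    (hs : scalarPart C₀(X, ℂ) f = scalarPart C₀(X, ℂ) g) (he : ∀ x, evalAt x f = evalAt x g) :
    f = g := by
  have hs' : f.fst = g.fst := hs
  refine Unitization.ext hs' (ZeroAtInftyContinuousMap.ext fun x => ?_)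
  have h := he x
  rw [evalAt_apply, evalAt_apply, hs'] at h
  exact add_left_cancel h

theorem blockOne_map (a b : ℕ) {B C : Type*} [Ring B] [Ring C] (f : B →+* C) :
    (blockOne a b B).map f = blockOne a b C := by
  rw [blockOne, blockOne, Matrix.fromBlocks_map]
  simp

/-- A family of matrices of the form `(0 0; 0 1) + A(x)`, with `A` continuous and vanishing at
infinity, whose values are projections, is a projection over the unitization of `C₀(X)`. -/
theorem exists_isStarProjection_unitization {a b : ℕ}
    (A : X → Matrix (Fin a ⊕ Fin b) (Fin a ⊕ Fin b) ℂ) (hA : ∀ k l, Continuous fun x => A x k l)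
    (hA0 : ∀ k l, Tendsto (fun x => A x k l) (cocompact X) (𝓝 0))
    (hp : ∀ x, IsStarProjection (blockOne a b ℂ + A x)) :
    ∃ e : Matrix (Fin a ⊕ Fin b) (Fin a ⊕ Fin b) (Unitization ℂ C₀(X, ℂ)), IsStarProjection e ∧
      e.map (scalarPart C₀(X, ℂ)) = blockOne a b ℂ ∧
      ∀ x, e.map (evalAt x) = blockOne a b ℂ + A x := by
  let g : Fin a ⊕ Fin b → Fin a ⊕ Fin b → C₀(X, ℂ) := fun k l =>
    ⟨⟨fun x => A x k l, hA k l⟩, hA0 k l⟩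
  let e : Matrix (Fin a ⊕ Fin b) (Fin a ⊕ Fin b) (Unitization ℂ C₀(X, ℂ)) :=
    blockOne a b _ + Matrix.of fun k l => Unitization.inr (g k l)
  have hs : e.map (scalarPart C₀(X, ℂ)) = blockOne a b ℂ := by
    rw [← blockOne_map a b (scalarPart C₀(X, ℂ) : Unitization ℂ C₀(X, ℂ) →+* ℂ)]
    ext k l
    have h : scalarPart C₀(X, ℂ) (Unitization.inr (g k l)) = 0 := rfl
    simp [e, h]
  have hx : ∀ x, e.map (evalAt x) = blockOne a b ℂ + A x := by
    intro x
    rw [← blockOne_map a b (evalAt x : Unitization ℂ C₀(X, ℂ) →+* ℂ)]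
    ext k l
    have h : evalAt x (Unitization.inr (g k l)) = A x k l := by
      rw [evalAt_apply, Unitization.fst_inr, Unitization.snd_inr, zero_add]
      rfl
    simp [e, h]
  have hproj : ∀ f : Unitization ℂ C₀(X, ℂ) →⋆ₐ[ℂ] ℂ, IsStarProjection (e.map f) →
      (e * e).map f = e.map f ∧ eᴴ.map f = e.map f := by
    intro f hf
    rw [Matrix.map_mul, Matrix.conjTranspose_map f (fun b => map_star f b)]
    exact ⟨hf.isIdempotentElem, hf.isSelfAdjoint⟩
  have h1 := hproj (scalarPart C₀(X, ℂ)) (hs ▸ isStarProjection_blockOne a b ℂ)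
  have h2 := fun x => hproj (evalAt x) (hx x ▸ hp x)
  refine ⟨e, ⟨?_, ?_⟩, hs, hx⟩
  · exact Matrix.ext fun k l => unitization_ext (congrFun₂ h1.1 k l) fun x =>
      congrFun₂ (h2 x).1 k l
  · exact Matrix.ext fun k l => unitization_ext (congrFun₂ h1.2 k l) fun x =>
      congrFun₂ (h2 x).2 k l

theorem K0.toKTop_diff {a b : ℕ}
    (e : Matrix (Fin a ⊕ Fin b) (Fin a ⊕ Fin b) (Unitization ℂ C₀(X, ℂ))) (he : IsStarProjection e)
    (hs : e.map (scalarPart C₀(X, ℂ)) =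
      (blockOne a b (Unitization ℂ C₀(X, ℂ))).map (scalarPart C₀(X, ℂ))) :
    K0.toKTop X (K0.diff finSumFinEquiv e (blockOne a b _) he (isStarProjection_blockOne a b _) hs) =
      (KTop.mk (MatProj.ofMatrix finSumFinEquiv e he).triple : KTop.{u, v} X) := by
  have h : ∀ p : MatProj (Unitization ℂ C₀(X, ℂ)),
      K00.lift (fun p => (KTop.mk p.triple : KTop.{u, v} X)) MatProj.mk_triple_sum
        (fun _ _ h => MatProj.mk_triple_eq h) (K00.mk p) = KTop.mk p.triple := fun p =>
    FreeAbelianGroup.lift_apply_of _ _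
  change K00.lift (fun p => (KTop.mk p.triple : KTop.{u, v} X)) MatProj.mk_triple_sum
    (fun _ _ h => MatProj.mk_triple_eq h) (K00.mk (MatProj.ofMatrix finSumFinEquiv e he) -
      K00.mk (MatProj.ofMatrix finSumFinEquiv (blockOne a b _)
        (isStarProjection_blockOne a b _))) = _
  rw [map_sub, h, h, sub_eq_self]
  apply MatProj.mk_triple_eq_zero
  intro x
  have h1 : ∀ f : Unitization ℂ C₀(X, ℂ) →⋆ₐ[ℂ] ℂ, (blockOne a b _).map f = blockOne a b ℂ :=
    fun f => blockOne_map a b (f : Unitization ℂ C₀(X, ℂ) →+* ℂ)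
  change ((blockOne a b _).map (evalAt x)).submatrix _ _ =
    ((blockOne a b _).map (scalarPart C₀(X, ℂ))).submatrix _ _
  rw [h1, h1]

end UnitizationMatrix

section GraphClass

variable {p q : ℕ} {M : Type u} [TopologicalSpace M] [ChartedSpace (FolModel p q) M]
  {𝓕 : Foliation p q M}
  {V : Type*} [NormedAddCommGroup V] [NormedSpace ℂ V] [FiniteDimensional ℂ V]
  {W : Type*} [NormedAddCommGroup W] [NormedSpace ℂ W] [FiniteDimensional ℂ W]
  {E : M → Type v} [TopologicalSpace (TotalSpace V E)] [∀ m, NormedAddCommGroup (E m)]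
  [∀ m, InnerProductSpace ℂ (E m)] [∀ m, FiniteDimensional ℂ (E m)] [FiberBundle V E]
  [VectorBundle ℂ V E]
  {F : M → Type v} [TopologicalSpace (TotalSpace W F)] [∀ m, NormedAddCommGroup (F m)]
  [∀ m, InnerProductSpace ℂ (F m)] [∀ m, FiniteDimensional ℂ (F m)] [FiberBundle W F]
  [VectorBundle ℂ W F]
  {a b : ℕ} (i : HermitianEmbedding V E a) (j : HermitianEmbedding W F b)

theorem HermitianEmbedding.continuous_toPi : Continuous fun e : (HNDual.pullback 𝓕 V E).Total =>
    i.toPi e.proj.base e.snd :=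
  (PiLp.continuous_ofLp 2 _).comp (i.continuous_toFun.comp
    (continuous_snd.comp (HNDual.isInducing_pullback (V := V) (E := E) 𝓕).continuous))

theorem HermitianEmbedding.continuous_adj : Continuous fun z : HNDual 𝓕 × (Fin a → ℂ) =>
    (⟨z.1, i.adj z.1.base z.2⟩ : (HNDual.pullback 𝓕 V E).Total) :=
  CBundle.continuous_leftInverse (HNDual.pullback 𝓕 V E) (fun x => i.toPi x.base)
    (fun x => i.adj x.base) i.continuous_toPi (fun x => i.adj_toPi x.base)
    fun x _ => i.adj_eq_zero x.base

variable {σ : ∀ x : HNDual 𝓕, E x.base →ₗ[ℂ] F x.base}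

theorem HermitianEmbedding.continuous_graphMap
    (hσ : Continuous (fun e : (HNDual.pullback 𝓕 V E).Total =>
      (⟨e.proj, σ e.proj e.snd⟩ : (HNDual.pullback 𝓕 W F).Total))) :
    Continuous fun e : (HNDual.pullback 𝓕 V E).Total =>
      i.graphMap j e.proj.base (σ e.proj) e.snd := by
  refine continuous_pi ?_
  rintro (k | k)
  · exact (continuous_apply k).comp i.continuous_toPi
  · exact (continuous_apply k).comp (j.continuous_toPi.comp hσ)

theorem HermitianEmbedding.continuous_graphInv
    (hσ : Continuous (fun e : (HNDual.pullback 𝓕 V E).Total =>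
      (⟨e.proj, σ e.proj e.snd⟩ : (HNDual.pullback 𝓕 W F).Total))) :
    Continuous fun z : HNDual 𝓕 × (Fin a ⊕ Fin b → ℂ) =>
      (⟨z.1, i.graphInv j z.1.base (σ z.1) z.2⟩ : (HNDual.pullback 𝓕 V E).Total) :=
  CBundle.continuous_leftInverse (HNDual.pullback 𝓕 V E)
    (fun x => i.graphMap j x.base (σ x)) (fun x => i.graphInv j x.base (σ x))
    (i.continuous_graphMap j hσ) (fun x => i.graphInv_graphMap j x.base (σ x))
    fun x _ => i.graphInv_eq_zero j x.base (σ x)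

theorem HermitianEmbedding.continuous_pushMatrix
    (hσ : Continuous (fun e : (HNDual.pullback 𝓕 V E).Total =>
      (⟨e.proj, σ e.proj e.snd⟩ : (HNDual.pullback 𝓕 W F).Total))) (k l : Fin a ⊕ Fin b) :
    Continuous fun x : HNDual 𝓕 => i.pushMatrix j x.base
      (graphProjection (σ x) - sndProjection (E x.base) (F x.base)) k l := by
  have h : ∀ x : HNDual 𝓕, i.pushMatrix j x.base
      (graphProjection (σ x) - sndProjection (E x.base) (F x.base)) k l =
      i.graphMap j x.base (σ x) (i.graphInv j x.base (σ x) (Pi.single l 1)) k -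
        inrLinear a b (j.toPi x.base (j.adj x.base
          (LinearMap.funLeft ℂ ℂ Sum.inr (Pi.single l 1)))) k := by
    intro x
    rw [← i.pushMatrix_graphProjection_mulVec, ← i.pushMatrix_sndProjection_mulVec,
      i.pushMatrix_sub]
    simp
  simp only [h]
  refine Continuous.sub ?_ ?_
  · exact (continuous_apply k).comp ((i.continuous_graphMap j hσ).comp
      ((i.continuous_graphInv j hσ).comp (continuous_id.prodMk continuous_const)))
  · exact (continuous_apply k).comp ((inrLinear a b).continuous_of_finiteDimensional.comp
      (j.continuous_toPi.comp (j.continuous_adj.comp (continuous_id.prodMk continuous_const))))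

theorem HermitianEmbedding.tendsto_pushMatrix
    (hσ : ∀ ε : ℝ, 0 < ε → ∃ K : Set (HNDual 𝓕), IsCompact K ∧ ∀ x ∉ K,
      Function.Bijective (σ x) ∧ ∀ v, ‖v‖ ≤ ε * ‖σ x v‖) (k l : Fin a ⊕ Fin b) :
    Tendsto (fun x : HNDual 𝓕 => i.pushMatrix j x.base
      (graphProjection (σ x) - sndProjection (E x.base) (F x.base)) k l)
      (cocompact (HNDual 𝓕)) (𝓝 0) := by
  refine Metric.tendsto_nhds.2 fun ε hε => ?_
  obtain ⟨K, hK, h⟩ := hσ (ε / 6) (by positivity)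
  filter_upwards [hK.compl_mem_cocompact] with x hx
  rw [dist_zero_right]
  refine (i.norm_pushMatrix_le j x.base _ (C := 3 * (ε / 6)) (by positivity)
    (norm_graphProjection_sub_le (σ x) (by positivity) (h x hx).1.2 (h x hx).2) k l).trans_lt ?_
  linarith

end GraphClass

theorem mainTheorem9 {p q : ℕ} {M : Type u} [TopologicalSpace M] [CompactSpace M] [T2Space M]
    [ChartedSpace (FolModel p q) M] [IsManifold 𝓘(ℝ, FolModel p q) ∞ M]
    (𝓕 : Foliation p q M)
    -- Smooth complex vector bundles `E` and `F` with model fibres `V` and `W`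
    {V : Type*} [NormedAddCommGroup V] [NormedSpace ℂ V] [FiniteDimensional ℂ V]
    {W : Type*} [NormedAddCommGroup W] [NormedSpace ℂ W] [FiniteDimensional ℂ W]
    {E : M → Type v} [TopologicalSpace (TotalSpace V E)] [∀ m, NormedAddCommGroup (E m)]
    [∀ m, InnerProductSpace ℂ (E m)] [∀ m, FiniteDimensional ℂ (E m)] [FiberBundle V E]
    [VectorBundle ℂ V E] [VectorBundle ℝ V E] [ContMDiffVectorBundle ∞ V E 𝓘(ℝ, FolModel p q)]
    {F : M → Type v} [TopologicalSpace (TotalSpace W F)] [∀ m, NormedAddCommGroup (F m)]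
    [∀ m, InnerProductSpace ℂ (F m)] [∀ m, FiniteDimensional ℂ (F m)] [FiberBundle W F]
    [VectorBundle ℂ W F] [VectorBundle ℝ W F] [ContMDiffVectorBundle ∞ W F 𝓘(ℝ, FolModel p q)]
    -- The Hermitian metrics of `E` and `F` are continuous
    (hE : Continuous fun z : TotalSpace V E => ‖z.snd‖)
    (hF : Continuous fun z : TotalSpace W F => ‖z.snd‖)
    -- `P` is a differential operator of weighted order `d ≥ 1` with invertible symbol `σ = σ_H(P)`
    (P : Cₛ^∞⟮𝓘(ℝ, FolModel p q); V, E⟯ → Cₛ^∞⟮𝓘(ℝ, FolModel p q); W, F⟯) (d : ℕ) (hd : 0 < d)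
    (σ : ∀ x : HNDual 𝓕, E x.base →ₗ[ℂ] F x.base) (hσ : IsWeightedPrincipalSymbol 𝓕 P d σ)
    (hinv : ∀ x : HNDual 𝓕, ¬ (x.ξ = 0 ∧ x.η = 0) → Function.Bijective (σ x)) :
    -- `(π*E, π*F, σ)` is a triple, `E` and `F` embed isometrically in trivial bundles, and for all
    -- such embeddings the canonical map takes the graph projection class of `σ` to the triple
    ∃ hT : ∃ K : Set (HNDual 𝓕), IsCompact K ∧
        CBundle.ContOn (HNDual.pullback 𝓕 V E) (HNDual.pullback 𝓕 W F) σ Kᶜ ∧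
        ∀ x ∉ K, Function.Bijective (σ x),
      (∃ a : ℕ, Nonempty (HermitianEmbedding V E a)) ∧
      (∃ b : ℕ, Nonempty (HermitianEmbedding W F b)) ∧
      ∀ (a b : ℕ) (i : HermitianEmbedding V E a) (j : HermitianEmbedding W F b),
        ∃ c : K0 C₀(HNDual 𝓕, ℂ), IsGraphProjectionClass σ i j c ∧
          K0.toKTop (HNDual 𝓕) c =
            KTop.mk ⟨HNDual.pullback 𝓕 V E, HNDual.pullback 𝓕 W F, σ, hT⟩ := by
  have hK := fun ε (hε : (0 : ℝ) < ε) => hσ.exists_compact_norm_le hE hF hd hinv hε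
  have hc := hσ.continuous
  have hT : ∃ K : Set (HNDual 𝓕), IsCompact K ∧
      CBundle.ContOn (HNDual.pullback 𝓕 V E) (HNDual.pullback 𝓕 W F) σ Kᶜ ∧
      ∀ x ∉ K, Function.Bijective (σ x) := by
    obtain ⟨K, hKc, h⟩ := hK 1 one_pos
    exact ⟨K, hKc, hc.continuousOn, fun x hx => (h x hx).1⟩
  refine ⟨hT, exists_hermitianEmbedding hE, exists_hermitianEmbedding hF, fun a b i j => ?_⟩
  obtain ⟨e, he, hs, hx⟩ := exists_isStarProjection_unitization _ (i.continuous_pushMatrix j hc)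
    (i.tendsto_pushMatrix j hK) fun x => i.isStarProjection_graphMatrix j x.base (σ x)
  have hs' : e.map (scalarPart C₀(HNDual 𝓕, ℂ)) =
      (blockOne a b (Unitization ℂ C₀(HNDual 𝓕, ℂ))).map (scalarPart C₀(HNDual 𝓕, ℂ)) :=
    hs.trans (blockOne_map a b
      (scalarPart C₀(HNDual 𝓕, ℂ) : Unitization ℂ C₀(HNDual 𝓕, ℂ) →+* ℂ)).symm
  refine ⟨K0.diff finSumFinEquiv e (blockOne a b _) he (isStarProjection_blockOne a b _) hs',
    ⟨e, he, hs', hx, rfl⟩, (K0.toKTop_diff e he hs').trans ?_⟩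
  exact MatProj.mk_triple_ofMatrix (B₀ := HNDual.pullback 𝓕 V E) (B₁ := HNDual.pullback 𝓕 W F) σ hT
    (fun x => i.graphMap j x.base (σ x)) (fun x => i.graphInv j x.base (σ x))
    (fun x => j.toPi x.base) (fun x => j.adj x.base) (i.continuous_graphMap j hc)
    (i.continuous_graphInv j hc) j.continuous_toPi j.continuous_adj
    (fun x => i.funLeft_graphMap j x.base (σ x)) (fun x => i.graphInv_graphMap j x.base (σ x))
    (fun x => j.adj_toPi x.base) (fun x _ => i.graphInv_inrLinear j x.base (σ x)) e he hs
    fun x z => (congrArg (· *ᵥ z) (hx x)).trans (i.graphMatrix_mulVec j x.base (σ x) z)
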